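/- For a finite abelian group $G$, a $d$-dimensional \emph{coset progression} in $G$ is a set of the form $$M=H+\{x_0+l_1x_1+\dots+l_dx_d : 0\le l_i<L_i \text{ for } 1\le i\le d\},$$ where $H\le G$ is a subgroup, $x_0,\dots,x_d\in G$ and $L_1,\dots,L_d\ge 1$ are integers; it is \emph{proper} if the sums $h+x_0+l_1x_1+\dots+l_dx_d$ with $h\in H$ and $0\le l_i<L_i$ are pairwise distinct. For $f:G\to\mathbb{R}$ and a measure $\mu$ on $G$ write $f\ast\mu(x)=\int f(x-y)\,d\mu(y)$, and $\|g\|_\infty=\max_{x\in G}|g(x)|$. \textbf{Theorem.} There is an absolute constant $C>0$ such that the following holds. Let $G$ be a finite abelian group, let $A,S\subset G$ be non-empty sets with $|A+S|\le K\min\{|A|,|S|\}$ (so $K\ge 1$), and let $\epsilon\in(0,1]$. Put $D=C\epsilon^{-2}(\log(\epsilon^{-1}K))^{6}$. Then there are an integer $0\le d\le D$ and a proper $d$-dimensional coset progression $M$ in $G$ with $$|M|\ \ge\ \left(\frac{\epsilon}{\max\{\epsilon,\,2\log K\}}\right)^{D}|A+S|$$ (that is, $|M|\ge(\epsilon/(2\log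 K))^{D}|A+S|$ if $2\log K\ge\epsilon$, and $|M|\ge|A+S|$ otherwise), such that for every probability measure $\mu$ supported on $M$ $$\|1_{A+S}\ast\mu\|_{\infty}\ge 1-\epsilon\qquad\text{and}\qquad \|1_A\ast\mu\|_{\infty}\ge(1-\epsilon)\frac{|A|}{|A+S|}.$$ -/

import Mathlib

open scoped Pointwise

universe u

/-- A `d`-dimensional coset progression in an abelian group `G`: the data of a subgroup `H`, a base
point `x₀`, generators `x₁, …, x_d` and lengths `L₁, …, L_d ≥ 1`, describing the set
`H + {x₀ + l₁ x₁ + ⋯ + l_d x_d : 0 ≤ l_i < L_i}`. -/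
structure CosetProgression (G : Type u) [AddCommGroup G] (d : ℕ) where
  subgroup : AddSubgroup G
  base : G
  gen : Fin d → G
  len : Fin d → ℕ
  len_pos : ∀ i, 0 < len i

namespace CosetProgression

/-- The parametrisation `(h, l) ↦ h + x₀ + l₁ x₁ + ⋯ + l_d x_d` of a coset progression. -/
def param {G : Type u} [AddCommGroup G] {d : ℕ} (M : CosetProgression G d)
    (p : M.subgroup × ((i : Fin d) → Fin (M.len i))) : G :=
  (p.1 : G) + (M.base + ∑ i, (p.2 i : ℕ) • M.gen i)

/-- The underlying set of a coset progression. -/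
def carrier {G : Type u} [AddCommGroup G] {d : ℕ} (M : CosetProgression G d) : Set G :=
  Set.range M.param

/-- A coset progression is proper if all the sums `h + x₀ + l₁ x₁ + ⋯ + l_d x_d` are distinct. -/
def Proper {G : Type u} [AddCommGroup G] {d : ℕ} (M : CosetProgression G d) : Prop :=
  Function.Injective M.param

end CosetProgression

/-- The convolution `f ∗ μ (x) = ∫ f (x - y) dμ(y)` of a function with a measure. -/
noncomputable def convMeasure {G : Type u} [AddCommGroup G] [MeasurableSpace G]
    (f : G → ℝ) (μ : MeasureTheory.Measure G) : G → ℝ :=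
  fun x => ∫ y, f (x - y) ∂μ

/-- The indicator function of a finite set. -/
noncomputable def indicatorFn {G : Type u} (A : Finset G) : G → ℝ :=
  Set.indicator (A : Set G) 1

/-! The invariance of `A + S` under a shift y is measured by `overlap A S y`, the proportion of
pairs (a, s) with a + s + y in `A + S`. It equals 1 at 0. If it is at least 1 - ε at y and -y for
every y in M, then averaging over a probability measure on M and interchanging sums gives both
conclusions (`one_sub_le_norm_convMeasure_of_overlap`). So a large proper progression of
near-periods of the overlap is wanted.

Croot–Sisask sampling (`exists_almost_periods`) gives T ⊆ A with |A| ≤ 2K^m|T| such that, for X = T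
- T, shifts by elements of kX change the overlap by at most ε/8. This has two uses. First, averaging
k times over X damps every character outside the large spectrum of X, while the Fourier coefficients
of the overlap have ℓ¹ norm at most √K; hence the overlap is near 1 wherever the large spectrum is
near 1 (`overlap_ge_of_bohr`). Second, kX ⊆ A - A + (S - S), so the Plünnecke–Ruzsa inequality and
Chang's covering lemma give X polynomial growth (`card_nsmul_le_pow_of_exp`).

It remains to find a progression on which the large spectrum of X is near 1. A local form of Chang's
theorem (`exists_subset_annihilating_spectrum`) finds a large Z ⊆ 2X on which the whole spectrum is
moderately close to 1. Recording the phases of the spectrum lifts Z to G × ℝ^Δ. The lift has the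
same growth as Z, so its phases generate a lattice of small rank. Small integer combinations of
successively shortest lattice vectors, together with the fibre over phase 0 as subgroup, form the
progression (`exists_cosetProgression_of_annihilating`). Its size is controlled by a halving
argument that plays the role of Minkowski's second theorem.

This route costs constants in the exponent, so it needs 2 log K / ε bounded away from 1 from above.
The remaining cases are K < 3/2, or K < 5/3 with ε > 1/2. There Hamidoune's atoms show that `A + S`
is a coset of a subgroup or sits in very few cosets of one, and M can be written down
(`exists_cosetProgression_of_small_sumset`). -/

set_option linter.unusedSectionVars false

/-! ### Coset progressions of dimension 0 and 1. -/

section SmallProgressions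

variable {G : Type u} [AddCommGroup G]

/-- A subgroup as a coset progression of dimension `0`. -/
def CosetProgression.ofAddSubgroup (H : AddSubgroup G) : CosetProgression G 0 where
  subgroup := H
  base := 0
  gen := Fin.elim0
  len := Fin.elim0
  len_pos i := i.elim0

theorem CosetProgression.ofAddSubgroup_param (H : AddSubgroup G) (p) :
    (CosetProgression.ofAddSubgroup H).param p = (p.1 : G) := by
  simp [CosetProgression.param, CosetProgression.ofAddSubgroup]

theorem CosetProgression.ofAddSubgroup_carrier (H : AddSubgroup G) :
    (CosetProgression.ofAddSubgroup H).carrier = H := by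
  ext x
  constructor
  · rintro ⟨p, rfl⟩
    rw [CosetProgression.ofAddSubgroup_param]
    exact p.1.2
  · intro hx
    exact ⟨(⟨x, hx⟩, fun i => i.elim0), CosetProgression.ofAddSubgroup_param H _⟩

theorem CosetProgression.ofAddSubgroup_proper (H : AddSubgroup G) :
    (CosetProgression.ofAddSubgroup H).Proper := by
  intro p q hpq
  rw [CosetProgression.ofAddSubgroup_param, CosetProgression.ofAddSubgroup_param] at hpq
  exact Prod.ext (Subtype.ext hpq) (funext fun i => i.elim0)

/-- The coset progression `H + {0, x, 2x}`. -/
def CosetProgression.threeTerm (H : AddSubgroup G) (x : G) : CosetProgression G 1 where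
  subgroup := H
  base := 0
  gen _ := x
  len _ := 3
  len_pos _ := by norm_num

theorem CosetProgression.threeTerm_param (H : AddSubgroup G) (x : G) (p) :
    (CosetProgression.threeTerm H x).param p = (p.1 : G) + ((p.2 0 : Fin 3) : ℕ) • x := by
  simp [CosetProgression.param, CosetProgression.threeTerm]

theorem CosetProgression.threeTerm_proper (H : AddSubgroup G) (x : G) (h1 : x ∉ H)
    (h2 : 2 • x ∉ H) : (CosetProgression.threeTerm H x).Proper := by
  intro p q hpq
  rw [CosetProgression.threeTerm_param, CosetProgression.threeTerm_param] at hpq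
  obtain ⟨⟨a, ha⟩, u⟩ := p
  obtain ⟨⟨b, hb⟩, v⟩ := q
  simp only at hpq
  have key : ∀ i j : Fin 3, a + (i : ℕ) • x = b + (j : ℕ) • x → (i : ℕ) < j → False := by
    intro i j hij hlt
    have hab : ((j : ℕ) - (i : ℕ)) • x ∈ H := by
      rw [sub_nsmul x hlt.le]
      have : (j : ℕ) • x + -((i : ℕ) • x) = a - b := by
        rw [← sub_eq_add_neg, sub_eq_sub_iff_add_eq_add, add_comm, ← hij]
      rw [this]
      exact H.sub_mem ha hb
    have : (j : ℕ) - (i : ℕ) = 1 ∨ (j : ℕ) - (i : ℕ) = 2 := by omega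
    rcases this with h | h <;> rw [h] at hab
    · exact h1 (by simpa using hab)
    · exact h2 hab
  have key' : ∀ i j : Fin 3, b + (i : ℕ) • x = a + (j : ℕ) • x → (i : ℕ) < j → False := by
    intro i j hij hlt
    have hab : ((j : ℕ) - (i : ℕ)) • x ∈ H := by
      rw [sub_nsmul x hlt.le]
      have : (j : ℕ) • x + -((i : ℕ) • x) = b - a := by
        rw [← sub_eq_add_neg, sub_eq_sub_iff_add_eq_add, add_comm, ← hij]
      rw [this]
      exact H.sub_mem hb ha
    have : (j : ℕ) - (i : ℕ) = 1 ∨ (j : ℕ) - (i : ℕ) = 2 := by omega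
    rcases this with h | h <;> rw [h] at hab
    · exact h1 (by simpa using hab)
    · exact h2 hab
  have huv : (u 0 : Fin 3) = v 0 := by
    rcases lt_trichotomy ((u 0 : Fin 3) : ℕ) ((v 0 : Fin 3) : ℕ) with h | h | h
    · exact (key _ _ hpq h).elim
    · exact Fin.ext h
    · exact (key' _ _ hpq.symm h).elim
  have huv' : u = v := by
    funext i
    fin_cases i
    exact huv
  subst huv'
  have : a = b := by simpa using hpq
  subst this
  rfl

end SmallProgressions

/-! ### Sumsets with constant below 5/3, via atoms. -/

section SmallDoubling

variable {G : Type u} [AddCommGroup G] [DecidableEq G]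

/-- Hamidoune's atom theorem: the sets `X` with `X + S` a proper part of `L` that have the
least boundary `|X + S| - |X|`, and the least size among those, are cosets of a subgroup. -/
theorem exists_addSubgroup_least_boundary [Fintype G] (L : AddSubgroup G) (LF S : Finset G)
    (hLF : ∀ x, x ∈ LF ↔ x ∈ L) (hS : S ⊆ LF)
    (hex : ∃ X : Finset G, X ⊆ LF ∧ X.Nonempty ∧ X + S ≠ LF) :
    ∃ (H : AddSubgroup G) (HF : Finset G), (∀ x, x ∈ HF ↔ x ∈ H) ∧ HF ⊆ LF ∧ HF + S ≠ LF ∧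
      ∀ X : Finset G, X ⊆ LF → X.Nonempty → X + S ≠ LF →
        (HF + S).card + X.card ≤ (X + S).card + HF.card := by
  classical
  let F : Finset (Finset G) := Finset.univ.filter fun X => X ⊆ LF ∧ X.Nonempty ∧ X + S ≠ LF
  have hF : ∀ X, X ∈ F ↔ X ⊆ LF ∧ X.Nonempty ∧ X + S ≠ LF := by simp [F]
  have hFne : F.Nonempty := by
    obtain ⟨X, hX⟩ := hex
    exact ⟨X, (hF X).2 hX⟩
  -- The weight `c` exceeds every cardinality, so minimising `c * bd X + X.card` is a lexicographic
  -- minimisation: boundary first, then size.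
  let c : ℤ := Fintype.card G + 1
  let bd : Finset G → ℤ := fun X => (X + S).card - X.card
  obtain ⟨N, hNF, hmin⟩ := F.exists_min_image (fun X => c * bd X + X.card) hFne
  have hcard : ∀ X : Finset G, (X.card : ℤ) < c := fun X => by
    have := X.card_le_univ
    simp only [c]; omega
  have hbd : ∀ Y ∈ F, bd N ≤ bd Y := by
    intro Y hY
    by_contra! hlt
    have h1 := hmin Y hY
    have h2 := hcard Y
    have h3 : (0 : ℤ) ≤ N.card := by positivity
    have h4 : (0 : ℤ) < c := by simp only [c]; positivity
    nlinarith
  have hsz : ∀ Y ∈ F, bd Y ≤ bd N → N.card ≤ Y.card := by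
    intro Y hY hle
    have h1 := hmin Y hY
    have h2 : bd Y = bd N := le_antisymm hle (hbd Y hY)
    simp only [h2] at h1
    omega
  have haddL : ∀ X ⊆ LF, X + S ⊆ LF := by
    intro X hX y hy
    obtain ⟨x, hx, s, hs, rfl⟩ := Finset.mem_add.1 hy
    exact (hLF _).2 (L.add_mem ((hLF _).1 (hX hx)) ((hLF _).1 (hS hs)))
  obtain ⟨hNL, hNne, hNS⟩ := (hF N).1 hNF
  -- the dual set
  have hdual : N.card + (N + S).card ≤ LF.card := by
    set Nd := LF \ (N + S) with hNd
    have hNdne : Nd.Nonempty := by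
      rw [hNd, Finset.sdiff_nonempty]
      exact fun h => hNS (Finset.Subset.antisymm (haddL N hNL) h)
    have hsub : -Nd ⊆ LF := by
      intro x hx
      have : -x ∈ LF := (Finset.mem_sdiff.1 (Finset.mem_neg'.1 hx)).1
      have := L.neg_mem ((hLF _).1 this)
      rw [neg_neg] at this
      exact (hLF _).2 this
    -- This inclusion shows that the boundary of `-Nd` is at most that of `N`. The second minimality
    -- property then gives |N| ≤ |Nd|.
    have hdisj : -Nd + S ⊆ LF \ (-N) := by
      intro y hy
      refine Finset.mem_sdiff.2 ⟨haddL _ hsub hy, fun hyN => ?_⟩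
      obtain ⟨x, hx, s, hs, rfl⟩ := Finset.mem_add.1 hy
      have h1 := Finset.mem_neg'.1 hx
      have h2 := Finset.mem_neg'.1 hyN
      refine (Finset.mem_sdiff.1 h1).2 (Finset.mem_add.2 ⟨_, h2, s, hs, by abel⟩)
    have hnegN : -N ⊆ LF := by
      intro x hx
      have := L.neg_mem ((hLF _).1 (hNL (Finset.mem_neg'.1 hx)))
      rw [neg_neg] at this
      exact (hLF _).2 this
    have hmem : -Nd ∈ F := by
      refine (hF _).2 ⟨hsub, hNdne.neg, fun h => ?_⟩
      obtain ⟨x, hx⟩ := hNne.neg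
      have : x ∈ -Nd + S := h ▸ hnegN hx
      exact (Finset.mem_sdiff.1 (hdisj this)).2 hx
    have hc1 : (-Nd + S).card + N.card ≤ LF.card := by
      have := Finset.card_le_card hdisj
      rw [Finset.card_sdiff_of_subset hnegN, Finset.card_neg] at this
      have h2 : N.card ≤ LF.card := Finset.card_le_card hNL
      omega
    have hc2 : Nd.card + (N + S).card = LF.card := by
      rw [hNd, Finset.card_sdiff_of_subset (haddL N hNL)]
      have := Finset.card_le_card (haddL N hNL)
      omega
    have : N.card ≤ (-Nd).card := by
      refine hsz _ hmem ?_
      simp only [bd, Finset.card_neg]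
      omega
    rw [Finset.card_neg] at this
    omega
  have htr : ∀ x ∈ L, ((({x} : Finset G) + N) ∩ N).Nonempty → ({x} : Finset G) + N = N := by
    intro x hx hI
    set N' := ({x} : Finset G) + N with hN'
    have hN'L : N' ⊆ LF := by
      intro y hy
      obtain ⟨z, hz, n, hn, rfl⟩ := Finset.mem_add.1 hy
      rw [Finset.mem_singleton.1 hz]
      exact (hLF _).2 (L.add_mem hx ((hLF _).1 (hNL hn)))
    have hcN' : N'.card = N.card := Finset.card_singleton_add ..
    have hcN'S : (N' + S).card = (N + S).card := by
      rw [hN', add_assoc, Finset.card_singleton_add]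
    have hIF : N' ∩ N ∈ F := by
      refine (hF _).2 ⟨Finset.inter_subset_right.trans hNL, hI, fun h => hNS ?_⟩
      refine Finset.Subset.antisymm (haddL N hNL) ?_
      rw [← h]
      exact Finset.add_subset_add_right Finset.inter_subset_right
    -- Submodularity of X ↦ |X + S|. If the union is admissible, intersection and union both attain
    -- the least boundary, so the intersection is no smaller than `N`. If the union plus `S` fills
    -- `LF`, the inequality contradicts `hdual`, since the intersection is non-empty.
    have h1 : (N' ∩ N + S).card + (N' ∪ N + S).card ≤ (N' + S).card + (N + S).card := by
      rw [Finset.union_add, ← Finset.card_inter_add_card_union (N' + S) (N + S)]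
      gcongr
      exact Finset.inter_add_subset
    have h2 := Finset.card_inter_add_card_union N' N
    have hbI := hbd _ hIF
    have hIpos := hI.card_pos
    have hIle : N.card ≤ (N' ∩ N).card := by
      by_cases hU : N' ∪ N + S = LF
      · exfalso
        rw [hU] at h1
        simp only [bd] at hbI
        omega
      · have hUF : N' ∪ N ∈ F :=
          (hF _).2 ⟨Finset.union_subset hN'L hNL, hNne.mono Finset.subset_union_right, hU⟩
        have hbU := hbd _ hUF
        refine hsz _ hIF ?_
        simp only [bd] at hbU hbI ⊢
        omega
    have h3 := Finset.eq_of_subset_of_card_le Finset.inter_subset_right hIle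
    have h4 : N ⊆ N' := by
      rw [← h3]; exact Finset.inter_subset_left
    exact (Finset.eq_of_subset_of_card_le h4 hcN'.le).symm
  obtain ⟨n, hn⟩ := hNne
  have hnL : n ∈ L := (hLF _).1 (hNL hn)
  -- Translates of `N` that meet are equal, so the translate of `N` through 0 is a subgroup.
  let N0 : Finset G := ({-n} : Finset G) + N
  have hN0 : ∀ x, x ∈ N0 ↔ n + x ∈ N := by
    intro x
    simp only [N0, Finset.mem_add, Finset.mem_singleton]
    constructor
    · rintro ⟨_, rfl, y, hy, rfl⟩; simpa using hy
    · intro h; exact ⟨_, rfl, _, h, by abel⟩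
  have hstab : ∀ a ∈ N0, ({a} : Finset G) + N = N := by
    intro a ha
    have ha' := (hN0 a).1 ha
    refine htr a ?_ ⟨n + a, Finset.mem_inter.2 ⟨?_, ha'⟩⟩
    · have := L.sub_mem ((hLF _).1 (hNL ha')) hnL
      simpa using this
    · exact Finset.mem_add.2 ⟨a, by simp, n, hn, by abel⟩
  let H : AddSubgroup G :=
    { carrier := N0
      zero_mem' := by
        rw [Finset.mem_coe, hN0]; simpa using hn
      add_mem' := by
        intro a b ha hb
        rw [Finset.mem_coe] at *
        rw [hN0, ← hstab a ha]
        exact Finset.mem_add.2 ⟨a, by simp, n + b, (hN0 b).1 hb, by abel⟩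
      neg_mem' := by
        intro a ha
        rw [Finset.mem_coe] at *
        have : n ∈ ({a} : Finset G) + N := by rw [hstab a ha]; exact hn
        obtain ⟨b, hb, y, hy, hay⟩ := Finset.mem_add.1 this
        rw [Finset.mem_singleton.1 hb] at hay
        rw [hN0]
        convert hy using 1
        rw [← hay]; abel }
  have hcN0 : N0.card = N.card := Finset.card_singleton_add ..
  have hcN0S : (N0 + S).card = (N + S).card := by
    simp only [N0]; rw [add_assoc, Finset.card_singleton_add]
  have hN0L : N0 ⊆ LF := by
    intro x hx
    have := L.sub_mem ((hLF _).1 (hNL ((hN0 x).1 hx))) hnL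
    exact (hLF _).2 (by simpa using this)
  refine ⟨H, N0, fun x => Iff.rfl, hN0L, ?_, ?_⟩
  · intro h
    apply hNS
    refine Finset.eq_of_subset_of_card_le (haddL N hNL) ?_
    rw [← hcN0S, h]
  · intro X hX hXne hXS
    have := hbd X ((hF X).2 ⟨hX, hXne, hXS⟩)
    simp only [bd] at this
    omega


/-- The translates a + S and a' + S both lie in `A + S`, which is too small to contain them
disjointly. -/
theorem sub_subset_sub_of_card_add_lt {A S : Finset G} (h : (A + S).card < 2 * S.card) :
    A - A ⊆ S - S := by
  intro x hx
  obtain ⟨a, ha, a', ha', rfl⟩ := Finset.mem_sub.1 hx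
  have h1 : ¬ Disjoint (({a} : Finset G) + S) ({a'} + S) := by
    intro hd
    have hsub : (({a} : Finset G) + S) ∪ ({a'} + S) ⊆ A + S :=
      Finset.union_subset (Finset.add_subset_add_right (by simpa using ha))
        (Finset.add_subset_add_right (by simpa using ha'))
    have := Finset.card_le_card hsub
    rw [Finset.card_union_of_disjoint hd, Finset.card_singleton_add,
      Finset.card_singleton_add] at this
    omega
  obtain ⟨y, hy, hy'⟩ := Finset.not_disjoint_iff.1 h1
  obtain ⟨_, rfl', s, hs, rfl⟩ := Finset.mem_add.1 hy
  obtain ⟨_, hb', s', hs', hss⟩ := Finset.mem_add.1 hy'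
  rw [Finset.mem_singleton.1 hb', Finset.mem_singleton.1 rfl'] at hss
  refine Finset.mem_sub.2 ⟨s', hs', s, hs, ?_⟩
  rw [sub_eq_sub_iff_add_eq_add, add_comm, hss]

/-- Sets with `|A + S| < 5/3 min(|A|, |S|)`: after translation, either `A + S` is a subgroup, or
`A` and `S` have at most three possible differences modulo a subgroup `H` of which `S` meets
exactly two cosets. -/
theorem structure_of_small_sumset [Fintype G] {A S : Finset G} (hA : A.Nonempty) (hS : S.Nonempty)
    (h1 : 3 * (A + S).card < 5 * A.card) (h2 : 3 * (A + S).card < 5 * S.card) :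
    (∃ L : AddSubgroup G, ∃ LF : Finset G, ∃ t : G, (∀ x, x ∈ LF ↔ x ∈ L) ∧
        A + S = {t} + LF) ∨
      (¬ (2 * (A + S).card < 3 * A.card ∧ 2 * (A + S).card < 3 * S.card) ∧ ∃ H : AddSubgroup G, ∃ HF : Finset G, ∃ x : G, ∃ s ∈ S,
        (∀ x, x ∈ HF ↔ x ∈ H) ∧ x ∉ H ∧
        (∀ y ∈ S, y - s ∈ H ∨ y - s - x ∈ H) ∧ A - A ⊆ S - S ∧
        5 * HF.card ≤ 2 * (A + S).card) := by
  classical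
  obtain ⟨a0, ha0⟩ := hA
  obtain ⟨s0, hs0⟩ := hS
  have hD : A - A ⊆ S - S := sub_subset_sub_of_card_add_lt (by omega)
  set L : AddSubgroup G := AddSubgroup.closure (S - S : Finset G) with hL
  set LF : Finset G := Finset.univ.filter (· ∈ L) with hLFdef
  have hLF : ∀ x, x ∈ LF ↔ x ∈ L := by simp [LF]
  set A0 : Finset G := {-a0} + A with hA0
  set S0 : Finset G := {-s0} + S with hS0
  have hmemS0 : ∀ x, x ∈ S0 ↔ s0 + x ∈ S := by
    intro x
    simp only [hS0, Finset.mem_add, Finset.mem_singleton]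
    constructor
    · rintro ⟨_, rfl, y, hy, rfl⟩; simpa using hy
    · intro h; exact ⟨_, rfl, _, h, by abel⟩
  have hS0L : S0 ⊆ LF := by
    intro x hx
    refine (hLF _).2 (AddSubgroup.subset_closure ?_)
    exact Finset.mem_sub.2 ⟨_, (hmemS0 x).1 hx, s0, hs0, by abel⟩
  have hA0L : A0 ⊆ LF := by
    intro x hx
    refine (hLF _).2 (AddSubgroup.subset_closure (hD ?_))
    obtain ⟨b, hb, a, ha, rfl⟩ := Finset.mem_add.1 hx
    rw [Finset.mem_singleton.1 hb]
    exact Finset.mem_sub.2 ⟨a, ha, a0, ha0, by abel⟩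
  have hW0 : A0 + S0 = {-(a0 + s0)} + (A + S) := by
    rw [hA0, hS0, add_add_add_comm, Finset.singleton_add_singleton]
    congr 2; abel
  have hW : A + S = {a0 + s0} + (A0 + S0) := by
    rw [hW0, ← add_assoc, Finset.singleton_add_singleton, add_neg_cancel, Finset.singleton_zero,
      zero_add]
  have hcW : (A0 + S0).card = (A + S).card := by rw [hW0, Finset.card_singleton_add]
  have hcA : A0.card = A.card := Finset.card_singleton_add ..
  have hcS : S0.card = S.card := Finset.card_singleton_add ..
  by_cases hcase : A0 + S0 = LF
  · exact Or.inl ⟨L, LF, a0 + s0, hLF, by rw [hW, hcase]⟩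
  right
  have hA0ne : A0.Nonempty := ⟨0, Finset.mem_add.2 ⟨-a0, by simp, a0, ha0, by simp⟩⟩
  have h0S0 : (0 : G) ∈ S0 := by rw [hmemS0]; simpa using hs0
  obtain ⟨H, HF, hHF, hHL, hHS, hleast⟩ := exists_addSubgroup_least_boundary L LF S0 hLF hS0L
    ⟨A0, hA0L, hA0ne, hcase⟩
  -- With `A0` as competitor, |H + S0| - |H| ≤ |A + S| - |A| < (2/3)|S| ≤ (2/3)|H + S0|. So H + S0
  -- consists of fewer than three cosets of H. It has at least two, because H + S0 ≠ L prevents `S0`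
  -- from lying in H; hence also |H| ≤ |A + S| - |A|.
  have hb := hleast A0 hA0L hA0ne hcase
  have h0H : (0 : G) ∈ HF := (hHF 0).2 H.zero_mem
  have hSH : S0 ⊆ HF + S0 := Finset.subset_add_right _ h0H
  have hSHc := Finset.card_le_card hSH
  have hlt3 : (HF + S0).card < 3 * HF.card := by omega
  have hx : ∃ x ∈ S0, x ∉ H := by
    by_contra! hcon
    have hle : L ≤ H := by
      rw [hL, AddSubgroup.closure_le]
      intro y hy
      obtain ⟨s, hs, s', hs', rfl⟩ := Finset.mem_sub.1 hy
      have e1 := hcon (s - s0) ((hmemS0 _).2 (by simpa using hs))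
      have e2 := hcon (s' - s0) ((hmemS0 _).2 (by simpa using hs'))
      have := H.sub_mem e1 e2
      simpa using this
    apply hHS
    have : HF = LF := Finset.Subset.antisymm hHL fun y hy => (hHF y).2 (hle ((hLF y).1 hy))
    refine Finset.Subset.antisymm ?_ ?_
    · intro y hy
      obtain ⟨p, hp, q, hq, rfl⟩ := Finset.mem_add.1 hy
      exact (hLF _).2 (L.add_mem ((hLF _).1 (hHL hp)) ((hLF _).1 (hS0L hq)))
    · rw [← this]; exact Finset.subset_add_left _ h0S0
  obtain ⟨x, hxS, hxH⟩ := hx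
  have hdisj : ∀ y z : G, z - y ∉ H → Disjoint (HF + {y}) (HF + {z}) := by
    intro y z hyz
    rw [Finset.disjoint_left]
    intro w hw hw'
    obtain ⟨p, hp, q, hq, rfl⟩ := Finset.mem_add.1 hw
    obtain ⟨p', hp', q', hq', he⟩ := Finset.mem_add.1 hw'
    rw [Finset.mem_singleton.1 hq, Finset.mem_singleton.1 hq'] at he
    apply hyz
    have : z - y = p - p' := by rw [sub_eq_sub_iff_add_eq_add, add_comm, he]
    rw [this]
    exact H.sub_mem ((hHF _).1 hp) ((hHF _).1 hp')
  have hsubx : ∀ y ∈ S0, HF + {y} ⊆ HF + S0 := fun y hy =>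
    Finset.add_subset_add_left (by simpa using hy)
  have hge2 : 2 * HF.card ≤ (HF + S0).card := by
    have hd := hdisj 0 x (by simpa using hxH)
    have := Finset.card_le_card (Finset.union_subset (hsubx 0 h0S0) (hsubx x hxS))
    rw [Finset.card_union_of_disjoint hd, Finset.card_add_singleton,
      Finset.card_add_singleton] at this
    omega
  refine ⟨by omega, H, HF, x, s0, hs0, hHF, hxH, ?_, hD, by omega⟩
  intro y hy
  by_contra! hcon
  have hyS : y - s0 ∈ S0 := (hmemS0 _).2 (by simpa using hy)
  have hd1 := hdisj 0 x (by simpa using hxH)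
  have hd2 := hdisj 0 (y - s0) (by simpa using hcon.1)
  have hd3 := hdisj x (y - s0) hcon.2
  have := Finset.card_le_card (Finset.union_subset
    (Finset.union_subset (hsubx 0 h0S0) (hsubx x hxS)) (hsubx _ hyS))
  rw [Finset.card_union_of_disjoint (Finset.disjoint_union_left.2 ⟨hd2, hd3⟩),
    Finset.card_union_of_disjoint hd1, Finset.card_add_singleton,
    Finset.card_add_singleton, Finset.card_add_singleton] at this
  omega

/-- When `A + S` is not a coset, the differences of `A` modulo H are among 0, x, -x. If 2x or 3x
lies in H, then H together with H ± x is a subgroup, a coset of which contains `A + S`. Otherwise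
`A`, like `S`, lies in two adjacent cosets, and M = H + {0, x, 2x} works: M is proper, a translate
of it contains `A + S`, and A + S + M occupies at most five cosets, where 5|H| ≤ 2|A + S|. -/
theorem exists_cosetProgression_of_small_sumset [Fintype G] {A S : Finset G} (hA : A.Nonempty)
    (hS : S.Nonempty)
    (h1 : 3 * (A + S).card < 5 * A.card) (h2 : 3 * (A + S).card < 5 * S.card) :
    ∃ d : ℕ, ∃ M : CosetProgression G d, ∃ MF : Finset G, M.Proper ∧ (MF : Set G) = M.carrier ∧
      (A + S).card ≤ MF.card ∧
      ((d = 0 ∧ (A + S + MF).card ≤ (A + S).card) ∨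
        (d ≤ 1 ∧ ¬ (2 * (A + S).card < 3 * A.card ∧ 2 * (A + S).card < 3 * S.card) ∧
          (A + S + MF).card ≤ 2 * (A + S).card)) := by
  classical
  rcases structure_of_small_sumset hA hS h1 h2 with ⟨L, LF, t, hLF, hW⟩ |
    ⟨hK, H, HF, x, s, hs, hHF, hxH, hSH, hD, hcard⟩
  · refine ⟨0, .ofAddSubgroup L, LF, CosetProgression.ofAddSubgroup_proper L, ?_, ?_,
      Or.inl ⟨rfl, ?_⟩⟩
    · rw [CosetProgression.ofAddSubgroup_carrier]; ext y; exact hLF y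
    · rw [hW, Finset.card_singleton_add]
    · refine Finset.card_le_card ?_
      rw [hW, add_assoc]
      refine Finset.add_subset_add_left ?_
      intro y hy
      obtain ⟨p, hp, q, hq, rfl⟩ := Finset.mem_add.1 hy
      exact (hLF _).2 (L.add_mem ((hLF _).1 hp) ((hLF _).1 hq))
  obtain ⟨a0, ha0⟩ := hA
  -- the possible differences of elements of `A`
  have hDS : ∀ a ∈ A, ∀ a' ∈ A, a - a' ∈ H ∨ a - a' - x ∈ H ∨ a - a' + x ∈ H := by
    intro a ha a' ha'
    obtain ⟨y, hy, z, hz, hyz⟩ := Finset.mem_sub.1 (hD (Finset.sub_mem_sub ha ha'))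
    rw [← hyz]
    have e : y - z = (y - s) - (z - s) := by abel
    rcases hSH y hy with e1 | e1 <;> rcases hSH z hz with e2 | e2
    · left; rw [e]; exact H.sub_mem e1 e2
    · right; right
      have := H.sub_mem e1 e2
      convert this using 1; abel
    · right; left
      have := H.sub_mem e1 e2
      convert this using 1; abel
    · left
      have := H.sub_mem e1 e2
      convert this using 1; abel
  by_cases hord : 2 • x ∈ H ∨ 3 • x ∈ H
  · let H2 : AddSubgroup G :=
      { carrier := {u | u ∈ H ∨ u - x ∈ H ∨ u + x ∈ H}
        zero_mem' := Or.inl H.zero_mem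
        add_mem' := by
          intro u v hu hv
          have e2 : u - x ∈ H → v - x ∈ H → (u + v ∈ H ∨ u + v - x ∈ H ∨ u + v + x ∈ H) := by
            intro e1 e2
            rcases hord with h | h
            · left
              have := H.add_mem (H.add_mem e1 e2) h
              convert this using 1; rw [two_nsmul]; abel
            · right; right
              have := H.add_mem (H.add_mem e1 e2) h
              convert this using 1
              rw [show (3 : ℕ) = 2 + 1 from rfl, add_nsmul, two_nsmul, one_nsmul]; abel
          have e3 : u + x ∈ H → v + x ∈ H → (u + v ∈ H ∨ u + v - x ∈ H ∨ u + v + x ∈ H) := by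
            intro e1 e2
            rcases hord with h | h
            · left
              have := H.sub_mem (H.add_mem e1 e2) h
              convert this using 1; rw [two_nsmul]; abel
            · right; left
              have := H.sub_mem (H.add_mem e1 e2) h
              convert this using 1
              rw [show (3 : ℕ) = 2 + 1 from rfl, add_nsmul, two_nsmul, one_nsmul]; abel
          rcases hu with hu | hu | hu <;> rcases hv with hv | hv | hv
          · exact Or.inl (H.add_mem hu hv)
          · right; left; convert H.add_mem hu hv using 1; abel
          · right; right; convert H.add_mem hu hv using 1; abel
          · right; left; convert H.add_mem hu hv using 1; abel
          · exact e2 hu hv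
          · left; convert H.add_mem hu hv using 1; abel
          · right; right; convert H.add_mem hu hv using 1; abel
          · left; convert H.add_mem hu hv using 1; abel
          · exact e3 hu hv
        neg_mem' := by
          rintro u (hu | hu | hu)
          · exact Or.inl (H.neg_mem hu)
          · right; right; convert H.neg_mem hu using 1; abel
          · right; left; convert H.neg_mem hu using 1; abel }
    have hH2 : ∀ u, u ∈ H2 ↔ u ∈ H ∨ u - x ∈ H ∨ u + x ∈ H := fun u => Iff.rfl
    set F2 : Finset G := Finset.univ.filter (· ∈ H2) with hF2d
    have hF2 : ∀ u, u ∈ F2 ↔ u ∈ H2 := by simp [F2]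
    have hWsub : A + S ⊆ {a0 + s} + F2 := by
      intro w hw
      obtain ⟨a, ha, y, hy, rfl⟩ := Finset.mem_add.1 hw
      refine Finset.mem_add.2 ⟨a0 + s, by simp, (a - a0) + (y - s), (hF2 _).2 ?_, by abel⟩
      refine H2.add_mem (hDS a ha a0 ha0) ?_
      rcases hSH y hy with e | e
      · exact Or.inl e
      · exact Or.inr (Or.inl e)
    have hF2c : F2.card ≤ 3 * HF.card := by
      have : F2 ⊆ HF + {0, x, -x} := by
        intro u hu
        rcases (hF2 u).1 hu with e | e | e
        · exact Finset.mem_add.2 ⟨u, (hHF _).2 e, 0, by simp, by simp⟩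
        · exact Finset.mem_add.2 ⟨_, (hHF _).2 e, x, by simp, by simp⟩
        · exact Finset.mem_add.2 ⟨_, (hHF _).2 e, -x, by simp, by simp⟩
      have h3 := (Finset.card_le_card this).trans Finset.card_add_le
      have h4 : ({0, x, -x} : Finset G).card ≤ 3 := Finset.card_le_three
      nlinarith
    have hcW := Finset.card_le_card hWsub
    rw [Finset.card_singleton_add] at hcW
    refine ⟨0, .ofAddSubgroup H2, F2, CosetProgression.ofAddSubgroup_proper H2, ?_, hcW,
      Or.inr ⟨zero_le_one, hK, ?_⟩⟩
    · rw [CosetProgression.ofAddSubgroup_carrier]; ext y; exact hF2 y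
    · have : A + S + F2 ⊆ {a0 + s} + F2 := by
        refine (Finset.add_subset_add_right hWsub).trans ?_
        rw [add_assoc]
        refine Finset.add_subset_add_left ?_
        intro y hy
        obtain ⟨p, hp, q, hq, rfl⟩ := Finset.mem_add.1 hy
        exact (hF2 _).2 (H2.add_mem ((hF2 _).1 hp) ((hF2 _).1 hq))
      have := Finset.card_le_card this
      rw [Finset.card_singleton_add] at this
      omega
  · push Not at hord
    let P : ℕ → Finset G := fun n => HF + (Finset.range n).image (· • x)
    have hP : ∀ n u, u ∈ P n ↔ ∃ i < n, u - i • x ∈ H := by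
      intro n u
      simp only [P, Finset.mem_add, Finset.mem_image, Finset.mem_range]
      constructor
      · rintro ⟨p, hp, _, ⟨i, hi, rfl⟩, rfl⟩
        exact ⟨i, hi, by simpa using (hHF _).1 hp⟩
      · rintro ⟨i, hi, h⟩
        exact ⟨_, (hHF _).2 h, _, ⟨i, hi, rfl⟩, by simp⟩
    have hPc : ∀ n, (P n).card ≤ n * HF.card := by
      intro n
      refine Finset.card_add_le.trans ?_
      rw [mul_comm]
      exact Nat.mul_le_mul_right _ (Finset.card_image_le.trans (by simp))
    -- a base point for `A`
    have hbase : ∃ b : G, ∀ a ∈ A, a - b ∈ H ∨ a - b - x ∈ H := by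
      by_cases hall : ∀ a ∈ A, a - a0 ∈ H ∨ a - a0 - x ∈ H
      · exact ⟨a0, hall⟩
      · push Not at hall
        obtain ⟨a1, ha1, hn1, hn2⟩ := hall
        have e1 : a1 - a0 + x ∈ H := by
          rcases hDS a1 ha1 a0 ha0 with h | h | h
          · exact (hn1 h).elim
          · exact (hn2 h).elim
          · exact h
        -- `a1` lies one step -x below `a0`. A further step -x would put a - a0 in the class of -2x,
        -- which is none of 0, x, -x unless x, 2x or 3x is in H.
        refine ⟨a1, fun a ha => ?_⟩
        rcases hDS a ha a1 ha1 with h | h | h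
        · exact Or.inl h
        · exact Or.inr h
        · exfalso
          have e2 : a - a0 + 2 • x ∈ H := by
            convert H.add_mem h e1 using 1; rw [two_nsmul]; abel
          rcases hDS a ha a0 ha0 with h' | h' | h'
          · apply hord.1; convert H.sub_mem e2 h' using 1; abel
          · apply hord.2; convert H.sub_mem e2 h' using 1
            rw [show (3 : ℕ) = 2 + 1 from rfl, add_nsmul, one_nsmul]; abel
          · apply hxH; convert H.sub_mem e2 h' using 1; rw [two_nsmul]; abel
    obtain ⟨b, hb⟩ := hbase
    have hWsub : A + S ⊆ {b + s} + P 3 := by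
      intro w hw
      obtain ⟨a, ha, y, hy, rfl⟩ := Finset.mem_add.1 hw
      refine Finset.mem_add.2 ⟨b + s, by simp, (a - b) + (y - s), (hP _ _).2 ?_, by abel⟩
      rcases hb a ha with e1 | e1 <;> rcases hSH y hy with e2 | e2
      · exact ⟨0, by norm_num, by simpa using H.add_mem e1 e2⟩
      · exact ⟨1, by norm_num, by convert H.add_mem e1 e2 using 1; rw [one_nsmul]; abel⟩
      · exact ⟨1, by norm_num, by convert H.add_mem e1 e2 using 1; rw [one_nsmul]; abel⟩
      · exact ⟨2, by norm_num, by convert H.add_mem e1 e2 using 1; rw [two_nsmul]; abel⟩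
    have hcW := Finset.card_le_card hWsub
    rw [Finset.card_singleton_add] at hcW
    refine ⟨1, .threeTerm H x, P 3, CosetProgression.threeTerm_proper H x hxH hord.1, ?_, hcW,
      Or.inr ⟨le_rfl, hK, ?_⟩⟩
    · ext u
      rw [Finset.mem_coe, hP]
      constructor
      · rintro ⟨i, hi, h⟩
        refine ⟨(⟨_, h⟩, fun _ => ⟨i, hi⟩), ?_⟩
        rw [CosetProgression.threeTerm_param]
        simp
      · rintro ⟨p, rfl⟩
        rw [CosetProgression.threeTerm_param]
        exact ⟨(p.2 0 : Fin 3), (p.2 0 : Fin 3).2, by rw [add_sub_cancel_right]; exact p.1.2⟩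
    · have : A + S + P 3 ⊆ {b + s} + P 5 := by
        refine (Finset.add_subset_add_right hWsub).trans ?_
        rw [add_assoc]
        refine Finset.add_subset_add_left ?_
        intro y hy
        obtain ⟨p, hp, q, hq, rfl⟩ := Finset.mem_add.1 hy
        obtain ⟨i, hi, hi'⟩ := (hP _ _).1 hp
        obtain ⟨j, hj, hj'⟩ := (hP _ _).1 hq
        refine (hP _ _).2 ⟨i + j, by omega, ?_⟩
        convert H.add_mem hi' hj' using 1; rw [add_nsmul]; abel
      have := Finset.card_le_card this
      rw [Finset.card_singleton_add] at this
      have := hPc 5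
      omega

end SmallDoubling

/-! ### From overlaps to convolutions with measures. -/

section Reduction

variable {G : Type u} [AddCommGroup G] [DecidableEq G]

theorem indicatorFn_apply (A : Finset G) (x : G) : indicatorFn A x = if x ∈ A then 1 else 0 := by
  simp [indicatorFn, Set.indicator_apply]

theorem indicatorFn_nonneg (A : Finset G) (x : G) : 0 ≤ indicatorFn A x := by
  rw [indicatorFn_apply]; split_ifs <;> norm_num

theorem indicatorFn_le_one (A : Finset G) (x : G) : indicatorFn A x ≤ 1 := by
  rw [indicatorFn_apply]; split_ifs <;> norm_num

/-- The proportion of pairs `(a, s) ∈ A × S` for which `a + s + y` lies in `A + S`. -/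
noncomputable def overlap (A S : Finset G) (y : G) : ℝ :=
  (∑ a ∈ A, ∑ s ∈ S, indicatorFn (A + S) (a + s + y)) / (A.card * S.card)

variable [Fintype G]

theorem sum_indicatorFn (A : Finset G) : ∑ x, indicatorFn A x = A.card := by
  simp [indicatorFn_apply]

variable [MeasurableSpace G] [DiscreteMeasurableSpace G]

theorem convMeasure_eq_sum (f : G → ℝ) (μ : MeasureTheory.Measure G)
    [MeasureTheory.IsProbabilityMeasure μ] (x : G) :
    convMeasure f μ x = ∑ y, μ.real {y} * f (x - y) := by
  rw [convMeasure, MeasureTheory.integral_fintype MeasureTheory.Integrable.of_finite]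
  simp

theorem sum_measureReal_singleton (μ : MeasureTheory.Measure G)
    [MeasureTheory.IsProbabilityMeasure μ] : ∑ y, μ.real {y} = 1 := by
  simp

theorem measureReal_singleton_eq_zero {μ : MeasureTheory.Measure G} {M : Set G}
    (hμ : μ Mᶜ = 0) {y : G} (hy : y ∉ M) : μ.real {y} = 0 := by
  have : μ {y} = 0 := MeasureTheory.measure_mono_null (by simpa using hy) hμ
  simp [MeasureTheory.Measure.real, this]

/-- The convolution has total mass |B| and vanishes off `B + MF`, so its maximum is at least its
average there. -/
theorem card_le_card_mul_norm_convMeasure (B MF : Finset G) (μ : MeasureTheory.Measure G)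
    [MeasureTheory.IsProbabilityMeasure μ] (hμ : μ (MF : Set G)ᶜ = 0) :
    (B.card : ℝ) ≤ (B + MF).card * ‖convMeasure (indicatorFn B) μ‖ := by
  have h1 : ∑ x, convMeasure (indicatorFn B) μ x = B.card := by
    simp_rw [convMeasure_eq_sum]
    rw [Finset.sum_comm]
    simp_rw [← Finset.mul_sum]
    have : ∀ y : G, ∑ x, indicatorFn B (x - y) = B.card := fun y => by
      rw [← sum_indicatorFn B]
      exact Equiv.sum_comp (Equiv.subRight y) (indicatorFn B)
    simp_rw [this, ← Finset.sum_mul, sum_measureReal_singleton, one_mul]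
  have h2 : ∑ x, convMeasure (indicatorFn B) μ x
      = ∑ x ∈ B + MF, convMeasure (indicatorFn B) μ x := by
    symm
    refine Finset.sum_subset (Finset.subset_univ _) fun x _ hx => ?_
    rw [convMeasure_eq_sum]
    refine Finset.sum_eq_zero fun y _ => ?_
    by_cases hy : y ∈ MF
    · rw [indicatorFn_apply, if_neg, mul_zero]
      exact fun hB => hx (Finset.mem_add.2 ⟨x - y, hB, y, hy, by abel⟩)
    · rw [measureReal_singleton_eq_zero hμ (by simpa using hy), zero_mul]
  rw [← h1, h2, ← nsmul_eq_mul]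
  exact Finset.sum_le_card_nsmul _ _ _ fun x _ =>
    (le_abs_self _).trans (norm_le_pi_norm (convMeasure (indicatorFn B) μ) x)

/-- Integrate the overlap against μ. At -y, interchanging sums gives the mean of 1_{A+S} ∗ μ over
the points a + s. At y, it gives 1_A ∗ μ paired with the weight x ↦ Σ_s 1_{A+S}(x + s), which is
non-negative of total mass |S||A + S|. -/
theorem one_sub_le_norm_convMeasure_of_overlap {A S MF : Finset G} (hA : A.Nonempty)
    (hS : S.Nonempty) {ε : ℝ}
    (hM : ∀ y ∈ MF, 1 - ε ≤ overlap A S y ∧ 1 - ε ≤ overlap A S (-y))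
    (μ : MeasureTheory.Measure G)
    [MeasureTheory.IsProbabilityMeasure μ] (hμ : μ (MF : Set G)ᶜ = 0) :
    1 - ε ≤ ‖convMeasure (indicatorFn (A + S)) μ‖ ∧
      (1 - ε) * ((A.card : ℝ) / ((A + S).card : ℝ)) ≤ ‖convMeasure (indicatorFn A) μ‖ := by
  have hAc : (0 : ℝ) < A.card := by exact_mod_cast hA.card_pos
  have hSc : (0 : ℝ) < S.card := by exact_mod_cast hS.card_pos
  have hWc : (0 : ℝ) < (A + S).card := by exact_mod_cast (hA.add hS).card_pos
  have hpos : (0 : ℝ) < A.card * S.card := by positivity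
  have hov : ∀ y, (1 - ε ≤ overlap A S y) ↔
      (1 - ε) * (A.card * S.card) ≤ ∑ a ∈ A, ∑ s ∈ S, indicatorFn (A + S) (a + s + y) :=
    fun y => by rw [overlap, le_div_iff₀ hpos]
  have havg : ∀ F : G → ℝ, (∀ y ∈ MF, (1 - ε) * (A.card * S.card) ≤ F y) →
      (1 - ε) * (A.card * S.card) ≤ ∑ y, μ.real {y} * F y := by
    intro F hF
    calc (1 - ε) * (A.card * S.card) = ∑ y, μ.real {y} * ((1 - ε) * (A.card * S.card)) := by
          rw [← Finset.sum_mul, sum_measureReal_singleton, one_mul]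
      _ ≤ _ := by
          refine Finset.sum_le_sum fun y _ => ?_
          by_cases hy : y ∈ MF
          · exact mul_le_mul_of_nonneg_left (hF y hy) MeasureTheory.measureReal_nonneg
          · rw [measureReal_singleton_eq_zero hμ (by simpa using hy), zero_mul, zero_mul]
  have hnorm : ∀ (B : Finset G) x, convMeasure (indicatorFn B) μ x
      ≤ ‖convMeasure (indicatorFn B) μ‖ := fun B x =>
    (le_abs_self _).trans (norm_le_pi_norm (convMeasure (indicatorFn B) μ) x)
  constructor
  · have h1 := havg _ fun y hy => (hov _).1 (hM y hy).2
    have h2 : ∑ y, μ.real {y} * ∑ a ∈ A, ∑ s ∈ S, indicatorFn (A + S) (a + s + -y)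
        = ∑ a ∈ A, ∑ s ∈ S, convMeasure (indicatorFn (A + S)) μ (a + s) := by
      simp_rw [convMeasure_eq_sum, Finset.mul_sum]
      rw [Finset.sum_comm]
      refine Finset.sum_congr rfl fun a _ => ?_
      rw [Finset.sum_comm]
      simp_rw [sub_eq_add_neg]
    rw [h2] at h1
    have h3 : ∑ a ∈ A, ∑ s ∈ S, convMeasure (indicatorFn (A + S)) μ (a + s)
        ≤ ∑ a ∈ A, ∑ s ∈ S, ‖convMeasure (indicatorFn (A + S)) μ‖ :=
      Finset.sum_le_sum fun a _ => Finset.sum_le_sum fun s _ => hnorm _ _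
    simp only [Finset.sum_const, nsmul_eq_mul] at h3
    refine le_of_mul_le_mul_right (h1.trans (h3.trans (le_of_eq ?_))) hpos
    ring
  · have h1 := havg _ fun y hy => (hov _).1 (hM y hy).1
    have h2 : ∑ y, μ.real {y} * ∑ a ∈ A, ∑ s ∈ S, indicatorFn (A + S) (a + s + y)
        = ∑ x, (∑ s ∈ S, indicatorFn (A + S) (x + s)) * convMeasure (indicatorFn A) μ x := by
      simp_rw [convMeasure_eq_sum, Finset.mul_sum (s := Finset.univ)]
      rw [Finset.sum_comm (s := Finset.univ) (t := Finset.univ)]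
      refine Finset.sum_congr rfl fun y _ => ?_
      rw [← Equiv.sum_comp (Equiv.addRight y)]
      simp only [Equiv.coe_addRight, add_sub_cancel_right]
      rw [← Finset.sum_subset (Finset.subset_univ A)]
      · rw [Finset.mul_sum]
        refine Finset.sum_congr rfl fun a ha => ?_
        rw [indicatorFn_apply A, if_pos ha, mul_one, mul_comm]
        congr 1
        refine Finset.sum_congr rfl fun s _ => ?_
        congr 1; abel
      · intro x _ hx
        rw [indicatorFn_apply A, if_neg hx]; ring
    rw [h2] at h1
    have h3 : ∑ x, (∑ s ∈ S, indicatorFn (A + S) (x + s)) * convMeasure (indicatorFn A) μ x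
        ≤ ∑ x, (∑ s ∈ S, indicatorFn (A + S) (x + s)) * ‖convMeasure (indicatorFn A) μ‖ :=
      Finset.sum_le_sum fun x _ => mul_le_mul_of_nonneg_left (hnorm _ _)
        (Finset.sum_nonneg fun s _ => indicatorFn_nonneg _ _)
    have h4 : ∑ x, ∑ s ∈ S, indicatorFn (A + S) (x + s) = S.card * (A + S).card := by
      rw [Finset.sum_comm]
      have : ∀ s : G, ∑ x, indicatorFn (A + S) (x + s) = (A + S).card := fun s => by
        rw [← sum_indicatorFn]
        exact Equiv.sum_comp (Equiv.addRight s) (indicatorFn (A + S))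
      simp_rw [this]
      simp
    rw [← Finset.sum_mul, h4] at h3
    rw [mul_div_assoc', div_le_iff₀ hWc]
    refine le_of_mul_le_mul_right (((le_of_eq ?_).trans h1).trans (h3.trans (le_of_eq ?_))) hSc
    · ring
    · ring

end Reduction

/-! ### Croot–Sisask almost periodicity by random sampling. -/

section AlmostPeriodicity

/-- Hoeffding's inequality for samples with replacement from a finite set. -/
theorem card_sample_sum_ge_le {ι : Type*} [DecidableEq ι] (S : Finset ι) (φ : ι → ℝ)
    (hφ : ∀ s ∈ S, |φ s| ≤ 1) (h0 : ∑ s ∈ S, φ s = 0) (m : ℕ) {η : ℝ} (hη0 : 0 ≤ η)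
    (hη : η ≤ 2) :
    (((Fintype.piFinset fun _ : Fin m => S).filter
      fun x => m * η ≤ ∑ i, φ (x i)).card : ℝ) ≤ Real.exp (-(m * η ^ 2 / 4)) * S.card ^ m := by
  -- Chernoff's method with parameter η/2: since η ≤ 2, the estimate exp t ≤ 1 + t + t² for |t| ≤ 1
  -- applies. Markov's inequality then gains exp(-mη²/2), of which half is lost to this moment
  -- bound.
  have hmgf : ∑ s ∈ S, Real.exp (η / 2 * φ s) ≤ S.card * Real.exp (η ^ 2 / 4) := by
    have hpt : ∀ s ∈ S, Real.exp (η / 2 * φ s) ≤ 1 + η / 2 * φ s + η ^ 2 / 4 := by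
      intro s hs
      have h1 : |η / 2 * φ s| ≤ 1 := by
        rw [abs_mul, abs_of_nonneg (by positivity)]
        have := hφ s hs
        nlinarith [abs_nonneg (φ s)]
      have h2 := Real.abs_exp_sub_one_sub_id_le h1
      have h3 : (η / 2 * φ s) ^ 2 ≤ η ^ 2 / 4 := by
        have h4 : φ s ^ 2 ≤ 1 := by
          rw [← sq_abs]
          have := hφ s hs
          nlinarith [abs_nonneg (φ s)]
        nlinarith [sq_nonneg η]
      linarith [le_abs_self (Real.exp (η / 2 * φ s) - 1 - η / 2 * φ s)]
    calc ∑ s ∈ S, Real.exp (η / 2 * φ s) ≤ ∑ s ∈ S, (1 + η / 2 * φ s + η ^ 2 / 4) :=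
          Finset.sum_le_sum hpt
      _ = S.card * (1 + η ^ 2 / 4) := by
          simp only [Finset.sum_add_distrib, Finset.sum_const, nsmul_eq_mul, ← Finset.mul_sum, h0]
          ring
      _ ≤ _ := by
          gcongr
          linarith [Real.add_one_le_exp (η ^ 2 / 4)]
  have hprod : ∑ x ∈ Fintype.piFinset fun _ : Fin m => S, Real.exp (η / 2 * ∑ i, φ (x i))
      = (∑ s ∈ S, Real.exp (η / 2 * φ s)) ^ m := by
    have := Finset.prod_univ_sum (fun _ : Fin m => S) fun _ s => Real.exp (η / 2 * φ s)
    rw [Finset.prod_const, Finset.card_univ, Fintype.card_fin] at this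
    rw [this]
    refine Finset.sum_congr rfl fun x _ => ?_
    rw [Finset.mul_sum, Real.exp_sum]
  set F := (Fintype.piFinset fun _ : Fin m => S).filter fun x => m * η ≤ ∑ i, φ (x i) with hF
  have hmarkov : F.card * Real.exp (m * η ^ 2 / 2) ≤ (S.card * Real.exp (η ^ 2 / 4)) ^ m := by
    calc F.card * Real.exp (m * η ^ 2 / 2) = ∑ _x ∈ F, Real.exp (m * η ^ 2 / 2) := by simp
      _ ≤ ∑ x ∈ F, Real.exp (η / 2 * ∑ i, φ (x i)) := by
          refine Finset.sum_le_sum fun x hx => Real.exp_le_exp.2 ?_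
          have := (Finset.mem_filter.1 hx).2
          nlinarith
      _ ≤ ∑ x ∈ Fintype.piFinset fun _ : Fin m => S, Real.exp (η / 2 * ∑ i, φ (x i)) :=
          Finset.sum_le_sum_of_subset_of_nonneg (Finset.filter_subset _ _)
            fun _ _ _ => (Real.exp_pos _).le
      _ ≤ _ := by
          rw [hprod]
          exact pow_le_pow_left₀ (Finset.sum_nonneg fun _ _ => (Real.exp_pos _).le) hmgf m
  have he : Real.exp (-(m * η ^ 2 / 4)) = Real.exp (η ^ 2 / 4) ^ m / Real.exp (m * η ^ 2 / 2) := by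
    rw [← Real.exp_nat_mul, ← Real.exp_sub]
    congr 1; ring
  rw [he, div_mul_eq_mul_div, le_div_iff₀ (Real.exp_pos _), mul_comm (Real.exp _ ^ m), ← mul_pow]
  exact hmarkov

variable {G : Type u} [AddCommGroup G] [DecidableEq G]

/-- The average of `f` over the translate `x + S`. -/
noncomputable def translateMean (S : Finset G) (f : G → ℝ) (x : G) : ℝ :=
  (∑ s ∈ S, f (x + s)) / S.card

theorem translateMean_nonneg {S : Finset G} {f : G → ℝ} (hf : ∀ x, 0 ≤ f x) (x : G) :
    0 ≤ translateMean S f x :=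
  div_nonneg (Finset.sum_nonneg fun _ _ => hf _) (by positivity)

theorem translateMean_le_one {S : Finset G} {f : G → ℝ} (hf : ∀ x, f x ≤ 1) (x : G) :
    translateMean S f x ≤ 1 := by
  refine div_le_one_of_le₀ ?_ (by positivity)
  calc ∑ s ∈ S, f (x + s) ≤ ∑ _s ∈ S, (1 : ℝ) := Finset.sum_le_sum fun _ _ => hf _
    _ = S.card := by simp

theorem card_sample_mean_le {S : Finset G} (hS : S.Nonempty) {f : G → ℝ} (hf0 : ∀ x, 0 ≤ f x)
    (hf1 : ∀ x, f x ≤ 1) {m : ℕ} (hm : 0 < m) {η : ℝ} (hη0 : 0 ≤ η) (hη : η ≤ 2) (z : G) :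
    (((Fintype.piFinset fun _ : Fin m => S).filter
      fun x => η < |(∑ i, f (z + x i)) / m - translateMean S f z|).card : ℝ)
        ≤ 2 * Real.exp (-(m * η ^ 2 / 4)) * S.card ^ m := by
  have hSc : (0 : ℝ) < S.card := by exact_mod_cast hS.card_pos
  have hmr : (0 : ℝ) < m := by exact_mod_cast hm
  set c := translateMean S f z with hc
  have hc0 : 0 ≤ c := translateMean_nonneg hf0 z
  have hc1 : c ≤ 1 := translateMean_le_one hf1 z
  have hsum : ∑ s ∈ S, f (z + s) = S.card * c := by
    rw [hc, translateMean]; field_simp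
  have hb : ∀ s ∈ S, |f (z + s) - c| ≤ 1 := fun s _ => by
    rw [abs_le]; constructor <;> linarith [hf0 (z + s), hf1 (z + s)]
  have h1 := card_sample_sum_ge_le S (fun s => f (z + s) - c) hb
    (by rw [Finset.sum_sub_distrib, hsum]; simp) m hη0 hη
  have h2 := card_sample_sum_ge_le S (fun s => -(f (z + s) - c))
    (fun s hs => by rw [abs_neg]; exact hb s hs)
    (by rw [Finset.sum_neg_distrib, Finset.sum_sub_distrib, hsum]; simp) m hη0 hη
  have hsub : ((Fintype.piFinset fun _ : Fin m => S).filter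
      fun x => η < |(∑ i, f (z + x i)) / m - c|) ⊆
      ((Fintype.piFinset fun _ : Fin m => S).filter
        fun x => m * η ≤ ∑ i, (f (z + x i) - c)) ∪
      ((Fintype.piFinset fun _ : Fin m => S).filter
        fun x => m * η ≤ ∑ i, -(f (z + x i) - c)) := by
    intro x hx
    obtain ⟨hx1, hx2⟩ := Finset.mem_filter.1 hx
    rw [← Finset.filter_or, Finset.mem_filter]
    refine ⟨hx1, ?_⟩
    have e : ∑ i, (f (z + x i) - c) = m * ((∑ i, f (z + x i)) / m - c) := by
      rw [Finset.sum_sub_distrib]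
      simp only [Finset.sum_const, Finset.card_univ, Fintype.card_fin, nsmul_eq_mul]
      field_simp
    rw [Finset.sum_neg_distrib, e]
    rcases lt_abs.1 hx2 with h | h
    · left; nlinarith
    · right; nlinarith
  have h3 : (((Fintype.piFinset fun _ : Fin m => S).filter
      fun x => η < |(∑ i, f (z + x i)) / m - c|).card : ℝ) ≤ _ :=
    (Nat.cast_le.2 ((Finset.card_le_card hsub).trans (Finset.card_union_le _ _)))
  rw [Nat.cast_add] at h3
  linarith

variable [Fintype G]

/-- The Croot–Sisask almost periodicity argument, with exceptional sets instead of `L^p` norms. -/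
theorem exists_almost_periods {A S : Finset G} (hA : A.Nonempty) (hS : S.Nonempty)
    {K : ℝ} (hK : ((A + S).card : ℝ) ≤ K * S.card) {η ξ : ℝ} (hη0 : 0 < η) (hη : η ≤ 1)
    (hξ : 0 < ξ) {m : ℕ} (hm0 : 0 < m)
    (hm : 4 * ((A + S - S).card : ℝ) * Real.exp (-(m * η ^ 2 / 4)) ≤ ξ * A.card) :
    ∃ T ⊆ A, (A.card : ℝ) ≤ 2 * K ^ m * T.card ∧ ∀ t ∈ T, ∀ t' ∈ T,
      ((Finset.univ.filter fun z => 2 * η <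
        |translateMean S (indicatorFn (A + S)) (z + (t - t'))
          - translateMean S (indicatorFn (A + S)) z|).card : ℝ) ≤ 2 * ξ * A.card := by
  classical
  set f := indicatorFn (A + S) with hf
  set h := translateMean S f with hh
  set V := A + S - S with hV
  have hAc : (0 : ℝ) < A.card := by exact_mod_cast hA.card_pos
  have hSc : (0 : ℝ) < S.card := by exact_mod_cast hS.card_pos
  have hWc : (0 : ℝ) < (A + S).card := by exact_mod_cast (hA.add hS).card_pos
  have hfV : ∀ z ∉ V, ∀ s ∈ S, f (z + s) = 0 := by
    intro z hz s hs
    rw [hf, indicatorFn_apply, if_neg]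
    exact fun hw => hz (Finset.mem_sub.2 ⟨_, hw, s, hs, by abel⟩)
  set P := Fintype.piFinset fun _ : Fin m => S with hP
  have hPc : (P.card : ℝ) = (S.card : ℝ) ^ m := by
    rw [hP, Fintype.card_piFinset]; simp
  -- Deviations need only be counted on `V`, since off `V` both the sample mean and `h` vanish. On
  -- average over samples a bad set has size at most ξ|A|/2, so at least half of the samples are
  -- good.
  let bad : (Fin m → G) → Finset G := fun x =>
    V.filter fun z => η < |(∑ i, f (z + x i)) / m - h z|
  have hbad : ∑ x ∈ P, ((bad x).card : ℝ) ≤ ξ * A.card / 2 * S.card ^ m := by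
    have e1 : ∑ x ∈ P, ((bad x).card : ℝ)
        = ∑ z ∈ V, ((P.filter fun x => η < |(∑ i, f (z + x i)) / m - h z|).card : ℝ) := by
      simp only [bad, Finset.card_filter, Nat.cast_sum]
      rw [Finset.sum_comm]
    rw [e1]
    calc _ ≤ ∑ z ∈ V, 2 * Real.exp (-(m * η ^ 2 / 4)) * (S.card : ℝ) ^ m :=
          Finset.sum_le_sum fun z _ => card_sample_mean_le hS (indicatorFn_nonneg _)
            (indicatorFn_le_one _) hm0 hη0.le (by linarith) z
      _ = (4 * (V.card : ℝ) * Real.exp (-(m * η ^ 2 / 4))) / 2 * S.card ^ m := by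
          rw [Finset.sum_const, nsmul_eq_mul]; ring
      _ ≤ _ := by gcongr
  set good := P.filter fun x => ((bad x).card : ℝ) ≤ ξ * A.card with hgood
  have hgoodc : (S.card : ℝ) ^ m ≤ 2 * good.card := by
    have e1 : (good.card : ℝ) + (P.filter fun x => ¬ ((bad x).card : ℝ) ≤ ξ * A.card).card
        = P.card := by
      exact_mod_cast Finset.card_filter_add_card_filter_not (s := P) _
    have e2 : ((P.filter fun x => ¬ ((bad x).card : ℝ) ≤ ξ * A.card).card : ℝ) * (ξ * A.card)
        ≤ ξ * A.card / 2 * S.card ^ m := by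
      refine le_trans ?_ hbad
      rw [← nsmul_eq_mul]
      refine le_trans (Finset.card_nsmul_le_sum _ (fun x => ((bad x).card : ℝ)) _ fun x hx => ?_)
        (Finset.sum_le_sum_of_subset_of_nonneg (Finset.filter_subset _ _)
          fun _ _ _ => by positivity)
      exact (not_le.1 (Finset.mem_filter.1 hx).2).le
    have e3 : ((P.filter fun x => ¬ ((bad x).card : ℝ) ≤ ξ * A.card).card : ℝ)
        ≤ S.card ^ m / 2 := by
      have : 0 < ξ * A.card := by positivity
      refine le_of_mul_le_mul_right (e2.trans (le_of_eq (by ring))) this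
    rw [hPc] at e1
    linarith
  -- Each pair of a in `A` and a good sample x yields the tuple y = x + a in (A + S)^m. Hence some y
  -- arises from at least |A||good|/|A + S|^m values of a.
  let T : (Fin m → G) → Finset G := fun y => A.filter fun a => (fun i => y i - a) ∈ good
  have hcount : ∑ y ∈ Fintype.piFinset fun _ : Fin m => A + S, ((T y).card : ℝ)
      = A.card * good.card := by
    have : ∀ a ∈ A, (((Fintype.piFinset fun _ : Fin m => A + S).filter
        fun y => (fun i => y i - a) ∈ good).card) = good.card := by
      intro a ha
      refine Finset.card_bij' (fun y _ => fun i => y i - a) (fun x _ => fun i => x i + a)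
        ?_ ?_ ?_ ?_
      · intro y hy; exact (Finset.mem_filter.1 hy).2
      · intro x hx
        refine Finset.mem_filter.2 ⟨Fintype.mem_piFinset.2 fun i => ?_, by simpa using hx⟩
        have := Fintype.mem_piFinset.1 (Finset.mem_filter.1 hx).1 i
        exact Finset.mem_add.2 ⟨a, ha, _, this, add_comm _ _⟩
      · intro y _; simp
      · intro x _; simp
    simp only [T, Finset.card_filter, Nat.cast_sum]
    rw [Finset.sum_comm]
    simp only [← Nat.cast_sum, ← Finset.card_filter]
    rw [← nsmul_eq_mul, ← Finset.sum_const, Nat.cast_sum]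
    exact Finset.sum_congr rfl fun a ha => by rw [this a ha]
  obtain ⟨y, -, hy⟩ : ∃ y ∈ Fintype.piFinset fun _ : Fin m => A + S,
      A.card * good.card / (A + S).card ^ m ≤ ((T y).card : ℝ) := by
    refine Finset.exists_le_of_sum_le ?_ ?_
    · exact Fintype.piFinset_nonempty.2 fun _ => hA.add hS
    · rw [hcount, Finset.sum_const, Fintype.card_piFinset]
      simp only [Finset.prod_const, Finset.card_univ, Fintype.card_fin, nsmul_eq_mul]
      push_cast
      rw [mul_div_cancel₀]
      positivity
  refine ⟨T y, Finset.filter_subset _ _, ?_, ?_⟩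
  · rw [div_le_iff₀ (by positivity)] at hy
    have hKm : ((A + S).card : ℝ) ^ m ≤ K ^ m * S.card ^ m := by
      rw [← mul_pow]; exact pow_le_pow_left₀ hWc.le hK m
    have e1 : (A.card : ℝ) * S.card ^ m ≤ 2 * (A.card * good.card) := by nlinarith
    have e2 : ((T y).card : ℝ) * (A + S).card ^ m ≤ (T y).card * (K ^ m * S.card ^ m) := by
      gcongr
    have e3 : (A.card : ℝ) * S.card ^ m ≤ (2 * K ^ m * (T y).card) * S.card ^ m := by nlinarith
    exact le_of_mul_le_mul_right e3 (by positivity)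
  · intro t ht t' ht'
    -- `F` does not depend on t, yet it approximates h(· + t) off a small set for every t in `T y`.
    -- So any two such translates of `h` are close.
    let F : G → ℝ := fun z => (∑ i, f (z + y i)) / m
    have hF : ∀ t ∈ T y, ((Finset.univ.filter fun z => η < |F z - h (z + t)|).card : ℝ)
        ≤ ξ * A.card := by
      intro t ht
      have hg := (Finset.mem_filter.1 ht).2
      refine le_trans (Nat.cast_le.2 ?_) (Finset.mem_filter.1 hg).2
      refine Finset.card_le_card_of_injOn (fun z => z + t) ?_ (fun _ _ _ _ h => by simpa using h)
      intro z hz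
      have hz' := (Finset.mem_filter.1 (Finset.mem_coe.1 hz)).2
      have hsm := Fintype.mem_piFinset.1 (Finset.mem_filter.1 hg).1
      have e : ∑ i, f (z + t + (y i - t)) = ∑ i, f (z + y i) :=
        Finset.sum_congr rfl fun i _ => by congr 1; abel
      simp only [bad, Finset.coe_filter, Set.mem_ofPred_eq]
      rw [e]
      refine ⟨?_, hz'⟩
      by_contra hV'
      have z1 : ∑ i, f (z + y i) = 0 := by
        rw [← e]
        exact Finset.sum_eq_zero fun i _ => hfV _ hV' _ (hsm i)
      have z2 : h (z + t) = 0 := by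
        rw [hh, translateMean, Finset.sum_eq_zero fun s hs => hfV _ hV' s hs, zero_div]
      simp only [F, z1, z2] at hz'
      simp at hz'
      linarith
    have hsub : (Finset.univ.filter fun z => 2 * η < |h (z + (t - t')) - h z|).card ≤
        ((Finset.univ.filter fun z => η < |F z - h (z + t)|) ∪
          (Finset.univ.filter fun z => η < |F z - h (z + t')|)).card := by
      refine Finset.card_le_card_of_injOn (fun z => z - t') ?_
        (fun _ _ _ _ h => by simpa using h)
      intro z hz
      have hz' := (Finset.mem_filter.1 (Finset.mem_coe.1 hz)).2
      rw [← Finset.filter_or, Finset.mem_coe, Finset.mem_filter]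
      refine ⟨Finset.mem_univ _, ?_⟩
      by_contra! hcon
      have e1 : z - t' + t = z + (t - t') := by abel
      have e2 : z - t' + t' = z := by abel
      rw [e1, e2] at hcon
      have := abs_sub_le (h (z + (t - t'))) (F (z - t')) (h z)
      rw [abs_sub_comm (h (z + (t - t'))) (F (z - t'))] at this
      linarith
    have e := (Nat.cast_le (α := ℝ)).2 (hsub.trans (Finset.card_union_le _ _))
    push_cast at e
    linarith [hF t ht, hF t' ht']

/-- Telescoping over k steps adds up the errors and the exceptional sets. The overlap at y is the
mean of a [0, 1]-valued function over A + y, so an exceptional set of size kξ|A| contributes at most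
kξ wherever it lies. This makes the estimate uniform in y. -/
theorem abs_overlap_add_sub_le {A S : Finset G} (hA : A.Nonempty) (hS : S.Nonempty) {X : Finset G}
    {η ξ : ℝ} (hη : 0 ≤ η)
    (hX : ∀ t ∈ X, ((Finset.univ.filter fun z => η <
        |translateMean S (indicatorFn (A + S)) (z + t)
          - translateMean S (indicatorFn (A + S)) z|).card : ℝ) ≤ ξ * A.card)
    (k : ℕ) {x : G} (hx : x ∈ k • X) (y : G) :
    |overlap A S (y + x) - overlap A S y| ≤ k * η + k * ξ := by
  classical
  set h := translateMean S (indicatorFn (A + S)) with hh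
  have hAc : (0 : ℝ) < A.card := by exact_mod_cast hA.card_pos
  have hSc : (0 : ℝ) < S.card := by exact_mod_cast hS.card_pos
  have hk : ∀ k : ℕ, ∀ x ∈ k • X,
      ((Finset.univ.filter fun z => k * η < |h (z + x) - h z|).card : ℝ) ≤ k * (ξ * A.card) := by
    intro k
    induction k with
    | zero =>
      intro x hx
      have : x = 0 := by simpa using hx
      subst this
      simp
    | succ k ih =>
      intro x hx
      rw [succ_nsmul] at hx
      obtain ⟨u, hu, t, ht, rfl⟩ := Finset.mem_add.1 hx
      have hsub : (Finset.univ.filter fun z => ((k + 1 : ℕ) : ℝ) * η < |h (z + (u + t)) - h z|).card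
          ≤ (Finset.univ.filter fun z => k * η < |h (z + u) - h z|).card
            + (Finset.univ.filter fun z => η < |h (z + t) - h z|).card := by
        have e1 : (Finset.univ.filter fun z => k * η < |h (z + u) - h z|).card
            = (Finset.univ.filter fun z => k * η < |h (z + t + u) - h (z + t)|).card := by
          refine Finset.card_bij' (fun z _ => z - t) (fun z _ => z + t) ?_ ?_ ?_ ?_ <;> simp
        rw [e1]
        refine (Finset.card_le_card ?_).trans (Finset.card_union_le _ _)
        intro z hz
        have hz' := (Finset.mem_filter.1 hz).2
        rw [← Finset.filter_or, Finset.mem_filter]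
        refine ⟨Finset.mem_univ _, ?_⟩
        by_contra! hcon
        have e2 : z + (u + t) = z + t + u := by abel
        rw [e2] at hz'
        have := abs_sub_le (h (z + t + u)) (h (z + t)) (h z)
        push_cast at hz'
        linarith
      have := (Nat.cast_le (α := ℝ)).2 hsub
      push_cast at this ⊢
      linarith [ih u hu, hX t ht]
  have hov : ∀ y, overlap A S y = (∑ a ∈ A, h (a + y)) / A.card := by
    intro y
    simp only [overlap, hh, translateMean, ← Finset.sum_div]
    rw [div_div, mul_comm (S.card : ℝ)]
    congr 1
    refine Finset.sum_congr rfl fun a _ => Finset.sum_congr rfl fun s _ => ?_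
    congr 1; abel
  rw [hov, hov, ← sub_div, abs_div, abs_of_pos hAc, div_le_iff₀ hAc, ← Finset.sum_sub_distrib]
  refine (Finset.abs_sum_le_sum_abs _ _).trans ?_
  have h01 : ∀ z, 0 ≤ h z ∧ h z ≤ 1 := fun z =>
    ⟨translateMean_nonneg (indicatorFn_nonneg _) z, translateMean_le_one (indicatorFn_le_one _) z⟩
  have hpt : ∀ a ∈ A, |h (a + (y + x)) - h (a + y)| ≤ k * η +
      if k * η < |h (a + y + x) - h (a + y)| then 1 else 0 := by
    intro a _
    rw [← add_assoc]
    split_ifs with hc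
    · have := h01 (a + y + x)
      have := h01 (a + y)
      have : (0 : ℝ) ≤ k * η := by positivity
      rw [abs_le]; constructor <;> linarith
    · linarith
  refine (Finset.sum_le_sum hpt).trans ?_
  rw [Finset.sum_add_distrib, Finset.sum_const, nsmul_eq_mul]
  have hc : ∑ a ∈ A, (if k * η < |h (a + y + x) - h (a + y)| then (1 : ℝ) else 0)
      ≤ (Finset.univ.filter fun z => k * η < |h (z + x) - h z|).card := by
    rw [Finset.sum_ite, Finset.sum_const_zero, add_zero, Finset.sum_const, nsmul_eq_mul, mul_one]
    refine Nat.cast_le.2 (Finset.card_le_card_of_injOn (fun a => a + y) ?_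
      (fun _ _ _ _ h => by simpa using h))
    intro a ha
    have := (Finset.mem_filter.1 (Finset.mem_coe.1 ha)).2
    simpa using this
  have := hk k x hx
  nlinarith

end AlmostPeriodicity

/-! ### Fourier analysis of the overlap. -/

section Fourier

variable {G : Type u} [AddCommGroup G] [DecidableEq G]

/-- The average of `u` over translates by elements of `X`. -/
noncomputable def meanOp (X : Finset G) (u : G → ℝ) : G → ℝ :=
  fun y => (∑ x ∈ X, u (y + x)) / X.card

/-- The k-fold average at y is a convex combination of values of `u` on y + kX. -/
theorem abs_meanOp_iterate_sub_le {X : Finset G} (hX : X.Nonempty) (u : G → ℝ) {e v : ℝ} (k : ℕ) :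
    ∀ y, (∀ x ∈ k • X, |u (y + x) - v| ≤ e) → |(meanOp X)^[k] u y - v| ≤ e := by
  have hXc : (0 : ℝ) < X.card := by exact_mod_cast hX.card_pos
  induction k with
  | zero => intro y h; simpa using h 0 (by simp)
  | succ k ih =>
    intro y h
    rw [Function.iterate_succ_apply', meanOp]
    have e1 : (∑ x ∈ X, (meanOp X)^[k] u (y + x)) / X.card - v
        = (∑ x ∈ X, ((meanOp X)^[k] u (y + x) - v)) / X.card := by
      rw [Finset.sum_sub_distrib]
      simp only [Finset.sum_const, nsmul_eq_mul]
      field_simp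
    rw [e1, abs_div, abs_of_pos hXc, div_le_iff₀ hXc]
    refine (Finset.abs_sum_le_sum_abs _ _).trans ?_
    rw [mul_comm, ← nsmul_eq_mul]
    refine Finset.sum_le_card_nsmul _ _ _ fun x hx => ih _ fun x' hx' => ?_
    rw [add_assoc]
    refine h _ ?_
    rw [succ_nsmul']
    exact Finset.add_mem_add hx hx'

variable [Fintype G]

/-- The average of the character `γ` over `X`. -/
noncomputable def charMean (X : Finset G) (γ : AddChar G ℂ) : ℂ := (∑ x ∈ X, γ x) / X.card

/-- Characters are eigenfunctions of `meanOp X`, with eigenvalue `charMean X γ`. -/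
theorem meanOp_iterate_fourier (X : Finset G) (u : G → ℝ) (a : AddChar G ℂ → ℂ)
    (hu : ∀ y, (u y : ℂ) = ∑ γ, a γ * γ y) (k : ℕ) :
    ∀ y, ((meanOp X)^[k] u y : ℂ) = ∑ γ, a γ * charMean X γ ^ k * γ y := by
  induction k with
  | zero => intro y; simpa using hu y
  | succ k ih =>
    intro y
    rw [Function.iterate_succ_apply', meanOp]
    push_cast
    simp_rw [ih]
    rw [Finset.sum_comm, Finset.sum_div]
    refine Finset.sum_congr rfl fun γ _ => ?_
    simp_rw [AddChar.map_add_eq_mul]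
    rw [charMean, pow_succ]
    rw [← Finset.mul_sum, ← Finset.mul_sum]
    ring

theorem sum_norm_sq_sum_addChar (B : Finset G) :
    ∑ γ : AddChar G ℂ, ‖∑ b ∈ B, γ b‖ ^ 2 = Fintype.card G * B.card := by
  have h : ∀ γ : AddChar G ℂ, ((‖∑ b ∈ B, γ b‖ ^ 2 : ℝ) : ℂ)
      = ∑ b ∈ B, ∑ b' ∈ B, γ (b - b') := by
    intro γ
    rw [← Complex.normSq_eq_norm_sq, Complex.normSq_eq_conj_mul_self, map_sum, mul_comm,
      Finset.sum_mul_sum]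
    refine Finset.sum_congr rfl fun b _ => Finset.sum_congr rfl fun b' _ => ?_
    rw [sub_eq_add_neg, AddChar.map_add_eq_mul, AddChar.map_neg_eq_conj]
  have h2 : ((∑ γ : AddChar G ℂ, ‖∑ b ∈ B, γ b‖ ^ 2 : ℝ) : ℂ)
      = ((Fintype.card G * B.card : ℝ) : ℂ) := by
    rw [Complex.ofReal_sum]
    simp_rw [h]
    rw [Finset.sum_comm]
    have : ∀ b ∈ B, ∑ γ : AddChar G ℂ, ∑ b' ∈ B, γ (b - b') = (Fintype.card G : ℂ) := by
      intro b hb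
      rw [Finset.sum_comm]
      simp_rw [AddChar.sum_apply_eq_ite, sub_eq_zero]
      simp [hb]
    rw [Finset.sum_congr rfl this]
    simp [mul_comm]
  exact_mod_cast h2

/-- The Fourier coefficients of `overlap A S`. -/
noncomputable def overlapCoeff (A S : Finset G) (γ : AddChar G ℂ) : ℂ :=
  (∑ a ∈ A, γ a) * (∑ s ∈ S, γ s) * (∑ w ∈ A + S, γ (-w)) / (Fintype.card G * (A.card * S.card))

theorem overlap_eq_sum (A S : Finset G) (y : G) :
    (overlap A S y : ℂ) = ∑ γ, overlapCoeff A S γ * γ y := by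
  have hG : (Fintype.card G : ℂ) ≠ 0 := by exact_mod_cast Fintype.card_ne_zero
  have hind : ∀ z, ((indicatorFn (A + S) z : ℝ) : ℂ)
      = (∑ γ : AddChar G ℂ, ∑ w ∈ A + S, γ (z - w)) / Fintype.card G := by
    intro z
    rw [Finset.sum_comm]
    simp_rw [AddChar.sum_apply_eq_ite, sub_eq_zero]
    rw [indicatorFn_apply, Finset.sum_ite_eq]
    split_ifs <;> simp [hG]
  simp only [overlap, overlapCoeff]
  push_cast
  simp_rw [hind, ← Finset.sum_div]
  rw [div_div]
  have : ∑ a ∈ A, ∑ s ∈ S, ∑ γ : AddChar G ℂ, ∑ w ∈ A + S, γ (a + s + y - w)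
      = ∑ γ : AddChar G ℂ, (∑ a ∈ A, γ a) * (∑ s ∈ S, γ s) * (∑ w ∈ A + S, γ (-w)) * γ y := by
    calc _ = ∑ a ∈ A, ∑ γ : AddChar G ℂ, ∑ s ∈ S, ∑ w ∈ A + S, γ (a + s + y - w) :=
          Finset.sum_congr rfl fun a _ => Finset.sum_comm
      _ = ∑ γ : AddChar G ℂ, ∑ a ∈ A, ∑ s ∈ S, ∑ w ∈ A + S, γ (a + s + y - w) := Finset.sum_comm
      _ = _ := by
          refine Finset.sum_congr rfl fun γ _ => ?_
          rw [Finset.sum_mul_sum, Finset.sum_mul, Finset.sum_mul]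
          refine Finset.sum_congr rfl fun a _ => ?_
          rw [Finset.sum_mul, Finset.sum_mul]
          refine Finset.sum_congr rfl fun s _ => ?_
          rw [Finset.mul_sum, Finset.sum_mul]
          refine Finset.sum_congr rfl fun w _ => ?_
          rw [sub_eq_add_neg, AddChar.map_add_eq_mul, AddChar.map_add_eq_mul,
            AddChar.map_add_eq_mul]
          ring
  rw [this, Finset.sum_div]
  refine Finset.sum_congr rfl fun γ _ => ?_
  ring

/-- Bound the sum over `S` trivially by |S|, then apply Cauchy–Schwarz and Parseval to the other two
factors: this gives √(|A||A + S|)/|A|. -/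
theorem sum_norm_overlapCoeff_le {A S : Finset G} (hA : A.Nonempty) (hS : S.Nonempty) {K : ℝ}
    (hK : ((A + S).card : ℝ) ≤ K * A.card) : ∑ γ, ‖overlapCoeff A S γ‖ ≤ √K := by
  have hAc : (0 : ℝ) < A.card := by exact_mod_cast hA.card_pos
  have hSc : (0 : ℝ) < S.card := by exact_mod_cast hS.card_pos
  have hG : (0 : ℝ) < Fintype.card G := by exact_mod_cast Fintype.card_pos
  have hpt : ∀ γ : AddChar G ℂ, ‖overlapCoeff A S γ‖
      ≤ ‖∑ a ∈ A, γ a‖ * ‖∑ w ∈ A + S, γ w‖ / (Fintype.card G * A.card) := by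
    intro γ
    have h1 : ‖∑ s ∈ S, γ s‖ ≤ S.card := by
      refine (norm_sum_le _ _).trans ?_
      simp
    have h2 : ‖∑ w ∈ A + S, γ (-w)‖ = ‖∑ w ∈ A + S, γ w‖ := by
      simp_rw [AddChar.map_neg_eq_conj, ← map_sum]
      exact RCLike.norm_conj _
    rw [overlapCoeff, norm_div, norm_mul, norm_mul, h2]
    simp only [norm_mul, Complex.norm_natCast]
    rw [div_le_div_iff₀ (by positivity) (by positivity)]
    have : ‖∑ a ∈ A, γ a‖ * ‖∑ s ∈ S, γ s‖ * ‖∑ w ∈ A + S, γ w‖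
        ≤ ‖∑ a ∈ A, γ a‖ * S.card * ‖∑ w ∈ A + S, γ w‖ := by gcongr
    calc _ ≤ (‖∑ a ∈ A, γ a‖ * S.card * ‖∑ w ∈ A + S, γ w‖) * (Fintype.card G * A.card) := by
          gcongr
      _ = _ := by ring
  refine (Finset.sum_le_sum fun γ _ => hpt γ).trans ?_
  rw [← Finset.sum_div, div_le_iff₀ (by positivity)]
  have hcs := Finset.sum_mul_sq_le_sq_mul_sq Finset.univ
    (fun γ : AddChar G ℂ => ‖∑ a ∈ A, γ a‖) (fun γ => ‖∑ w ∈ A + S, γ w‖)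
  rw [sum_norm_sq_sum_addChar, sum_norm_sq_sum_addChar] at hcs
  have hK0 : 0 ≤ K := by
    by_contra! hneg
    have : K * A.card < 0 := mul_neg_of_neg_of_pos hneg hAc
    have : (0 : ℝ) ≤ (A + S).card := by positivity
    linarith
  refine abs_le_of_sq_le_sq' ?_ (by positivity) |>.2
  rw [mul_pow, Real.sq_sqrt hK0]
  refine hcs.trans ?_
  have : (Fintype.card G : ℝ) * A.card * (Fintype.card G * (A + S).card)
      ≤ (Fintype.card G : ℝ) * A.card * (Fintype.card G * (K * A.card)) := by gcongr
  refine this.trans (le_of_eq (by ring))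

theorem overlap_zero {A S : Finset G} (hA : A.Nonempty) (hS : S.Nonempty) :
    overlap A S 0 = 1 := by
  have hAc : (A.card : ℝ) ≠ 0 := by exact_mod_cast hA.card_pos.ne'
  have hSc : (S.card : ℝ) ≠ 0 := by exact_mod_cast hS.card_pos.ne'
  have : ∑ a ∈ A, ∑ s ∈ S, indicatorFn (A + S) (a + s + 0) = A.card * S.card := by
    calc _ = ∑ a ∈ A, ∑ s ∈ S, (1 : ℝ) := Finset.sum_congr rfl fun a ha =>
          Finset.sum_congr rfl fun s hs => by
            rw [add_zero, indicatorFn_apply, if_pos (Finset.add_mem_add ha hs)]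
      _ = _ := by simp
  rw [overlap, this]
  field_simp

/-- The k-fold average over X is within e of the overlap, both at y and at 0. Between these two
points it varies little: a character of the large spectrum changes by at most δ, any other carries a
factor below 2^(-k), and the coefficients have total mass at most √K. -/
theorem overlap_ge_of_bohr {A S : Finset G} (hA : A.Nonempty) (hS : S.Nonempty) {K : ℝ}
    (hK : ((A + S).card : ℝ) ≤ K * A.card) {X : Finset G} (hX : X.Nonempty) {k : ℕ} {e δ : ℝ}
    (hδ : 0 ≤ δ) (hk : ∀ x ∈ k • X, ∀ y, |overlap A S (y + x) - overlap A S y| ≤ e) {y : G}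
    (hy : ∀ γ : AddChar G ℂ, 1 / 2 ≤ ‖charMean X γ‖ → ‖1 - γ y‖ ≤ δ) :
    1 - (2 * e + (δ + 2 * (1 / 2) ^ k) * √K) ≤ overlap A S y := by
  set u := overlap A S
  have h1 := abs_meanOp_iterate_sub_le hX u k y fun x hx => hk x hx y
  have h2 := abs_meanOp_iterate_sub_le hX u k 0 fun x hx => hk x hx 0
  have hF := meanOp_iterate_fourier X u (overlapCoeff A S) (overlap_eq_sum A S) k
  have h3 : |(meanOp X)^[k] u y - (meanOp X)^[k] u 0| ≤ (δ + 2 * (1 / 2) ^ k) * √K := by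
    have e1 : |(meanOp X)^[k] u y - (meanOp X)^[k] u 0|
        = ‖∑ γ, overlapCoeff A S γ * charMean X γ ^ k * (γ y - 1)‖ := by
      rw [← Real.norm_eq_abs, ← Complex.norm_real, Complex.ofReal_sub, hF, hF,
        ← Finset.sum_sub_distrib]
      congr 1
      refine Finset.sum_congr rfl fun γ _ => ?_
      rw [AddChar.map_zero_eq_one]; ring
    rw [e1]
    have hpt : ∀ γ : AddChar G ℂ, ‖overlapCoeff A S γ * charMean X γ ^ k * (γ y - 1)‖
        ≤ ‖overlapCoeff A S γ‖ * (δ + 2 * (1 / 2) ^ k) := by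
      intro γ
      rw [mul_assoc, norm_mul]
      refine mul_le_mul_of_nonneg_left ?_ (norm_nonneg _)
      rw [norm_mul, norm_pow]
      have hle1 : ‖charMean X γ‖ ≤ 1 := by
        rw [charMean, norm_div, Complex.norm_natCast]
        refine div_le_one_of_le₀ ((norm_sum_le _ _).trans ?_) (by positivity)
        simp
      rcases le_or_gt (1 / 2) ‖charMean X γ‖ with hc | hc
      · have a1 := hy γ hc
        rw [norm_sub_rev] at a1
        have a2 : ‖charMean X γ‖ ^ k ≤ 1 := pow_le_one₀ (norm_nonneg _) hle1
        have a3 : (0 : ℝ) ≤ 2 * (1 / 2) ^ k := by positivity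
        have a4 : ‖charMean X γ‖ ^ k * ‖γ y - 1‖ ≤ 1 * δ := by gcongr
        linarith
      · have a1 : ‖γ y - 1‖ ≤ 2 := by
          refine (norm_sub_le _ _).trans ?_
          simp only [AddChar.norm_apply, norm_one]; norm_num
        have a2 : ‖charMean X γ‖ ^ k ≤ (1 / 2) ^ k := by gcongr
        have a4 : ‖charMean X γ‖ ^ k * ‖γ y - 1‖ ≤ (1 / 2) ^ k * 2 := by gcongr
        linarith
    refine (norm_sum_le _ _).trans ((Finset.sum_le_sum fun γ _ => hpt γ).trans ?_)
    rw [← Finset.sum_mul, mul_comm]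
    exact mul_le_mul_of_nonneg_left (sum_norm_overlapCoeff_le hA hS hK) (by positivity)
  have h0 : u 0 = 1 := overlap_zero hA hS
  rw [abs_le] at h1 h2 h3
  linarith

end Fourier

/-! ### Plünnecke–Ruzsa bounds and covering lemmas. -/

section Growth

variable {G : Type*} [AddCommGroup G] [DecidableEq G]

/-- Plünnecke–Ruzsa controls the iterated differences of `A` and of `S` separately, at cost K^(2n+1)
each. Two Ruzsa triangle inequalities, through `A` and through `S`, join them at the cost of one
more factor K. -/
theorem card_iterated_differences_le {A S : Finset G} (hA : A.Nonempty) (hS : S.Nonempty) {K : ℝ}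
    (hKA : ((A + S).card : ℝ) ≤ K * A.card) (hKS : ((A + S).card : ℝ) ≤ K * S.card) (n : ℕ) :
    ((n • (A - A + (S - S))).card : ℝ) ≤ K ^ (4 * n + 3) * A.card := by
  have hAc : (0 : ℝ) < A.card := by exact_mod_cast hA.card_pos
  have hSc : (0 : ℝ) < S.card := by exact_mod_cast hS.card_pos
  have hplu : ∀ {B C : Finset G}, C.Nonempty → ((C + B).card : ℝ) ≤ K * C.card → ∀ m n : ℕ,
      ((m • B - n • B).card : ℝ) ≤ K ^ (m + n) * C.card := by
    intro B C hC hK m n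
    have hCc : (0 : ℝ) < C.card := by exact_mod_cast hC.card_pos
    have h := Finset.pluennecke_ruzsa_inequality_nsmul_sub_nsmul_add hC B m n
    have h' : ((m • B - n • B).card : ℝ) ≤ ((C + B).card / C.card : ℝ) ^ (m + n) * C.card := by
      have h2 := (NNRat.cast_le (K := ℝ)).2 h
      push_cast at h2
      exact h2
    refine h'.trans ?_
    gcongr
    rwa [div_le_iff₀ hCc]
  have hW : (0 : ℝ) < (A + S).card := by exact_mod_cast (hA.add hS).card_pos
  have hKpos : 0 < K := by
    by_contra! h
    nlinarith
  have hP := hplu (B := A) hS (by rw [add_comm]; exact hKS) (n + 1) n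
  have hQ := hplu (B := S) hA hKA (n + 1) n
  set P := n • A - n • A with hPd
  set Q := n • S - n • S with hQd
  have hset : n • (A - A + (S - S)) = P + Q := by rw [nsmul_add, nsmul_sub, nsmul_sub]
  have hPA : (n + 1) • A - n • A = P + A := by
    rw [succ_nsmul, hPd, add_sub_right_comm]
  have hQS : (n + 1) • S - n • S = S + Q := by
    rw [succ_nsmul', hQd, add_sub_assoc]
  rw [hPA] at hP
  rw [hQS] at hQ
  have t1 : ((P + Q).card : ℝ) * A.card ≤ (P + A).card * (A + Q).card := by
    exact_mod_cast Finset.ruzsa_triangle_inequality_add_add_add P A Q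
  have t2 : ((A + Q).card : ℝ) * S.card ≤ (A + S).card * (S + Q).card := by
    exact_mod_cast Finset.ruzsa_triangle_inequality_add_add_add A S Q
  rw [hset]
  have e : n + 1 + n = 2 * n + 1 := by ring
  rw [e] at hP hQ
  refine le_of_mul_le_mul_right (a := (A.card : ℝ) * S.card) ?_ (by positivity)
  calc ((P + Q).card : ℝ) * (A.card * S.card) = ((P + Q).card * A.card) * S.card := by ring
    _ ≤ ((P + A).card * (A + Q).card) * S.card := by gcongr
    _ = (P + A).card * ((A + Q).card * S.card) := by ring
    _ ≤ (K ^ (2 * n + 1) * S.card) * ((A + S).card * (S + Q).card) := by gcongr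
    _ ≤ (K ^ (2 * n + 1) * S.card) * ((K * A.card) * (K ^ (2 * n + 1) * A.card)) := by gcongr
    _ = K ^ (4 * n + 3) * A.card * (A.card * S.card) := by ring

theorem sum_mem_nsmul_of_subset {Z T : Finset G} (h : T ⊆ Z) :
    ∑ t ∈ T, t ∈ T.card • Z := by
  induction T using Finset.induction_on with
  | empty => simp
  | insert a T ha ih =>
    rw [Finset.sum_insert ha, Finset.card_insert_of_notMem ha, succ_nsmul']
    exact Finset.add_mem_add (h (Finset.mem_insert_self _ _))
      (ih fun x hx => h (Finset.mem_insert_of_mem hx))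

/-- Chang's covering lemma. -/
theorem exists_small_spanning_set {Z : Finset G} (h0 : (0 : G) ∈ Z) {d : ℕ}
    (hd : ((3 * d + 1) • Z).card < 2 ^ d * Z.card) :
    ∃ T ⊆ 3 • Z, T.card < d ∧ ∀ z ∈ 3 • Z, ∃ c : G → ℤ, (∀ t, |c t| ≤ 1) ∧
      z - ∑ t ∈ T, c t • t ∈ Z - Z := by
  classical
  -- Dissociation modulo Z: distinct subset sums of T give disjoint translates of Z. With d
  -- elements, 2^d disjoint translates would fit in (3d + 1)Z, which `hd` excludes. For a maximal T,
  -- adjoining z creates a collision with z on exactly one side, which writes z as a combination of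
  -- T with coefficients 0, ±1 modulo Z - Z.
  let Q : Finset G → Prop := fun T => ∀ T₁ ⊆ T, ∀ T₂ ⊆ T, T₁ ≠ T₂ →
    Disjoint ({∑ t ∈ T₁, t} + Z) ({∑ t ∈ T₂, t} + Z)
  have hcardQ : ∀ T ⊆ 3 • Z, Q T → T.card < d := by
    intro T hT hQ
    by_contra! hle
    obtain ⟨U, hUT, hUc⟩ := Finset.exists_subset_card_eq hle
    have hdisj : ∀ T₁ ∈ U.powerset, ∀ T₂ ∈ U.powerset, T₁ ≠ T₂ →
        Disjoint ({∑ t ∈ T₁, t} + Z) ({∑ t ∈ T₂, t} + Z) := fun T₁ h₁ T₂ h₂ hne =>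
      hQ T₁ ((Finset.mem_powerset.1 h₁).trans hUT) T₂ ((Finset.mem_powerset.1 h₂).trans hUT) hne
    have hsub : U.powerset.biUnion (fun T₁ => {∑ t ∈ T₁, t} + Z) ⊆ (3 * d + 1) • Z := by
      intro x hx
      obtain ⟨T₁, hT₁, hx⟩ := Finset.mem_biUnion.1 hx
      have hT₁U := Finset.mem_powerset.1 hT₁
      obtain ⟨y, hy, z, hz, rfl⟩ := Finset.mem_add.1 hx
      rw [Finset.mem_singleton.1 hy, succ_nsmul]
      refine Finset.add_mem_add ?_ hz
      have h1 := sum_mem_nsmul_of_subset ((hT₁U.trans hUT).trans hT)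
      rw [← mul_nsmul] at h1
      refine Finset.nsmul_subset_nsmul_right h0 ?_ h1
      have := Finset.card_le_card hT₁U
      omega
    have := Finset.card_le_card hsub
    rw [Finset.card_biUnion hdisj] at this
    simp only [Finset.card_singleton_add, Finset.sum_const, Finset.card_powerset, hUc,
      smul_eq_mul] at this
    omega
  have hne : ((3 • Z).powerset.filter Q).Nonempty := by
    refine ⟨∅, Finset.mem_filter.2 ⟨by simp, ?_⟩⟩
    intro T₁ h₁ T₂ h₂ hne
    exact absurd ((Finset.subset_empty.1 h₁).trans (Finset.subset_empty.1 h₂).symm) hne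
  obtain ⟨T, hTm, hmax⟩ := Finset.exists_max_image _ Finset.card hne
  obtain ⟨hT3, hQT⟩ := Finset.mem_filter.1 hTm
  rw [Finset.mem_powerset] at hT3
  refine ⟨T, hT3, hcardQ T hT3 hQT, fun z hz => ?_⟩
  by_cases hzT : z ∈ T
  · refine ⟨fun t => if t = z then 1 else 0, fun t => by dsimp only; split_ifs <;> simp, ?_⟩
    simp only [ite_smul, one_smul, zero_smul, Finset.sum_ite_eq', hzT, if_true, sub_self]
    exact Finset.mem_sub.2 ⟨0, h0, 0, h0, by simp⟩
  have hnot : ¬ Q (insert z T) := by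
    intro hQ'
    have := hmax (insert z T) (Finset.mem_filter.2 ⟨Finset.mem_powerset.2
      (Finset.insert_subset hz hT3), hQ'⟩)
    rw [Finset.card_insert_of_notMem hzT] at this
    omega
  have key : ∀ T₁ ⊆ insert z T, ∀ T₂ ⊆ insert z T, z ∈ T₁ → z ∉ T₂ →
      ¬ Disjoint ({∑ t ∈ T₁, t} + Z) ({∑ t ∈ T₂, t} + Z) →
      ∃ c : G → ℤ, (∀ t, |c t| ≤ 1) ∧ z - ∑ t ∈ T, c t • t ∈ Z - Z := by
    intro T₁ h₁ T₂ h₂ hz1 hz2 hdis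
    obtain ⟨x, hx1, hx2⟩ := Finset.not_disjoint_iff.1 hdis
    obtain ⟨y1, hy1, z1, hz1', rfl⟩ := Finset.mem_add.1 hx1
    obtain ⟨y2, hy2, z2, hz2', he⟩ := Finset.mem_add.1 hx2
    rw [Finset.mem_singleton.1 hy1, Finset.mem_singleton.1 hy2] at he
    have h₂' : T₂ ⊆ T := fun t ht => by
      rcases Finset.mem_insert.1 (h₂ ht) with h | h
      · exact absurd (h ▸ ht) hz2
      · exact h
    have h₁' : T₁.erase z ⊆ T := fun t ht => by
      obtain ⟨hne, ht'⟩ := Finset.mem_erase.1 ht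
      exact (Finset.mem_insert.1 (h₁ ht')).resolve_left hne
    refine ⟨fun t => (if t ∈ T₂ then 1 else 0) - (if t ∈ T₁.erase z then 1 else 0),
      fun t => by dsimp only; split_ifs <;> simp, ?_⟩
    have e1 : ∑ t ∈ T, ((if t ∈ T₂ then (1 : ℤ) else 0) - (if t ∈ T₁.erase z then 1 else 0)) • t
        = ∑ t ∈ T₂, t - ∑ t ∈ T₁.erase z, t := by
      simp only [sub_smul, Finset.sum_sub_distrib, ite_smul, one_smul, zero_smul]
      rw [← Finset.sum_filter, ← Finset.sum_filter, Finset.filter_mem_eq_inter,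
        Finset.filter_mem_eq_inter, Finset.inter_eq_right.2 h₂', Finset.inter_eq_right.2 h₁']
    rw [e1]
    rw [← Finset.add_sum_erase _ _ hz1] at he
    refine Finset.mem_sub.2 ⟨z2, hz2', z1, hz1', ?_⟩
    have : z2 - z1 = (z + ∑ t ∈ T₁.erase z, t) - ∑ t ∈ T₂, t := by
      rw [sub_eq_sub_iff_add_eq_add, add_comm, he]
    rw [this]; abel
  simp only [Q] at hnot
  push Not at hnot
  obtain ⟨T₁, h₁, T₂, h₂, hne12, hdis⟩ := hnot
  by_cases hz1 : z ∈ T₁ <;> by_cases hz2 : z ∈ T₂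
  · exfalso
    have a1 : T₁.erase z ⊆ T := fun t ht => by
      obtain ⟨hne, ht'⟩ := Finset.mem_erase.1 ht
      exact (Finset.mem_insert.1 (h₁ ht')).resolve_left hne
    have a2 : T₂.erase z ⊆ T := fun t ht => by
      obtain ⟨hne, ht'⟩ := Finset.mem_erase.1 ht
      exact (Finset.mem_insert.1 (h₂ ht')).resolve_left hne
    have a3 : T₁.erase z ≠ T₂.erase z := fun h => hne12 (by
      rw [← Finset.insert_erase hz1, ← Finset.insert_erase hz2, h])
    have a4 := hQT _ a1 _ a2 a3
    apply hdis
    rw [← Finset.add_sum_erase _ _ hz1, ← Finset.add_sum_erase _ _ hz2,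
      ← Finset.singleton_add_singleton, ← Finset.singleton_add_singleton, add_assoc, add_assoc]
    rw [Finset.disjoint_left] at a4 ⊢
    intro x hx1 hx2
    obtain ⟨y1, hy1, w1, hw1, rfl⟩ := Finset.mem_add.1 hx1
    obtain ⟨y2, hy2, w2, hw2, he⟩ := Finset.mem_add.1 hx2
    rw [Finset.mem_singleton.1 hy1, Finset.mem_singleton.1 hy2, add_right_inj] at he
    exact a4 hw1 (he ▸ hw2)
  · exact key T₁ h₁ T₂ h₂ hz1 hz2 hdis
  · exact key T₂ h₂ T₁ h₁ hz2 hz1 (fun h => hdis h.symm)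
  · exfalso
    refine hdis (hQT T₁ ?_ T₂ ?_ hne12)
    · intro t ht
      rcases Finset.mem_insert.1 (h₁ ht) with h | h
      · exact absurd (h ▸ ht) hz1
      · exact h
    · intro t ht
      rcases Finset.mem_insert.1 (h₂ ht) with h | h
      · exact absurd (h ▸ ht) hz2
      · exact h

/-- Adding an element of Z to a remainder in 2Z lands in 3Z, and the covering brings it back to Z -
Z = 2Z while changing each coefficient by at most 1. So nZ is covered by 2Z plus combinations of T
with coefficients in [-n, n]. -/
theorem card_nsmul_le_of_covering {Z T : Finset G} (hneg : -Z = Z)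
    (hT : ∀ z ∈ 3 • Z, ∃ c : G → ℤ, (∀ t, |c t| ≤ 1) ∧ z - ∑ t ∈ T, c t • t ∈ Z - Z) {n : ℕ}
    (hn : 2 ≤ n) : (n • Z).card ≤ (2 * n + 1) ^ T.card * (2 • Z).card := by
  classical
  have hZZ : Z - Z = 2 • Z := by rw [sub_eq_add_neg, hneg, two_nsmul]
  have hmem : ∀ n : ℕ, 2 ≤ n → ∀ z ∈ n • Z, ∃ c : G → ℤ, (∀ t, |c t| ≤ n) ∧
      z - ∑ t ∈ T, c t • t ∈ 2 • Z := by
    intro n hn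
    induction n, hn using Nat.le_induction with
    | base => intro z hz; exact ⟨0, by simp, by simpa using hz⟩
    | succ n hn ih =>
      intro z hz
      rw [succ_nsmul'] at hz
      obtain ⟨x, hx, y, hy, rfl⟩ := Finset.mem_add.1 hz
      obtain ⟨c, hc, hcy⟩ := ih y hy
      obtain ⟨c', hc', hcy'⟩ := hT (x + (y - ∑ t ∈ T, c t • t)) (by
        rw [show (3 : ℕ) = 2 + 1 from rfl, succ_nsmul']
        exact Finset.add_mem_add hx hcy)
      refine ⟨c + c', fun t => ?_, ?_⟩
      · have := abs_add_le (c t) (c' t)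
        have := hc t
        have := hc' t
        simp only [Pi.add_apply]
        push_cast
        linarith
      · rw [← hZZ]
        convert hcy' using 1
        simp only [Pi.add_apply, add_smul, Finset.sum_add_distrib]
        abel
  let box : Finset G := (Fintype.piFinset fun _ : T => Finset.Icc (-(n : ℤ)) n).image
    fun c => ∑ t : T, c t • (t : G)
  have hbox : box.card ≤ (2 * n + 1) ^ T.card := by
    refine Finset.card_image_le.trans ?_
    rw [Fintype.card_piFinset]
    simp only [Int.card_Icc, Finset.prod_const, Finset.card_univ, Fintype.card_coe]
    refine Nat.pow_le_pow_left (by omega) _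
  have hsub : n • Z ⊆ box + 2 • Z := by
    intro z hz
    obtain ⟨c, hc, hcz⟩ := hmem n hn z hz
    refine Finset.mem_add.2 ⟨∑ t ∈ T, c t • t, ?_, _, hcz, by abel⟩
    refine Finset.mem_image.2 ⟨fun t => c t, Fintype.mem_piFinset.2 fun t =>
      Finset.mem_Icc.2 (abs_le.1 (hc t)), ?_⟩
    exact Finset.sum_coe_sort T fun t => c t • t
  exact (Finset.card_le_card hsub).trans (Finset.card_add_le.trans (Nat.mul_le_mul_right _ hbox))

end Growth

/-! ### A local form of Chang's theorem on large spectra. -/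

section LocalSpectrum

variable {G : Type u} [AddCommGroup G] [DecidableEq G] [Fintype G]

theorem norm_one_sub_addChar_add_le (γ : AddChar G ℂ) (x y : G) :
    ‖1 - γ (x + y)‖ ≤ ‖1 - γ x‖ + ‖1 - γ y‖ := by
  have : 1 - γ (x + y) = (1 - γ x) + γ x * (1 - γ y) := by
    rw [AddChar.map_add_eq_mul]; ring
  rw [this]
  refine (norm_add_le _ _).trans ?_
  rw [norm_mul, AddChar.norm_apply, one_mul]

theorem norm_one_sub_addChar_neg (γ : AddChar G ℂ) (x : G) : ‖1 - γ (-x)‖ = ‖1 - γ x‖ := by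
  have : 1 - γ (-x) = -(γ (-x) * (1 - γ x)) := by
    have h : γ (-x) * γ x = 1 := by rw [← AddChar.map_add_eq_mul]; simp
    linear_combination -h
  rw [this, norm_neg, norm_mul, AddChar.norm_apply, one_mul]

open Classical in
/-- The elements of `tX` at which the characters in `Λ` are within `tκ` of `1`. -/
noncomputable def localBohr (X : Finset G) (κ : ℝ) (Λ : Finset (AddChar G ℂ)) (t : ℕ) : Finset G :=
  (t • X).filter fun x => ∀ γ ∈ Λ, ‖1 - γ x‖ ≤ t * κ

theorem mem_localBohr {X : Finset G} {κ : ℝ} {Λ : Finset (AddChar G ℂ)} {t : ℕ} {x : G} :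
    x ∈ localBohr X κ Λ t ↔ x ∈ t • X ∧ ∀ γ ∈ Λ, ‖1 - γ x‖ ≤ t * κ := by
  simp [localBohr]

theorem add_mem_localBohr {X : Finset G} {κ : ℝ} {Λ : Finset (AddChar G ℂ)} {s t : ℕ} {x y : G}
    (hx : x ∈ localBohr X κ Λ s) (hy : y ∈ localBohr X κ Λ t) : x + y ∈ localBohr X κ Λ (s + t) := by
  rw [mem_localBohr] at *
  refine ⟨by rw [add_nsmul]; exact Finset.add_mem_add hx.1 hy.1, fun γ hγ => ?_⟩
  refine (norm_one_sub_addChar_add_le γ x y).trans ?_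
  push_cast
  linarith [hx.2 γ hγ, hy.2 γ hγ]

theorem neg_nsmul_finset {X : Finset G} (hneg : -X = X) (t : ℕ) : -(t • X) = t • X := by
  rw [← neg_nsmul, hneg]

theorem neg_localBohr {X : Finset G} (hneg : -X = X) (κ : ℝ) (Λ : Finset (AddChar G ℂ)) (t : ℕ) :
    -localBohr X κ Λ t = localBohr X κ Λ t := by
  ext x
  rw [Finset.mem_neg', mem_localBohr, mem_localBohr, ← Finset.mem_neg', neg_nsmul_finset hneg]
  simp_rw [norm_one_sub_addChar_neg]

theorem zero_mem_localBohr {X : Finset G} (h0 : (0 : G) ∈ X) {κ : ℝ} (hκ : 0 ≤ κ)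
    (Λ : Finset (AddChar G ℂ)) (t : ℕ) : (0 : G) ∈ localBohr X κ Λ t := by
  rw [mem_localBohr]
  refine ⟨Finset.zero_mem_nsmul h0, fun γ _ => ?_⟩
  simp only [AddChar.map_zero_eq_one, sub_self, norm_zero]
  positivity

/-- Pigeonhole on q arcs of the circle, each of length 2π/q ≤ 2κ. -/
theorem exists_large_subset_small_variation (γ : AddChar G ℂ) {q : ℕ} (hq : 0 < q) {κ : ℝ}
    (hκ : Real.pi / q ≤ κ) (Y : Finset G) :
    ∃ Y' ⊆ Y, Y.card ≤ q * Y'.card ∧ ∀ x ∈ Y', ∀ y ∈ Y', ‖γ x - γ y‖ ≤ 2 * κ := by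
  classical
  have hqr : (0 : ℝ) < q := by exact_mod_cast hq
  have hpi := Real.pi_pos
  let v : G → ℝ := fun x => ((γ x).arg + Real.pi) * q / (2 * Real.pi)
  -- Arguments lie in (-π, π], so v takes values in (0, q] and the ceiling takes exactly the values
  -- 1, …, q; a floor would need q + 1 cells.
  let f : G → ℤ := fun x => ⌈v x⌉
  have hf : ∀ x ∈ Y, f x ∈ Finset.Icc (1 : ℤ) q := by
    intro x _
    have h1 := Complex.neg_pi_lt_arg (γ x)
    have h2 := Complex.arg_le_pi (γ x)
    rw [Finset.mem_Icc]
    constructor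
    · have : 0 < v x := by
        simp only [v]
        have : 0 < (γ x).arg + Real.pi := by linarith
        positivity
      have := Int.ceil_pos.2 this
      simp only [f]; omega
    · simp only [f]
      rw [Int.ceil_le]
      simp only [v]
      rw [div_le_iff₀ (by positivity)]
      push_cast
      nlinarith
  have hcard : (Finset.Icc (1 : ℤ) q).card = q := by simp
  have hne : (Finset.Icc (1 : ℤ) q).Nonempty := by
    rw [← Finset.card_pos, hcard]; exact hq
  obtain ⟨i, -, hi⟩ : ∃ i ∈ Finset.Icc (1 : ℤ) q,
      (Y.card : ℝ) / q ≤ ((Y.filter fun x => f x = i).card : ℝ) := by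
    refine Finset.exists_le_of_sum_le hne ?_
    rw [Finset.sum_const, hcard, nsmul_eq_mul, mul_div_cancel₀ _ hqr.ne']
    exact_mod_cast (Finset.card_eq_sum_card_fiberwise hf).le
  refine ⟨Y.filter fun x => f x = i, Finset.filter_subset _ _, ?_, ?_⟩
  · rw [div_le_iff₀ hqr] at hi
    have : (Y.card : ℝ) ≤ ((q * (Y.filter fun x => f x = i).card : ℕ) : ℝ) := by
      push_cast; linarith
    exact_mod_cast this
  · intro x hx y hy
    have hx' := (Finset.mem_filter.1 hx).2
    have hy' := (Finset.mem_filter.1 hy).2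
    have hvv : |v x - v y| ≤ 1 := by
      have a1 := Int.ceil_lt_add_one (v x)
      have a2 := Int.le_ceil (v x)
      have b1 := Int.ceil_lt_add_one (v y)
      have b2 := Int.le_ceil (v y)
      have e1 : (⌈v x⌉ : ℝ) = i := by exact_mod_cast hx'
      have e2 : (⌈v y⌉ : ℝ) = i := by exact_mod_cast hy'
      rw [e1] at a1 a2
      rw [e2] at b1 b2
      rw [abs_le]; constructor <;> linarith
    have harg : |(γ x).arg - (γ y).arg| ≤ 2 * κ := by
      have e : v x - v y = ((γ x).arg - (γ y).arg) * (q / (2 * Real.pi)) := by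
        simp only [v]; ring
      rw [e, abs_mul, abs_of_pos (by positivity : (0 : ℝ) < q / (2 * Real.pi)),
        ← le_div_iff₀ (by positivity)] at hvv
      refine hvv.trans ?_
      rw [one_div_div]
      calc 2 * Real.pi / q = 2 * (Real.pi / q) := by ring
        _ ≤ _ := by gcongr
    have hexp : ∀ x, γ x = Complex.exp (Complex.I * (γ x).arg) := by
      intro x
      have := Complex.norm_mul_exp_arg_mul_I (γ x)
      rw [AddChar.norm_apply, Complex.ofReal_one, one_mul, mul_comm] at this
      exact this.symm
    have : γ x - γ y = γ y * (Complex.exp (Complex.I * (((γ x).arg - (γ y).arg : ℝ) : ℂ)) - 1) := by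
      have hx := hexp x
      have hy := hexp y
      generalize (γ x).arg = a at hx ⊢
      generalize (γ y).arg = b at hy ⊢
      rw [hx, hy, mul_sub, mul_one, ← Complex.exp_add]
      congr 2
      push_cast; ring
    rw [this, norm_mul, AddChar.norm_apply, one_mul]
    exact (Real.norm_exp_I_mul_ofReal_sub_one_le).trans harg

/-- Pigeonhole one character at a time. Differences of elements of the surviving cell lie in X - X =
2X and bring every character within 2κ of 1, which is why the scale is 2. -/
theorem card_le_pow_mul_card_localBohr {X : Finset G} (hneg : -X = X) (h0 : (0 : G) ∈ X)
    {q : ℕ} (hq : 0 < q) {κ : ℝ} (hκ : Real.pi / q ≤ κ) (Λ : Finset (AddChar G ℂ)) :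
    X.card ≤ q ^ Λ.card * (localBohr X κ Λ 2).card := by
  classical
  have key : ∀ Λ : Finset (AddChar G ℂ), ∃ Y ⊆ X, X.card ≤ q ^ Λ.card * Y.card ∧
      ∀ γ ∈ Λ, ∀ x ∈ Y, ∀ y ∈ Y, ‖γ x - γ y‖ ≤ 2 * κ := by
    intro Λ
    induction Λ using Finset.induction_on with
    | empty => exact ⟨X, subset_rfl, by simp, by simp⟩
    | insert γ Λ hγ ih =>
      obtain ⟨Y, hY, hc, hv⟩ := ih
      obtain ⟨Y', hY', hc', hv'⟩ := exists_large_subset_small_variation γ hq hκ Y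
      refine ⟨Y', hY'.trans hY, ?_, ?_⟩
      · rw [Finset.card_insert_of_notMem hγ, pow_succ, mul_assoc]
        exact hc.trans (Nat.mul_le_mul_left _ hc')
      · intro χ hχ x hx y hy
        rcases Finset.mem_insert.1 hχ with rfl | h
        · exact hv' x hx y hy
        · exact hv χ h x (hY' hx) y (hY' hy)
  obtain ⟨Y, hY, hc, hv⟩ := key Λ
  refine hc.trans (Nat.mul_le_mul_left _ ?_)
  have hYne : Y.Nonempty := by
    rw [← Finset.card_pos]
    rcases Nat.eq_zero_or_pos Y.card with h | h
    · rw [h, mul_zero] at hc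
      exact absurd (Finset.card_pos.2 ⟨0, h0⟩) (by omega)
    · exact h
  obtain ⟨y, hy⟩ := hYne
  refine Finset.card_le_card_of_injOn (fun x => x - y) ?_ (fun _ _ _ _ h => by simpa using h)
  intro x hx
  show x - y ∈ localBohr X κ Λ 2
  rw [mem_localBohr]
  refine ⟨?_, fun γ hγ => ?_⟩
  · rw [two_nsmul, sub_eq_add_neg]
    refine Finset.add_mem_add (hY hx) ?_
    rw [← hneg]
    exact Finset.neg_mem_neg (hY hy)
  · have e : 1 - γ (x - y) = γ (-y) * (γ y - γ x) := by
      have h : γ (-y) * γ y = 1 := by rw [← AddChar.map_add_eq_mul]; simp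
      rw [sub_eq_add_neg x, AddChar.map_add_eq_mul]
      linear_combination -h
    rw [e, norm_mul, AddChar.norm_apply, one_mul]
    have := hv γ hγ y hy x hx
    push_cast
    linarith

/-- Both Z and y + Z fill all but η|Z| elements of Z', so (1 - γ y) times the sum of γ over Z has
norm at most 2η|Z|. That sum is itself at least |Z|/100. -/
theorem norm_one_sub_le_of_charMean {Z Z' Y : Finset G} (hZ : Z.Nonempty) {η : ℝ}
    (hreg : (Z'.card : ℝ) ≤ (1 + η) * Z.card) (hZZ' : Z ⊆ Z')
    (hadd : ∀ y ∈ Y, ∀ z ∈ Z, y + z ∈ Z') {γ : AddChar G ℂ} (hγ : 1 / 100 ≤ ‖charMean Z γ‖)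
    {y : G} (hy : y ∈ Y) : ‖1 - γ y‖ ≤ 200 * η := by
  have hZc : (0 : ℝ) < Z.card := by exact_mod_cast hZ.card_pos
  set W := ({y} : Finset G) + Z with hW
  have hWZ' : W ⊆ Z' := by
    intro w hw
    obtain ⟨a, ha, z, hz, rfl⟩ := Finset.mem_add.1 hw
    rw [Finset.mem_singleton.1 ha]
    exact hadd y hy z hz
  have hWc : W.card = Z.card := Finset.card_singleton_add ..
  have e1 : ∑ w ∈ W, γ w = γ y * ∑ z ∈ Z, γ z := by
    rw [hW, Finset.mul_sum]
    symm
    refine Finset.sum_bij (fun z _ => y + z) ?_ ?_ ?_ ?_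
    · intro z hz; exact Finset.add_mem_add (by simp) hz
    · intro a _ b _ h; simpa using h
    · intro b hb
      obtain ⟨a, ha, z, hz, rfl⟩ := Finset.mem_add.1 hb
      rw [Finset.mem_singleton.1 ha]
      exact ⟨z, hz, rfl⟩
    · intro z _; rw [AddChar.map_add_eq_mul]
  have hdiff : ∀ B ⊆ Z', B.card = Z.card → ‖∑ z ∈ Z' \ B, γ z‖ ≤ η * Z.card := by
    intro B hB hBc
    have : ‖∑ z ∈ Z' \ B, γ z‖ ≤ (Z' \ B).card := by
      refine (norm_sum_le _ _).trans ?_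
      simp
    refine this.trans ?_
    have h2 : ((Z' \ B).card : ℝ) + B.card = Z'.card := by
      exact_mod_cast Finset.card_sdiff_add_card_eq_card hB
    rw [hBc] at h2
    linarith
  have e2 : (1 - γ y) * ∑ z ∈ Z, γ z = ∑ z ∈ Z' \ W, γ z - ∑ z ∈ Z' \ Z, γ z := by
    have s1 := Finset.sum_sdiff (f := fun z => γ z) hWZ'
    have s2 := Finset.sum_sdiff (f := fun z => γ z) hZZ'
    rw [e1] at s1
    linear_combination s2 - s1
  have e3 : ‖1 - γ y‖ * ‖∑ z ∈ Z, γ z‖ ≤ 2 * η * Z.card := by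
    rw [← norm_mul, e2]
    refine (norm_sub_le _ _).trans ?_
    linarith [hdiff W hWZ' hWc, hdiff Z hZZ' rfl]
  rw [charMean, norm_div, Complex.norm_natCast, le_div_iff₀ hZc] at hγ
  have e4 : ‖1 - γ y‖ * (1 / 100 * Z.card) ≤ ‖1 - γ y‖ * ‖∑ z ∈ Z, γ z‖ := by gcongr
  have e5 : ‖1 - γ y‖ * (1 / 100 * Z.card) ≤ 2 * η * Z.card := e4.trans e3
  have e6 : (‖1 - γ y‖) * Z.card ≤ (200 * η) * Z.card := by linarith
  exact le_of_mul_le_mul_right e6 hZc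

theorem exists_step_le_of_lt_pow {f : ℕ → ℝ} {η : ℝ} (hη : 0 ≤ η) (I : ℕ)
    (h : f I < (1 + η) ^ I * f 0) : ∃ i < I, f (i + 1) ≤ (1 + η) * f i := by
  by_contra! hcon
  have : ∀ j ≤ I, (1 + η) ^ j * f 0 ≤ f j := by
    intro j
    induction j with
    | zero => simp
    | succ j ih =>
      intro hj
      have h1 := ih (by omega)
      have h2 := hcon j (by omega)
      have h3 : (1 + η) * ((1 + η) ^ j * f 0) ≤ (1 + η) * f j := by gcongr
      rw [pow_succ]
      linarith
  exact absurd (this I le_rfl) (not_le.2 h)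

/-- The real part of the character `γ`, rotated so as to have a positive mean over `X`. -/
noncomputable def alignedRe (X : Finset G) (γ : AddChar G ℂ) (x : G) : ℝ :=
  ((starRingEnd ℂ (charMean X γ) / ‖charMean X γ‖) * γ x).re

theorem norm_conj_div_norm_le (z : ℂ) : ‖starRingEnd ℂ z / ‖z‖‖ ≤ 1 := by
  rw [norm_div, RCLike.norm_conj, Complex.norm_real, norm_norm]
  exact div_self_le_one _

theorem abs_alignedRe_le (X : Finset G) (γ : AddChar G ℂ) (x : G) : |alignedRe X γ x| ≤ 1 := by
  refine (Complex.abs_re_le_norm _).trans ?_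
  rw [norm_mul, AddChar.norm_apply, mul_one]
  exact norm_conj_div_norm_le _

theorem alignedRe_add_le (X : Finset G) (γ : AddChar G ℂ) (x z : G) :
    alignedRe X γ (x + z) ≤ alignedRe X γ x + ‖1 - γ z‖ := by
  rw [← sub_le_iff_le_add', alignedRe, alignedRe, ← Complex.sub_re, ← mul_sub]
  refine ((le_abs_self _).trans (Complex.abs_re_le_norm _)).trans ?_
  have : γ (x + z) - γ x = -(γ x * (1 - γ z)) := by rw [AddChar.map_add_eq_mul]; ring
  rw [this, norm_mul, norm_neg, norm_mul, AddChar.norm_apply, one_mul]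
  exact mul_le_of_le_one_left (norm_nonneg _) (norm_conj_div_norm_le _)

theorem sum_alignedRe (X : Finset G) (γ : AddChar G ℂ) :
    ∑ x ∈ X, alignedRe X γ x = X.card * ‖charMean X γ‖ := by
  rcases X.eq_empty_or_nonempty with rfl | hX
  · simp
  have hXc : (X.card : ℂ) ≠ 0 := by exact_mod_cast hX.card_pos.ne'
  simp only [alignedRe]
  rw [← Complex.re_sum, ← Finset.mul_sum]
  have h1 : ∑ x ∈ X, γ x = X.card * charMean X γ := by rw [charMean]; field_simp
  rw [h1]
  rcases eq_or_ne (charMean X γ) 0 with h | h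
  · simp [h]
  have hn : ((‖charMean X γ‖ : ℝ) : ℂ) ≠ 0 := by exact_mod_cast norm_ne_zero_iff.2 h
  have : starRingEnd ℂ (charMean X γ) / ‖charMean X γ‖ * (X.card * charMean X γ)
      = ((X.card * ‖charMean X γ‖ : ℝ) : ℂ) := by
    have h2 : starRingEnd ℂ (charMean X γ) * charMean X γ = (‖charMean X γ‖ : ℂ) ^ 2 := by
      rw [← Complex.normSq_eq_conj_mul_self, Complex.normSq_eq_norm_sq]; push_cast; rfl
    rw [div_mul_eq_mul_div, div_eq_iff hn]
    push_cast
    linear_combination (X.card : ℂ) * h2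
  rw [this, Complex.ofReal_re]

theorem sum_alignedRe_add_le (X Z : Finset G) (γ : AddChar G ℂ) (x : G) :
    ∑ z ∈ Z, alignedRe X γ (x + z) ≤ Z.card * ‖charMean Z γ‖ := by
  rcases Z.eq_empty_or_nonempty with rfl | hZ
  · simp
  have hZc : (Z.card : ℂ) ≠ 0 := by exact_mod_cast hZ.card_pos.ne'
  simp only [alignedRe, AddChar.map_add_eq_mul]
  rw [← Complex.re_sum, ← Finset.mul_sum, ← Finset.mul_sum]
  have h1 : ∑ x ∈ Z, γ x = Z.card * charMean Z γ := by rw [charMean]; field_simp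
  rw [h1]
  refine ((le_abs_self _).trans (Complex.abs_re_le_norm _)).trans ?_
  rw [norm_mul, norm_mul, norm_mul, AddChar.norm_apply, one_mul, Complex.norm_natCast]
  exact mul_le_of_le_one_left (by positivity) (norm_conj_div_norm_le _)

/-- A random point of `(|Λ| N) X` under all of whose translates the exponential moment of the
aligned characters in `Λ` is small. -/
def HasSmallMoment (X : Finset G) (N : ℕ) (Λ : Finset (AddChar G ℂ)) : Prop :=
  ∃ (ι : Type u) (_ : Fintype ι) (_ : Nonempty ι) (p : ι → G),
    (∀ i, p i ∈ (Λ.card * N) • X) ∧ ∀ w, ∑ i, Real.exp (1 / 4 * ∑ γ ∈ Λ, alignedRe X γ (w + p i))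
      ≤ Real.exp (27 / 400) ^ Λ.card * Fintype.card ι

theorem hasSmallMoment_empty (X : Finset G) (N : ℕ) : HasSmallMoment X N ∅ :=
  ⟨PUnit, inferInstance, inferInstance, fun _ => 0, by simp, by simp⟩

/-- Add to the random point an independent uniform element of the local Bohr set. The old characters
barely notice, costing at most 1/400 in the exponent. The new one has mean at most 1/100 there, so
exp t ≤ 1 + t + t² with t a quarter of its aligned real part gives 1 + 1/400 + 1/16 ≤ exp(26/400).
-/
theorem HasSmallMoment.insert_char [DecidableEq (AddChar G ℂ)] {X : Finset G} (h0 : (0 : G) ∈ X)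
    {N : ℕ} {Λ : Finset (AddChar G ℂ)}
    (h : HasSmallMoment X N Λ) {κ : ℝ} (hκ0 : 0 ≤ κ) (hκ : Λ.card * (N * κ) ≤ 1 / 100) {t : ℕ}
    (ht : t ≤ N) {γ : AddChar G ℂ} (hγΛ : γ ∉ Λ)
    (hγ : ‖charMean (localBohr X κ Λ t) γ‖ ≤ 1 / 100) :
    HasSmallMoment X N (insert γ Λ) := by
  obtain ⟨ι, _, _, p, hp, hmom⟩ := h
  set Z := localBohr X κ Λ t with hZ
  have hZne : Z.Nonempty := ⟨0, zero_mem_localBohr h0 hκ0 Λ t⟩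
  have hZc : (0 : ℝ) < Z.card := by exact_mod_cast hZne.card_pos
  have : Nonempty Z := hZne.coe_sort
  refine ⟨ι × Z, inferInstance, inferInstance, fun i => p i.1 + i.2, ?_, ?_⟩
  · rintro ⟨i, z, hz⟩
    rw [Finset.card_insert_of_notMem hγΛ, add_mul, one_mul, add_nsmul]
    exact Finset.add_mem_add (hp i)
      (Finset.nsmul_subset_nsmul_right h0 ht (mem_localBohr.1 hz).1)
  · intro w
    rw [Finset.card_insert_of_notMem hγΛ, pow_succ, Fintype.card_prod, Fintype.card_coe,
      Fintype.sum_prod_type]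
    have hinner : ∀ i, ∑ z : Z, Real.exp (1 / 4 * ∑ χ ∈ insert γ Λ, alignedRe X χ (w + (p i + z)))
        ≤ Real.exp (1 / 4 * ∑ χ ∈ Λ, alignedRe X χ (w + p i)) * (Real.exp (27 / 400) * Z.card) := by
      intro i
      have hpt : ∀ z ∈ Z, Real.exp (1 / 4 * ∑ χ ∈ insert γ Λ, alignedRe X χ (w + (p i + z)))
          ≤ Real.exp (1 / 4 * ∑ χ ∈ Λ, alignedRe X χ (w + p i)) * Real.exp (1 / 400) *
            Real.exp (1 / 4 * alignedRe X γ (w + p i + z)) := by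
        intro z hz
        rw [← Real.exp_add, ← Real.exp_add, Finset.sum_insert hγΛ, ← add_assoc]
        refine Real.exp_le_exp.2 ?_
        have : ∑ χ ∈ Λ, alignedRe X χ (w + p i + z)
            ≤ ∑ χ ∈ Λ, (alignedRe X χ (w + p i) + N * κ) := by
          refine Finset.sum_le_sum fun χ hχ => (alignedRe_add_le X χ _ _).trans ?_
          have h1 := (mem_localBohr.1 hz).2 χ hχ
          have h2 : (t : ℝ) * κ ≤ N * κ := by gcongr
          linarith
        rw [Finset.sum_add_distrib, Finset.sum_const, nsmul_eq_mul] at this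
        linarith
      have hexp : ∑ z ∈ Z, Real.exp (1 / 4 * alignedRe X γ (w + p i + z))
          ≤ Real.exp (26 / 400) * Z.card := by
        have hb : ∀ z ∈ Z, Real.exp (1 / 4 * alignedRe X γ (w + p i + z))
            ≤ 1 + 1 / 4 * alignedRe X γ (w + p i + z) + 1 / 16 := by
          intro z _
          have a0 := abs_alignedRe_le X γ (w + p i + z)
          have a1 : |1 / 4 * alignedRe X γ (w + p i + z)| ≤ 1 := by
            rw [abs_mul, abs_of_pos (by norm_num : (0 : ℝ) < 1 / 4)]; linarith
          have a2 := (abs_le.1 (Real.abs_exp_sub_one_sub_id_le a1)).2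
          have a3 : alignedRe X γ (w + p i + z) ^ 2 ≤ 1 := (sq_le_one_iff_abs_le_one _).2 a0
          nlinarith
        refine (Finset.sum_le_sum hb).trans ?_
        simp only [Finset.sum_add_distrib, Finset.sum_const, nsmul_eq_mul, ← Finset.mul_sum]
        have s1 := sum_alignedRe_add_le X Z γ (w + p i)
        have s2 : (Z.card : ℝ) * ‖charMean Z γ‖ ≤ Z.card * (1 / 100) := by gcongr
        have s3 := Real.add_one_le_exp (26 / 400 : ℝ)
        nlinarith
      rw [Finset.sum_coe_sort Z fun z =>
        Real.exp (1 / 4 * ∑ χ ∈ insert γ Λ, alignedRe X χ (w + (p i + z)))]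
      refine (Finset.sum_le_sum hpt).trans ?_
      rw [← Finset.mul_sum]
      have e : Real.exp (27 / 400) = Real.exp (1 / 400) * Real.exp (26 / 400) := by
        rw [← Real.exp_add]; norm_num
      rw [e, mul_assoc, mul_assoc]
      gcongr
    refine (Finset.sum_le_sum fun i _ => hinner i).trans ?_
    rw [← Finset.sum_mul]
    have := mul_le_mul_of_nonneg_right (hmom w)
      (by positivity : (0 : ℝ) ≤ Real.exp (27 / 400) * Z.card)
    refine this.trans (le_of_eq ?_)
    push_cast
    ring

/-- By Jensen's inequality the exponential moment over X is at least exp(|Λ|/8), as each aligned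
mean is at least 1/2. Every shift of X by minus a value of the random point stays in (|Λ|N + 1)X,
where the averaged moment is at most exp(27|Λ|/400) per point. Finally 1/8 - 27/400 = 23/400. -/
theorem HasSmallMoment.card_bound {X : Finset G} (h0 : (0 : G) ∈ X) (hneg : -X = X) {N : ℕ}
    {Λ : Finset (AddChar G ℂ)} (h : HasSmallMoment X N Λ)
    (hΛ : ∀ γ ∈ Λ, 1 / 2 ≤ ‖charMean X γ‖) :
    Real.exp (23 / 400 * Λ.card) * X.card ≤ ((Λ.card * N + 1) • X).card := by
  obtain ⟨ι, _, _, p, hp, hmom⟩ := h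
  have hXc : (0 : ℝ) < X.card := by exact_mod_cast Finset.card_pos.2 ⟨0, h0⟩
  have hι : (0 : ℝ) < Fintype.card ι := by exact_mod_cast Fintype.card_pos
  set R := (Λ.card * N + 1) • X with hR
  let F : G → ℝ := fun x => Real.exp (1 / 4 * ∑ γ ∈ Λ, alignedRe X γ x)
  have hF0 : ∀ x, 0 ≤ F x := fun x => (Real.exp_pos _).le
  have hlow : ∀ i, ∑ x ∈ X, F x ≤ ∑ w ∈ R, F (w + p i) := by
    intro i
    have e1 : ∑ x ∈ X, F x = ∑ w ∈ X.image (fun x => x - p i), F (w + p i) := by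
      rw [Finset.sum_image (fun _ _ _ _ h => by simpa using h)]
      simp
    rw [e1]
    refine Finset.sum_le_sum_of_subset_of_nonneg ?_ fun _ _ _ => hF0 _
    intro w hw
    obtain ⟨x, hx, rfl⟩ := Finset.mem_image.1 hw
    rw [hR, succ_nsmul', sub_eq_add_neg]
    refine Finset.add_mem_add hx ?_
    rw [← neg_nsmul_finset hneg]
    exact Finset.neg_mem_neg (hp i)
  have hup : ∑ i, ∑ w ∈ R, F (w + p i)
      ≤ R.card * (Real.exp (27 / 400) ^ Λ.card * Fintype.card ι) := by
    rw [Finset.sum_comm, ← nsmul_eq_mul]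
    exact Finset.sum_le_card_nsmul _ _ _ fun w _ => hmom w
  have hjensen : X.card * Real.exp (1 / 8 * Λ.card) ≤ ∑ x ∈ X, F x := by
    have hj := convexOn_exp.map_sum_le (t := X) (w := fun _ => (X.card : ℝ)⁻¹)
      (p := fun x => 1 / 4 * ∑ γ ∈ Λ, alignedRe X γ x) (fun _ _ => by positivity)
      (by simp [hXc.ne']) (fun _ _ => Set.mem_univ _)
    simp only [smul_eq_mul, ← Finset.mul_sum] at hj
    have e2 : 1 / 8 * (Λ.card : ℝ)
        ≤ (X.card : ℝ)⁻¹ * (1 / 4 * ∑ x ∈ X, ∑ γ ∈ Λ, alignedRe X γ x) := by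
      rw [Finset.sum_comm]
      simp_rw [sum_alignedRe]
      rw [← Finset.mul_sum]
      have e3 : (Λ.card : ℝ) * (1 / 2) ≤ ∑ γ ∈ Λ, ‖charMean X γ‖ := by
        rw [← nsmul_eq_mul]
        exact Finset.card_nsmul_le_sum _ _ _ hΛ
      have e4 : (X.card : ℝ)⁻¹ * (1 / 4 * (X.card * ∑ γ ∈ Λ, ‖charMean X γ‖))
          = 1 / 4 * ∑ γ ∈ Λ, ‖charMean X γ‖ := by field_simp
      rw [e4]
      linarith
    have e5 := (Real.exp_le_exp.2 e2).trans hj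
    rw [inv_mul_eq_div, le_div_iff₀ hXc] at e5
    linarith
  have hall : Fintype.card ι * (X.card * Real.exp (1 / 8 * Λ.card))
      ≤ R.card * (Real.exp (27 / 400) ^ Λ.card * Fintype.card ι) := by
    refine le_trans ?_ hup
    rw [← nsmul_eq_mul, ← Finset.card_univ]
    exact Finset.card_nsmul_le_sum _ _ _ fun i _ => hjensen.trans (hlow i)
  have hfin : X.card * Real.exp (1 / 8 * Λ.card) ≤ R.card * Real.exp (27 / 400) ^ Λ.card := by
    refine le_of_mul_le_mul_right (a := (Fintype.card ι : ℝ)) ?_ hι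
    linarith
  rw [← Real.exp_nat_mul] at hfin
  have e6 : Real.exp (1 / 8 * (Λ.card : ℝ))
      = Real.exp (23 / 400 * Λ.card) * Real.exp (Λ.card * (27 / 400)) := by
    rw [← Real.exp_add]; congr 1; ring
  rw [e6] at hfin
  refine le_of_mul_le_mul_right (a := Real.exp (Λ.card * (27 / 400))) ?_ (Real.exp_pos _)
  linarith

/-- A local form of Chang's theorem: the large spectrum of `X` is close to `1` on a large part
of `2X`. -/
theorem exists_subset_annihilating_spectrum {X : Finset G} (h0 : (0 : G) ∈ X) (hneg : -X = X)
    {r q I : ℕ} (hq : 0 < q) {κ η : ℝ} (hη : 0 ≤ η) (hκ : Real.pi / q ≤ κ)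
    (hsmall : r * ((2 + 2 * I : ℕ) * κ) ≤ 1 / 100)
    (hgrow : (((2 + 2 * I) • X).card : ℝ) * q ^ r < (1 + η) ^ I * X.card)
    (hdim : (((r * (2 + 2 * I) + 1) • X).card : ℝ) < Real.exp (23 / 400 * r) * X.card) :
    ∃ Z ⊆ 2 • X, (0 : G) ∈ Z ∧ -Z = Z ∧ X.card ≤ q ^ r * Z.card ∧
      ∀ γ : AddChar G ℂ, 1 / 2 ≤ ‖charMean X γ‖ → ∀ z ∈ Z, ‖1 - γ z‖ ≤ 200 * η := by
  classical
  set N := 2 + 2 * I with hN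
  have hqr : (0 : ℝ) < q := by exact_mod_cast hq
  have hκ0 : 0 ≤ κ := le_trans (by positivity) hκ
  let F : Finset (Finset (AddChar G ℂ)) := Finset.univ.filter fun Λ =>
    (∀ γ ∈ Λ, 1 / 2 ≤ ‖charMean X γ‖) ∧ HasSmallMoment X N Λ ∧ Λ.card ≤ r
  have hF : ∀ Λ, Λ ∈ F ↔ (∀ γ ∈ Λ, 1 / 2 ≤ ‖charMean X γ‖) ∧ HasSmallMoment X N Λ ∧
      Λ.card ≤ r := by simp [F]
  have hFne : F.Nonempty := ⟨∅, (hF _).2 ⟨by simp, hasSmallMoment_empty X N, by simp⟩⟩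
  -- The maximal set plays the role of a maximal dissociated set. By `hdim` and
  -- `HasSmallMoment.card_bound` its size stays strictly below r, so there is room to adjoin one
  -- more character.
  obtain ⟨Λ, hΛF, hmax⟩ := F.exists_max_image Finset.card hFne
  obtain ⟨hΛs, hΛm, hΛr⟩ := (hF Λ).1 hΛF
  have hΛlt : Λ.card < r := by
    rcases hΛr.lt_or_eq with h | h
    · exact h
    · have := hΛm.card_bound h0 hneg hΛs
      rw [h] at this
      exact absurd hdim (not_lt.2 this)
  have hpig := card_le_pow_mul_card_localBohr hneg h0 hq hκ Λ
  have hpow : q ^ Λ.card ≤ q ^ r := Nat.pow_le_pow_right hq hΛr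
  have hXZ : X.card ≤ q ^ r * (localBohr X κ Λ 2).card := hpig.trans (Nat.mul_le_mul_right _ hpow)
  have hmono : ∀ t, localBohr X κ Λ t ⊆ localBohr X κ Λ (t + 2) := fun t x hx => by
    simpa using add_mem_localBohr hx (zero_mem_localBohr h0 hκ0 Λ 2)
  -- A regular scale: the local Bohr sets cannot grow by a factor above 1 + η at each of the `I`
  -- steps, since they start with at least |X|/q^r elements and end inside N • X.
  obtain ⟨i, hi, hreg⟩ := exists_step_le_of_lt_pow
    (f := fun i => ((localBohr X κ Λ (2 + 2 * i)).card : ℝ)) hη I (by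
      have a1 : ((localBohr X κ Λ (2 + 2 * I)).card : ℝ) ≤ (N • X).card := by
        exact_mod_cast Finset.card_le_card fun x hx => (mem_localBohr.1 hx).1
      have a2 : (X.card : ℝ) ≤ q ^ r * (localBohr X κ Λ 2).card := by exact_mod_cast hXZ
      have a3 : (1 + η) ^ I * (X.card : ℝ)
          ≤ (1 + η) ^ I * (q ^ r * (localBohr X κ Λ 2).card) := by gcongr
      have a4 : ((localBohr X κ Λ (2 + 2 * I)).card : ℝ) * q ^ r ≤ (N • X).card * q ^ r := by
        gcongr
      have a5 : ((localBohr X κ Λ (2 + 2 * I)).card : ℝ) * q ^ r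
          < ((1 + η) ^ I * (localBohr X κ Λ 2).card) * q ^ r := by linarith
      simpa using lt_of_mul_lt_mul_right a5 (by positivity))
  have hκN : (Λ.card : ℝ) * (N * κ) ≤ 1 / 100 := by
    refine le_trans ?_ hsmall
    gcongr
  refine ⟨localBohr X κ Λ 2, fun x hx => (mem_localBohr.1 hx).1, zero_mem_localBohr h0 hκ0 Λ 2,
    neg_localBohr hneg κ Λ 2, hXZ, fun γ hγ z hz => ?_⟩
  have hZne : (localBohr X κ Λ (2 + 2 * i)).Nonempty := ⟨0, zero_mem_localBohr h0 hκ0 Λ _⟩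
  refine norm_one_sub_le_of_charMean hZne hreg (hmono _) (Y := localBohr X κ Λ 2) ?_ ?_ hz
  · intro y hy w hw
    have e : 2 + 2 * (i + 1) = 2 + 2 * i + 2 := by ring
    rw [e, add_comm y w]
    exact add_mem_localBohr hw hy
  -- If the mean of γ were below 1/100, then γ could be adjoined to Λ, against maximality. It is not
  -- already there, because the characters in Λ have mean close to 1 on the local Bohr set.
  · by_contra! hlt
    have hγΛ : γ ∉ Λ := by
      intro hmem
      have hZc : (0 : ℝ) < (localBohr X κ Λ (2 + 2 * i)).card := by exact_mod_cast hZne.card_pos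
      have h1 : 1 - charMean (localBohr X κ Λ (2 + 2 * i)) γ
          = (∑ x ∈ localBohr X κ Λ (2 + 2 * i), (1 - γ x)) /
            (localBohr X κ Λ (2 + 2 * i)).card := by
        have : ((localBohr X κ Λ (2 + 2 * i)).card : ℂ) ≠ 0 := by exact_mod_cast hZc.ne'
        rw [charMean, Finset.sum_sub_distrib]
        simp only [Finset.sum_const, nsmul_eq_mul, mul_one]
        field_simp
      have h2 : ‖1 - charMean (localBohr X κ Λ (2 + 2 * i)) γ‖ ≤ 1 / 100 := by
        rw [h1, norm_div, Complex.norm_natCast, div_le_iff₀ hZc, mul_comm (1 / 100 : ℝ), ← nsmul_eq_mul]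
        refine (norm_sum_le _ _).trans (Finset.sum_le_card_nsmul _ _ _ fun x hx => ?_)
        refine ((mem_localBohr.1 hx).2 γ hmem).trans ?_
        have hc1 : (1 : ℝ) ≤ Λ.card := by
          exact_mod_cast Finset.card_pos.2 ⟨γ, hmem⟩
        have h3 : ((2 + 2 * i : ℕ) : ℝ) * κ ≤ N * κ := by
          gcongr; omega
        have h4 : (0 : ℝ) ≤ N * κ := by positivity
        nlinarith
      have h5 := norm_sub_norm_le (1 : ℂ) (1 - charMean (localBohr X κ Λ (2 + 2 * i)) γ)
      rw [sub_sub_cancel, norm_one] at h5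
      linarith
    have hins := hΛm.insert_char h0 hκ0 hκN (by omega : 2 + 2 * i ≤ N) hγΛ hlt.le
    have hcardins := Finset.card_insert_of_notMem hγΛ
    have := hmax (insert γ Λ) ((hF _).2 ⟨?_, hins, by omega⟩)
    · omega
    · intro χ hχ
      rcases Finset.mem_insert.1 hχ with rfl | h
      · exact hγ
      · exact hΛs χ h

end LocalSpectrum

/-! ### Successive minima of lattices and lattice point counts. -/

section SuccessiveMinima

variable {V : Type*} [NormedAddCommGroup V] [NormedSpace ℝ V] [Module ℚ V]

/-- A flag of rational subspaces spanned by successively shortest vectors of a lattice. -/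
structure IsGreedyFlag (Λ : Submodule ℤ V) (m : ℕ) (v : ℕ → V) (P : ℕ → Submodule ℚ V) : Prop where
  zero : P 0 = ⊥
  succ : ∀ i, P (i + 1) = P i ⊔ Submodule.span ℚ {v i}
  mem : ∀ i < m, v i ∈ Λ
  notMem : ∀ i < m, v i ∉ P i
  min : ∀ i < m, ∀ x ∈ Λ, x ∉ P i → ‖v i‖ ≤ ‖x‖
  top : ∀ x ∈ Λ, x ∈ P m

/-- Finiteness of balls provides a shortest lattice vector outside each subspace. Every such choice
raises the rational dimension, which the span of T bounds. -/
theorem exists_isGreedyFlag (Λ : Submodule ℤ V) (hfin : ∀ R : ℝ, {x | x ∈ Λ ∧ ‖x‖ ≤ R}.Finite)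
    (T : Finset V) (hT : ∀ x ∈ Λ, x ∈ Submodule.span ℚ (T : Set V)) :
    ∃ m ≤ T.card, ∃ v P, IsGreedyFlag Λ m v P := by
  classical
  have hpick : ∀ P : Submodule ℚ V, ∃ w : V, (∃ x ∈ Λ, x ∉ P) →
      w ∈ Λ ∧ w ∉ P ∧ ∀ x ∈ Λ, x ∉ P → ‖w‖ ≤ ‖x‖ := by
    intro P
    by_cases h : ∃ x ∈ Λ, x ∉ P
    · obtain ⟨x, hx, hxP⟩ := h
      have hf : {y | (y ∈ Λ ∧ ‖y‖ ≤ ‖x‖) ∧ y ∉ P}.Finite :=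
        (hfin ‖x‖).subset fun y hy => hy.1
      obtain ⟨w, hw, hmin⟩ := Set.exists_min_image _ (fun y : V => ‖y‖) hf
        ⟨x, ⟨hx, le_rfl⟩, hxP⟩
      refine ⟨w, fun _ => ⟨hw.1.1, hw.2, fun y hy hyP => ?_⟩⟩
      rcases le_total ‖y‖ ‖x‖ with h | h
      · exact hmin y ⟨⟨hy, h⟩, hyP⟩
      · exact hw.1.2.trans h
    · exact ⟨0, fun h' => absurd h' h⟩
  choose pick hpick using hpick
  obtain ⟨P, hP0, hPs⟩ : ∃ P : ℕ → Submodule ℚ V, P 0 = ⊥ ∧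
      ∀ i, P (i + 1) = P i ⊔ Submodule.span ℚ {pick (P i)} :=
    ⟨fun i => Nat.rec (motive := fun _ => Submodule ℚ V) ⊥
      (fun _ Q => Q ⊔ Submodule.span ℚ {pick Q}) i, rfl, fun _ => rfl⟩
  set U := Submodule.span ℚ (T : Set V) with hU
  have hfd : FiniteDimensional ℚ U := FiniteDimensional.span_finset ℚ T
  have hrank : Module.finrank ℚ U ≤ T.card := finrank_span_finset_le_card T
  have hgrow : ∀ n : ℕ, (∀ i < n, ∃ x ∈ Λ, x ∉ P i) → P n ≤ U ∧ n ≤ Module.finrank ℚ ↥(P n) := by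
    intro n
    induction n with
    | zero => intro _; rw [hP0]; exact ⟨bot_le, Nat.zero_le _⟩
    | succ n ih =>
      intro h
      obtain ⟨h1, h2⟩ := ih fun i hi => h i (by omega)
      obtain ⟨w1, w2, -⟩ := hpick (P n) (h n (by omega))
      have h3 : P (n + 1) ≤ U := by
        rw [hPs]
        refine sup_le h1 ?_
        rw [Submodule.span_le, Set.singleton_subset_iff]
        exact hT _ w1
      refine ⟨h3, ?_⟩
      have : FiniteDimensional ℚ (P (n + 1)) := Submodule.finiteDimensional_of_le h3
      have hlt : P n < P (n + 1) := by
        refine lt_of_le_of_ne (by rw [hPs]; exact le_sup_left) fun he => w2 ?_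
        refine he.ge ?_
        rw [hPs]
        exact Submodule.mem_sup_right (Submodule.mem_span_singleton_self _)
      have := Submodule.finrank_lt_finrank_of_lt hlt
      omega
  have hbound : ∀ n, (∀ i < n, ∃ x ∈ Λ, x ∉ P i) → n ≤ T.card := by
    intro n h
    obtain ⟨h1, h2⟩ := hgrow n h
    exact h2.trans ((Submodule.finrank_mono h1).trans hrank)
  have hex : ∃ i, ∀ x ∈ Λ, x ∈ P i := by
    by_contra! hcon
    have := hbound (T.card + 1) fun i _ => hcon i
    omega
  have hlt : ∀ i < Nat.find hex, ∃ x ∈ Λ, x ∉ P i := by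
    intro i hi
    have := Nat.find_min hex hi
    push Not at this
    exact this
  exact ⟨Nat.find hex, hbound _ hlt, fun i => pick (P i), P, hP0, hPs,
    fun i hi => (hpick _ (hlt i hi)).1, fun i hi => (hpick _ (hlt i hi)).2.1,
    fun i hi => (hpick _ (hlt i hi)).2.2, Nat.find_spec hex⟩

namespace IsGreedyFlag

variable {Λ : Submodule ℤ V} {m : ℕ} {v : ℕ → V} {P : ℕ → Submodule ℚ V}

theorem le_succ (h : IsGreedyFlag Λ m v P) (i : ℕ) : P i ≤ P (i + 1) := by
  rw [h.succ]; exact le_sup_left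

theorem mem_succ (h : IsGreedyFlag Λ m v P) (i : ℕ) : v i ∈ P (i + 1) := by
  rw [h.succ]; exact Submodule.mem_sup_right (Submodule.mem_span_singleton_self _)

theorem norm_pos (h : IsGreedyFlag Λ m v P) {i : ℕ} (hi : i < m) : 0 < ‖v i‖ := by
  rw [_root_.norm_pos_iff]
  intro h0
  exact h.notMem i hi (h0 ▸ Submodule.zero_mem _)

theorem norm_le_succ (h : IsGreedyFlag Λ m v P) {i : ℕ} (hi : i + 1 < m) :
    ‖v i‖ ≤ ‖v (i + 1)‖ :=
  h.min i (by omega) _ (h.mem _ hi) fun hm => h.notMem _ hi (h.le_succ i hm)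

theorem finrank_le (h : IsGreedyFlag Λ m v P) (i : ℕ) :
    FiniteDimensional ℚ (P i) ∧ Module.finrank ℚ (P i) ≤ i := by
  induction i with
  | zero => rw [h.zero]; exact ⟨inferInstance, by simp⟩
  | succ i ih =>
    obtain ⟨h1, h2⟩ := ih
    rw [h.succ]
    refine ⟨inferInstance, (Submodule.finrank_add_le_finrank_add_finrank _ _).trans ?_⟩
    have := finrank_span_le_card (R := ℚ) ({v i} : Set V)
    simp only [Set.toFinset_singleton, Finset.card_singleton] at this
    omega

theorem coeff_eq_zero (h : IsGreedyFlag Λ m v P) (c : ℕ → ℤ) {i : ℕ} (hi : i ≤ m)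
    (hc : ∑ k ∈ Finset.range i, c k • v k = 0) : ∀ k < i, c k = 0 := by
  have hmem : ∀ n, ∑ k ∈ Finset.range n, c k • v k ∈ P n := by
    intro n
    induction n with
    | zero => simp
    | succ n ih =>
      rw [Finset.sum_range_succ]
      exact Submodule.add_mem _ (h.le_succ n ih) (zsmul_mem (h.mem_succ n) _)
  induction i with
  | zero => intro k hk; omega
  | succ i ih =>
    have hci : c i = 0 := by
      by_contra hne
      rw [Finset.sum_range_succ, add_comm, add_eq_zero_iff_eq_neg] at hc
      have h1 : c i • v i ∈ P i := hc ▸ neg_mem (hmem i)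
      refine h.notMem i (by omega) ?_
      have h2 : v i = ((c i : ℚ)⁻¹) • (c i • v i) := by
        rw [← Int.cast_smul_eq_zsmul ℚ, smul_smul, inv_mul_cancel₀ (by exact_mod_cast hne), one_smul]
      rw [h2]
      exact Submodule.smul_mem _ _ h1
    intro k hk
    rcases Nat.lt_succ_iff_lt_or_eq.1 hk with hk | rfl
    · refine ih (by omega) ?_ k hk
      rw [Finset.sum_range_succ, hci, zero_smul, add_zero] at hc
      exact hc
    · exact hci

/-- The lattice points in `P j` form a free abelian group of rank at most j, with at most 2^j
classes modulo 2. In the most popular class, differences from a fixed element can be halved inside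
the lattice. -/
theorem exists_halving [DecidableEq V] (h : IsGreedyFlag Λ m v P) (hΛ : Λ.FG) (j : ℕ)
    (C : Finset V) (hC : ∀ c ∈ C, c ∈ Λ ∧ c ∈ P j) :
    ∃ C' : Finset V, (∀ c ∈ C', c ∈ Λ ∧ c ∈ P j) ∧ C.card ≤ 2 ^ j * C'.card ∧
      ∀ c ∈ C', ∀ d ∈ C', ∃ c₀ ∈ C, ∃ d₀ ∈ C, c₀ - d₀ = (2 : ℕ) • (c - d) := by
  classical
  obtain ⟨hfd, hrk⟩ := h.finrank_le j
  let Q : Submodule ℤ V := Λ ⊓ (P j).restrictScalars ℤ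
  have hQ : ∀ x, x ∈ Q ↔ x ∈ Λ ∧ x ∈ P j := fun x => by simp [Q]
  have : Module.Finite ℤ Λ := Module.Finite.iff_fg.2 hΛ
  have hnoe : IsNoetherian ℤ Λ := isNoetherian_of_isNoetherianRing_of_finite ℤ Λ
  have : IsNoetherian ℤ Q := isNoetherian_of_le (inf_le_left : Q ≤ Λ)
  have : Module.Finite ℤ Q := inferInstance
  have : IsAddTorsionFree V := IsAddTorsionFree.of_module_rat V
  have : Module.IsTorsionFree ℤ Q :=
    Q.subtype_injective.moduleIsTorsionFree Q.subtype fun _ _ => rfl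
  have : Module.Free ℤ Q := inferInstance
  let b := Module.finBasis ℤ Q
  set n := Module.finrank ℤ Q with hn
  have hnj : n ≤ j := by
    have h1 : LinearIndependent ℤ (fun i => (b i : V)) :=
      b.linearIndependent.map' Q.subtype (Submodule.ker_subtype Q)
    have h2 : LinearIndependent ℚ (fun i => (b i : V)) :=
      (LinearIndependent.iff_fractionRing ℤ ℚ).1 h1
    have h3 : LinearIndependent ℚ (fun i => (⟨b i, ((hQ _).1 (b i).2).2⟩ : P j)) :=
      LinearIndependent.of_comp (P j).subtype h2
    have := h3.fintype_card_le_finrank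
    rw [Fintype.card_fin] at this
    omega
  rcases C.eq_empty_or_nonempty with rfl | hCne
  · exact ⟨∅, by simp, by simp, by simp⟩
  let f : V → (Fin n → ZMod 2) := fun x i =>
    if hx : x ∈ Q then ((b.repr ⟨x, hx⟩ i : ℤ) : ZMod 2) else 0
  obtain ⟨y, -, hy⟩ : ∃ y ∈ (Finset.univ : Finset (Fin n → ZMod 2)),
      (C.card : ℝ) / 2 ^ n ≤ ((C.filter fun x => f x = y).card : ℝ) := by
    refine Finset.exists_le_of_sum_le Finset.univ_nonempty ?_
    rw [Finset.sum_const, Finset.card_univ, Fintype.card_fun, ZMod.card, Fintype.card_fin,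
      nsmul_eq_mul]
    push_cast
    rw [mul_div_cancel₀ _ (by positivity)]
    exact_mod_cast (Finset.card_eq_sum_card_fiberwise (f := f) (s := C)
      (t := Finset.univ) (fun _ _ => Finset.mem_coe.2 (Finset.mem_univ _))).le
  set D := C.filter fun x => f x = y with hD
  have hCD : C.card ≤ 2 ^ j * D.card := by
    rw [div_le_iff₀ (by positivity)] at hy
    have : C.card ≤ D.card * 2 ^ n := by exact_mod_cast hy
    calc C.card ≤ D.card * 2 ^ n := this
      _ ≤ D.card * 2 ^ j := Nat.mul_le_mul_left _ (Nat.pow_le_pow_right (by norm_num) hnj)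
      _ = _ := mul_comm _ _
  have hDne : D.Nonempty := by
    rw [← Finset.card_pos]
    rcases Nat.eq_zero_or_pos D.card with h0 | h0
    · rw [h0, mul_zero] at hCD
      exact absurd hCne.card_pos (by omega)
    · exact h0
  obtain ⟨d, hd⟩ := hDne
  have hhalf : ∀ x ∈ D, ∃ z, z ∈ Q ∧ x - d = (2 : ℕ) • z := by
    intro x hx
    have hxQ : x ∈ Q := (hQ x).2 (hC x (Finset.mem_filter.1 hx).1)
    have hdQ : d ∈ Q := (hQ d).2 (hC d (Finset.mem_filter.1 hd).1)
    have hdvd : ∀ i, ∃ a : ℤ, b.repr ⟨x, hxQ⟩ i - b.repr ⟨d, hdQ⟩ i = 2 * a := by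
      intro i
      have h1 : f x i = f d i := by
        rw [(Finset.mem_filter.1 hx).2, (Finset.mem_filter.1 hd).2]
      simp only [f, hxQ, hdQ, dif_pos] at h1
      have h2 := (ZMod.intCast_eq_intCast_iff_dvd_sub _ _ 2).1 h1.symm
      exact h2
    choose a ha using hdvd
    let z : Q := ∑ i, a i • b i
    refine ⟨z, z.2, ?_⟩
    have : (⟨x, hxQ⟩ : Q) - ⟨d, hdQ⟩ = (2 : ℕ) • z := by
      apply b.repr.injective
      ext i
      simp only [map_sub, map_nsmul, z, Finsupp.coe_sub, Pi.sub_apply, ha, Finsupp.smul_apply]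
      rw [b.repr_sum_self]
      simp
    have := congrArg (Subtype.val) this
    simpa using this
  choose! g hgQ hg using hhalf
  refine ⟨D.image g, ?_, ?_, ?_⟩
  · intro c hc
    obtain ⟨x, hx, rfl⟩ := Finset.mem_image.1 hc
    exact (hQ _).1 (hgQ x hx)
  · rw [Finset.card_image_of_injOn]
    · exact hCD
    · intro x hx x' hx' he
      have h1 := hg x hx
      rw [he, ← hg x' hx'] at h1
      simpa using h1
  · intro c hc c' hc'
    obtain ⟨x, hx, rfl⟩ := Finset.mem_image.1 hc
    obtain ⟨x', hx', rfl⟩ := Finset.mem_image.1 hc'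
    refine ⟨x, (Finset.mem_filter.1 hx).1, x', (Finset.mem_filter.1 hx').1, ?_⟩
    rw [nsmul_sub, ← hg x hx, ← hg x' hx']
    abel

/-- A volume-free upper bound in the spirit of Minkowski's second theorem. Halve until all
differences are shorter than the last vector of the flag; by its minimality they then lie in the
previous subspace, and the rank drops. A halving in rank j + 1 costs 2^(j+1), one factor 2 for each
index up to j, matched because the exponents `e` decrease. -/
theorem card_le_prod [DecidableEq V] (h : IsGreedyFlag Λ m v P) (hΛ : Λ.FG) {ρ : ℝ} (e : ℕ → ℕ)
    (he : ∀ i < m, ρ < 2 ^ e i * ‖v i‖) (hanti : ∀ i, i + 1 < m → e (i + 1) ≤ e i) (j : ℕ)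
    (hj : j ≤ m) (k : ℕ) (hk : ∀ i, i + 1 = j → k ≤ e i) (C : Finset V)
    (hC : ∀ c ∈ C, c ∈ Λ ∧ c ∈ P j) (hCC : ∀ c ∈ C, ∀ d ∈ C, 2 ^ k * ‖c - d‖ ≤ ρ) :
    C.card ≤ ∏ i ∈ Finset.range j, 2 ^ (e i - k) := by
  induction j generalizing k C with
  | zero =>
    rw [Finset.range_zero, Finset.prod_empty, Finset.card_le_one]
    intro a ha b hb
    have h1 := (hC a ha).2
    have h2 := (hC b hb).2
    rw [h.zero, Submodule.mem_bot] at h1 h2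
    rw [h1, h2]
  | succ j ihj =>
    have hkj := hk j rfl
    obtain ⟨t, ht⟩ := Nat.exists_eq_add_of_le hkj
    clear hkj hk
    induction t generalizing k C with
    | zero =>
      rw [add_zero] at ht
      rw [Finset.prod_range_succ, ht, Nat.sub_self, pow_zero, mul_one]
      rcases C.eq_empty_or_nonempty with rfl | ⟨c₀, hc₀⟩
      · simp
      have hcard : (C.image fun c => c - c₀).card = C.card :=
        Finset.card_image_of_injective _ fun _ _ h => by simpa using h
      rw [← hcard]
      refine ihj (by omega) k ?_ _ ?_ ?_
      · rintro i rfl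
        rw [← ht]
        exact hanti i (by omega)
      · intro c hc
        obtain ⟨x, hx, rfl⟩ := Finset.mem_image.1 hc
        have hxΛ : x - c₀ ∈ Λ := sub_mem (hC x hx).1 (hC c₀ hc₀).1
        refine ⟨hxΛ, ?_⟩
        by_contra hn
        have h1 := h.min j (by omega) _ hxΛ hn
        have h2 := hCC x hx c₀ hc₀
        have h3 := he j (by omega)
        rw [ht] at h3
        have h4 : (2 : ℝ) ^ k * ‖v j‖ ≤ 2 ^ k * ‖x - c₀‖ := by gcongr
        linarith
      · intro c hc d hd
        obtain ⟨x, hx, rfl⟩ := Finset.mem_image.1 hc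
        obtain ⟨y, hy, rfl⟩ := Finset.mem_image.1 hd
        simpa using hCC x hx y hy
    | succ t iht =>
      obtain ⟨C', hC', hcard, hdiff⟩ := h.exists_halving hΛ (j + 1) C hC
      have h1 := iht (k + 1) C' hC' (fun c hc d hd => by
        obtain ⟨c₀, hc₀, d₀, hd₀, h2⟩ := hdiff c hc d hd
        have h3 := hCC c₀ hc₀ d₀ hd₀
        rw [h2, RCLike.norm_nsmul ℝ, nsmul_eq_mul] at h3
        rw [pow_succ]
        push_cast at h3
        linarith) (by omega)
      refine hcard.trans ((Nat.mul_le_mul_left _ h1).trans (le_of_eq ?_))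
      have : (2 : ℕ) ^ (j + 1) = ∏ i ∈ Finset.range (j + 1), 2 := by simp
      rw [this, ← Finset.prod_mul_distrib]
      refine Finset.prod_congr rfl fun i hi => ?_
      have hmono : ∀ s, i + s ≤ j → e (i + s) ≤ e i := by
        intro s
        induction s with
        | zero => simp
        | succ s ih =>
          intro hs
          exact (hanti (i + s) (by omega)).trans (ih (by omega))
      have hij : i ≤ j := Nat.lt_succ_iff.1 (Finset.mem_range.1 hi)
      have h5 := hmono (j - i) (by omega)
      rw [Nat.add_sub_cancel' hij] at h5
      rw [← pow_succ']
      congr 1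
      omega

/-- Take e i least with 2τ < 2^(e i)‖v i‖. If e i is positive, minimality gives 2^(e i) ≤ 4τ/‖v i‖.
-/
theorem card_le_prod_max [DecidableEq V] (h : IsGreedyFlag Λ m v P) (hΛ : Λ.FG) {τ : ℝ}
    (C : Finset V) (hC : ∀ c ∈ C, c ∈ Λ ∧ ‖c‖ ≤ τ) :
    (C.card : ℝ) ≤ ∏ i ∈ Finset.range m, max 1 (4 * τ / ‖v i‖) := by
  have hex : ∀ i, i < m → ∃ e : ℕ, 2 * τ < 2 ^ e * ‖v i‖ := by
    intro i hi
    obtain ⟨e, he⟩ := pow_unbounded_of_one_lt (2 * τ / ‖v i‖) (one_lt_two)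
    exact ⟨e, by rwa [div_lt_iff₀ (h.norm_pos hi)] at he⟩
  classical
  let e : ℕ → ℕ := fun i => if hi : i < m then Nat.find (hex i hi) else 0
  have he : ∀ i < m, 2 * τ < 2 ^ e i * ‖v i‖ := by
    intro i hi
    simp only [e, dif_pos hi]
    exact Nat.find_spec (hex i hi)
  have hmin : ∀ i < m, ∀ n, 2 * τ < 2 ^ n * ‖v i‖ → e i ≤ n := by
    intro i hi n hn
    simp only [e, dif_pos hi]
    exact Nat.find_min' _ hn
  have hanti : ∀ i, i + 1 < m → e (i + 1) ≤ e i := by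
    intro i hi
    refine hmin _ hi _ ((he i (by omega)).trans_le ?_)
    have := h.norm_le_succ hi
    gcongr
  have h1 := h.card_le_prod hΛ e he hanti m le_rfl 0 (fun _ _ => Nat.zero_le _) C
    (fun c hc => ⟨(hC c hc).1, h.top c (hC c hc).1⟩) (fun c hc d hd => by
      have := norm_sub_le c d
      linarith [(hC c hc).2, (hC d hd).2])
  have h2 : (C.card : ℝ) ≤ ∏ i ∈ Finset.range m, (2 : ℝ) ^ e i := by
    simp only [Nat.sub_zero] at h1
    exact_mod_cast h1
  refine h2.trans (Finset.prod_le_prod (fun _ _ => by positivity) fun i hi => ?_)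
  have hi := Finset.mem_range.1 hi
  rcases Nat.eq_zero_or_pos (e i) with h0 | h0
  · rw [h0, pow_zero]; exact le_max_left _ _
  · refine le_max_of_le_right ?_
    obtain ⟨n, hn⟩ := Nat.exists_eq_succ_of_ne_zero h0.ne'
    have h3 : ¬ (2 * τ < 2 ^ n * ‖v i‖) := fun hlt => by
      have := hmin i hi n hlt
      omega
    rw [hn, le_div_iff₀ (h.norm_pos hi), pow_succ]
    linarith

end IsGreedyFlag

end SuccessiveMinima

/-- Modulo combinations of T, every multiple of z reduces to an element of the finite set 2Z. Two
multiples share a remainder, so a non-zero integer multiple of φ z lies in the rational span. -/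
theorem map_mem_span_of_covering {E V : Type*} [AddCommGroup E] [DecidableEq E] [AddCommGroup V]
    [Module ℚ V] (φ : E →+ V) {Z T : Finset E} (h0 : (0 : E) ∈ Z) (hneg : -Z = Z)
    (hT : ∀ z ∈ 3 • Z, ∃ c : E → ℤ, z - ∑ t ∈ T, c t • t ∈ Z - Z) {z : E} (hz : z ∈ Z) :
    φ z ∈ Submodule.span ℚ (φ '' T) := by
  set U := Submodule.span ℚ (φ '' (T : Set E)) with hU
  have hZZ : Z - Z = 2 • Z := by rw [sub_eq_add_neg, hneg, two_nsmul]
  have hcomb : ∀ c : E → ℤ, φ (∑ t ∈ T, c t • t) ∈ U := by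
    intro c
    rw [map_sum]
    refine Submodule.sum_mem _ fun t ht => ?_
    rw [map_zsmul]
    exact zsmul_mem (Submodule.subset_span (Set.mem_image_of_mem φ ht)) _
  have hmul : ∀ n : ℕ, ∃ w ∈ 2 • Z, φ (n • z - w) ∈ U := by
    intro n
    induction n with
    | zero => exact ⟨0, Finset.zero_mem_nsmul h0, by simp⟩
    | succ n ih =>
      obtain ⟨w, hw, hwU⟩ := ih
      have h3 : w + z ∈ 3 • Z := by
        rw [show (3 : ℕ) = 2 + 1 from rfl, succ_nsmul]
        exact Finset.add_mem_add hw hz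
      obtain ⟨c, hc⟩ := hT _ h3
      refine ⟨_, hZZ ▸ hc, ?_⟩
      have : (n + 1) • z - (w + z - ∑ t ∈ T, c t • t) = (n • z - w) + ∑ t ∈ T, c t • t := by
        rw [succ_nsmul]; abel
      rw [this, map_add]
      exact Submodule.add_mem _ hwU (hcomb c)
  choose w hw hwU using hmul
  obtain ⟨a, -, b, -, hab, hwab⟩ := Set.infinite_univ.exists_ne_map_eq_of_mapsTo
    (f := w) (t := ((2 • Z : Finset E) : Set E)) (fun n _ => hw n) (Finset.finite_toSet _)
  have h1 : φ (((a : ℤ) - b) • z) ∈ U := by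
    have := Submodule.sub_mem _ (hwU a) (hwU b)
    rw [← map_sub, hwab, sub_sub_sub_cancel_right] at this
    rwa [sub_smul, natCast_zsmul, natCast_zsmul]
  have hne : (a : ℤ) - b ≠ 0 := by omega
  rw [map_zsmul] at h1
  have h2 : φ z = (((a : ℤ) - b : ℤ) : ℚ)⁻¹ • (((a : ℤ) - b) • φ z) := by
    rw [← Int.cast_smul_eq_zsmul ℚ, smul_smul, inv_mul_cancel₀ (by exact_mod_cast hne), one_smul]
  rw [h2]
  exact Submodule.smul_mem _ _ h1

/-! ### Lifting to phases and constructing the progression. -/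

section PhaseLift

variable {G : Type u} [AddCommGroup G] [DecidableEq G] [Fintype G]

/-- The pairs of a group element and a choice of phases for the values of the characters in `Δ`
there. -/
def phaseLift (Δ : Finset (AddChar G ℂ)) : AddSubgroup (G × (Δ → ℝ)) where
  carrier := {p | ∀ γ : Δ, γ.1 p.1 = Complex.exp (2 * Real.pi * Complex.I * p.2 γ)}
  zero_mem' := by intro γ; simp
  add_mem' := by
    intro p q hp hq γ
    simp only [Prod.fst_add, Prod.snd_add, Pi.add_apply]
    rw [AddChar.map_add_eq_mul, hp γ, hq γ, ← Complex.exp_add]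
    congr 1; push_cast; ring
  neg_mem' := by
    intro p hp γ
    simp only [Prod.fst_neg, Prod.snd_neg, Pi.neg_apply]
    rw [AddChar.map_neg_eq_inv, hp γ, ← Complex.exp_neg]
    congr 1; push_cast; ring

/-- Two phase vectors over the same element differ by integers, and here by less than 1 in each
coordinate. -/
theorem eq_of_mem_phaseLift {Δ : Finset (AddChar G ℂ)} {p q : G × (Δ → ℝ)}
    (hp : p ∈ phaseLift Δ) (hq : q ∈ phaseLift Δ) (hpn : ‖p.2‖ < 1 / 2) (hqn : ‖q.2‖ < 1 / 2)
    (h : p.1 = q.1) : p = q := by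
  refine Prod.ext h (funext fun γ => ?_)
  have h1 := hp γ
  rw [h, hq γ, Complex.exp_eq_exp_iff_exists_int] at h1
  obtain ⟨n, hn⟩ := h1
  have h2 : (q.2 γ : ℂ) = p.2 γ + n := by
    refine mul_left_cancel₀ Complex.two_pi_I_ne_zero ?_
    rw [hn]; ring
  have h3 : q.2 γ = p.2 γ + n := by exact_mod_cast h2
  have h4 := (norm_le_pi_norm p.2 γ).trans_lt hpn
  have h5 := (norm_le_pi_norm q.2 γ).trans_lt hqn
  rw [Real.norm_eq_abs, abs_lt] at h4 h5
  have h6 : (n : ℝ) < 1 := by linarith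
  have h7 : (-1 : ℝ) < n := by linarith
  have h8 : n < 1 := by exact_mod_cast h6
  have h9 : -1 < n := by exact_mod_cast h7
  have : n = 0 := by omega
  rw [h3, this]; simp

theorem norm_one_sub_le_of_mem_phaseLift {Δ : Finset (AddChar G ℂ)} {p : G × (Δ → ℝ)}
    (hp : p ∈ phaseLift Δ) {γ : AddChar G ℂ} (hγ : γ ∈ Δ) :
    ‖1 - γ p.1‖ ≤ 2 * Real.pi * ‖p.2‖ := by
  have h1 := hp ⟨γ, hγ⟩
  have h2 := norm_le_pi_norm p.2 ⟨γ, hγ⟩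
  simp only at h1
  have e : (2 * Real.pi * Complex.I * p.2 ⟨γ, hγ⟩ : ℂ)
      = Complex.I * ((2 * Real.pi * p.2 ⟨γ, hγ⟩ : ℝ) : ℂ) := by push_cast; ring
  rw [h1, norm_sub_rev, e]
  refine (Real.norm_exp_I_mul_ofReal_sub_one_le).trans ?_
  rw [norm_mul, Real.norm_of_nonneg (by positivity : 0 ≤ 2 * Real.pi)]
  gcongr

/-- Multiplication by |G| kills the group component, so every phase lies in the discrete grid
|G|⁻¹ℤ. This makes the phases a lattice. -/
theorem exists_int_of_mem_phaseLift {Δ : Finset (AddChar G ℂ)} {p : G × (Δ → ℝ)}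
    (hp : p ∈ phaseLift Δ) (γ : Δ) : ∃ n : ℤ, (Fintype.card G : ℝ) * p.2 γ = n := by
  have h1 : (Fintype.card G • p) ∈ phaseLift Δ := nsmul_mem hp _
  have h2 := h1 γ
  simp only [Prod.smul_fst, Prod.smul_snd, card_nsmul_eq_zero, AddChar.map_zero_eq_one] at h2
  obtain ⟨n, hn⟩ := Complex.exp_eq_one_iff.1 h2.symm
  refine ⟨n, ?_⟩
  have h3 : ((Fintype.card G • p.2) γ : ℂ) = n := by
    refine mul_left_cancel₀ Complex.two_pi_I_ne_zero ?_
    rw [hn]; ring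
  have h4 : (Fintype.card G • p.2) γ = n := by exact_mod_cast h3
  rw [← h4, Pi.smul_apply, nsmul_eq_mul]

theorem finite_phases (Δ : Finset (AddChar G ℂ)) (R : ℝ) :
    {v : Δ → ℝ | (∃ x, (x, v) ∈ phaseLift Δ) ∧ ‖v‖ ≤ R}.Finite := by
  have hn : (0 : ℝ) < Fintype.card G := by exact_mod_cast Fintype.card_pos
  set n := Fintype.card G with hnn
  let B : ℤ := ⌈n * R⌉
  have hfin : ((Set.univ.pi fun _ : Δ => Set.Icc (-B) B)).Finite :=
    Set.Finite.pi fun _ => Set.finite_Icc _ _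
  refine (hfin.image fun (k : Δ → ℤ) (γ : Δ) => (k γ : ℝ) / n).subset ?_
  rintro v ⟨⟨x, hx⟩, hv⟩
  choose k hk using exists_int_of_mem_phaseLift hx
  refine ⟨k, fun γ _ => ?_, funext fun γ => ?_⟩
  · have h1 := (norm_le_pi_norm v γ).trans hv
    rw [Real.norm_eq_abs, abs_le] at h1
    have h2 := hk γ
    simp only at h2
    have h3 : (n : ℝ) * R ≤ B := Int.le_ceil _
    have h4 : (n : ℝ) * v γ ≤ n * R := by gcongr; exact h1.2
    have h5 : -((n : ℝ) * R) ≤ n * v γ := by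
      rw [← mul_neg]; gcongr; exact h1.1
    rw [Set.mem_Icc]
    constructor
    · have : (-(B : ℝ)) ≤ k γ := by linarith
      exact_mod_cast this
    · have : (k γ : ℝ) ≤ B := by linarith
      exact_mod_cast this
  · have h2 := hk γ
    simp only at h2 ⊢
    rw [← h2, ← hnn, mul_div_cancel_left₀ _ hn.ne']

/-- The principal phases of the characters in `Δ` at `x`. -/
noncomputable def principalPhase (Δ : Finset (AddChar G ℂ)) (x : G) : Δ → ℝ :=
  fun γ => (γ.1 x).arg / (2 * Real.pi)

theorem principalPhase_mem (Δ : Finset (AddChar G ℂ)) (x : G) :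
    (x, principalPhase Δ x) ∈ phaseLift Δ := by
  intro γ
  have := Complex.norm_mul_exp_arg_mul_I (γ.1 x)
  rw [AddChar.norm_apply, Complex.ofReal_one, one_mul] at this
  conv_lhs => rw [← this]
  congr 1
  simp only [principalPhase]
  have hpi : (Real.pi : ℂ) ≠ 0 := by exact_mod_cast Real.pi_ne_zero
  push_cast
  field_simp

theorem norm_principalPhase_le {Δ : Finset (AddChar G ℂ)} {x : G} {τ : ℝ} (hτ : 0 ≤ τ)
    (h : ∀ γ ∈ Δ, ‖1 - γ x‖ ≤ τ) : ‖principalPhase Δ x‖ ≤ τ / 4 := by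
  rw [pi_norm_le_iff_of_nonneg (by positivity)]
  intro γ
  have hpi := Real.pi_pos
  have hne : γ.1 x ≠ 0 := by
    rw [← norm_ne_zero_iff, AddChar.norm_apply]; exact one_ne_zero
  have h1 := Complex.angle_le_mul_norm_sub (x := 1) (y := γ.1 x) (by simp)
    (AddChar.norm_apply _ _)
  rw [Complex.angle_one_left hne] at h1
  have h2 : Real.pi / 2 * ‖1 - γ.1 x‖ ≤ Real.pi / 2 * τ := by gcongr; exact h _ γ.2
  rw [principalPhase, norm_div, Real.norm_eq_abs, Real.norm_of_nonneg (by positivity),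
    div_le_iff₀ (by positivity)]
  linarith

theorem mem_nsmul_lift {Δ : Finset (AddChar G ℂ)} [DecidableEq (G × (Δ → ℝ))] {Z : Finset G} {τ : ℝ}
    {Z' : Finset (G × (Δ → ℝ))} (hZ' : ∀ p ∈ Z', p ∈ phaseLift Δ ∧ p.1 ∈ Z ∧ ‖p.2‖ ≤ τ) (n : ℕ) :
    ∀ p ∈ n • Z', p ∈ phaseLift Δ ∧ p.1 ∈ n • Z ∧ ‖p.2‖ ≤ n * τ := by
  induction n with
  | zero =>
    intro p hp
    rw [zero_nsmul, Finset.mem_zero] at hp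
    rw [hp]
    exact ⟨zero_mem _, by simp, by simp⟩
  | succ n ih =>
    intro p hp
    rw [succ_nsmul] at hp
    obtain ⟨a, ha, b, hb, rfl⟩ := Finset.mem_add.1 hp
    obtain ⟨a1, a2, a3⟩ := ih a ha
    obtain ⟨b1, b2, b3⟩ := hZ' b hb
    refine ⟨add_mem a1 b1, ?_, ?_⟩
    · rw [succ_nsmul]; exact Finset.add_mem_add a2 b2
    · refine (norm_add_le _ _).trans ?_
      push_cast; linarith

/-- A set of small doubling on which the characters in `Δ` are close to `1` can be replaced by a
proper coset progression on which they are closer to `1`. -/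
theorem exists_cosetProgression_of_annihilating (Δ : Finset (AddChar G ℂ)) {Z : Finset G}
    (h0 : (0 : G) ∈ Z) (hneg : -Z = Z) {τ : ℝ} (hτ0 : 0 ≤ τ)
    (hZ : ∀ γ ∈ Δ, ∀ z ∈ Z, ‖1 - γ z‖ ≤ τ) {d : ℕ}
    (hd : ((3 * d + 1) • Z).card < 2 ^ d * Z.card) (hτ : (3 * d + 1) * τ < 2) {δ : ℝ}
    (hδ0 : 0 < δ) (hδ : δ < 1 / 2) :
    ∃ m < d, ∃ M : CosetProgression G m, M.Proper ∧
      (Z.card : ℝ) ≤ (4 * d / δ) ^ m * M.carrier.ncard ∧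
      ∀ y ∈ M.carrier, ∀ γ ∈ Δ, ‖1 - γ y‖ ≤ 2 * Real.pi * δ := by
  classical
  set V := Δ → ℝ with hV
  let lift : G → G × V := fun x => (x, principalPhase Δ x)
  have hliftinj : Function.Injective lift := fun x y h => congrArg Prod.fst h
  set Z' : Finset (G × V) := Z.image lift with hZ'def
  have hZ' : ∀ p ∈ Z', p ∈ phaseLift Δ ∧ p.1 ∈ Z ∧ ‖p.2‖ ≤ τ / 4 := by
    intro p hp
    obtain ⟨x, hx, rfl⟩ := Finset.mem_image.1 hp
    exact ⟨principalPhase_mem Δ x, hx, norm_principalPhase_le hτ0 fun γ hγ => hZ γ hγ x hx⟩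
  have hτ4 : τ / 4 < 1 / 2 := by
    have : 0 ≤ 3 * (d : ℝ) * τ := by positivity
    linarith
  have hlift_eq : ∀ p ∈ phaseLift Δ, p.1 ∈ Z → ‖p.2‖ < 1 / 2 → p ∈ Z' := by
    intro p hp hp1 hp2
    have h1 := hZ' (lift p.1) (Finset.mem_image_of_mem _ hp1)
    rw [eq_of_mem_phaseLift hp h1.1 hp2 (h1.2.2.trans_lt hτ4) rfl]
    exact Finset.mem_image_of_mem _ hp1
  have h0' : (0 : G × V) ∈ Z' := hlift_eq 0 (zero_mem _) h0 (by simp)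
  have hneg' : -Z' = Z' := by
    have hsub : ∀ p ∈ Z', -p ∈ Z' := by
      intro p hp
      obtain ⟨a, b, c⟩ := hZ' p hp
      refine hlift_eq _ (neg_mem a) ?_ ?_
      · rw [← hneg]; exact Finset.neg_mem_neg b
      · rw [Prod.snd_neg, norm_neg]; exact c.trans_lt hτ4
    ext p
    rw [Finset.mem_neg']
    exact ⟨fun h => by simpa using hsub _ h, hsub p⟩
  have hcardZ' : Z'.card = Z.card := Finset.card_image_of_injective _ hliftinj
  -- All phases in (3d + 1)Z' stay below 1/2, so projection to G is injective there and the growth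
  -- hypothesis passes to the lift.
  have hd' : ((3 * d + 1) • Z').card < 2 ^ d * Z'.card := by
    rw [hcardZ']
    refine lt_of_le_of_lt ?_ hd
    have hmem := mem_nsmul_lift hZ' (3 * d + 1)
    have hsmall : ((3 * d + 1 : ℕ) : ℝ) * (τ / 4) < 1 / 2 := by push_cast; linarith
    refine Finset.card_le_card_of_injOn Prod.fst (fun p hp => (hmem p hp).2.1) ?_
    intro p hp q hq h
    exact eq_of_mem_phaseLift (hmem p hp).1 (hmem q hq).1 ((hmem p hp).2.2.trans_lt hsmall)
      ((hmem q hq).2.2.trans_lt hsmall) h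
  obtain ⟨T, -, hTd, hT⟩ := exists_small_spanning_set h0' hd'
  let E : Submodule ℤ (G × V) := Submodule.span ℤ (Z' : Set (G × V))
  have hEL : ∀ p ∈ E, p ∈ phaseLift Δ := by
    intro p hp
    have : E ≤ (phaseLift Δ).toIntSubmodule := by
      rw [Submodule.span_le]
      intro p hp
      exact (hZ' p hp).1
    exact this hp
  let Λ : Submodule ℤ V := E.map (LinearMap.snd ℤ G V)
  have hΛ : ∀ v, v ∈ Λ ↔ ∃ x, (x, v) ∈ E := by
    intro v
    simp [Λ]
  have hΛfg : Λ.FG := (Submodule.fg_span (Finset.finite_toSet Z')).map _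
  have hΛfin : ∀ R : ℝ, {x | x ∈ Λ ∧ ‖x‖ ≤ R}.Finite := fun R =>
    (finite_phases Δ R).subset fun v hv => by
      obtain ⟨x, hx⟩ := (hΛ v).1 hv.1
      exact ⟨⟨x, hEL _ hx⟩, hv.2⟩
  have hspan : ∀ v ∈ Λ, v ∈ Submodule.span ℚ ((T.image Prod.snd : Finset V) : Set V) := by
    have hle : E ≤ ((Submodule.span ℚ ((T.image Prod.snd : Finset V) : Set V)).restrictScalars
        ℤ).comap (LinearMap.snd ℤ G V) := by
      rw [Submodule.span_le]
      intro p hp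
      have := map_mem_span_of_covering (AddMonoidHom.snd G V) h0' hneg'
        (fun z hz => (hT z hz).imp fun c hc => hc.2) hp
      rw [Finset.coe_image]
      exact this
    intro v hv
    obtain ⟨x, hx⟩ := (hΛ v).1 hv
    exact hle hx
  obtain ⟨m, hm, v, P, hflag⟩ := exists_isGreedyFlag Λ hΛfin (T.image Prod.snd) hspan
  have hmd : m < d := (hm.trans Finset.card_image_le).trans_lt hTd
  have hx : ∀ i, ∃ x, i < m → (x, v i) ∈ E := by
    intro i
    by_cases hi : i < m
    · obtain ⟨x, hx⟩ := (hΛ _).1 (hflag.mem i hi)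
      exact ⟨x, fun _ => hx⟩
    · exact ⟨0, fun h => absurd h hi⟩
  choose x hx using hx
  let H : AddSubgroup G := (E.comap (LinearMap.inl ℤ G V)).toAddSubgroup
  have hH : ∀ y, y ∈ H ↔ (y, (0 : V)) ∈ E := fun y => Iff.rfl
  -- Each of the m terms contributes at most δ/m, so phases on the progression stay at most δ < 1/2.
  -- Hence the group element determines the phase, whence properness. The base point in `M` centres
  -- the box, so that coefficients run over [-N i, N i].
  let N : ℕ → ℕ := fun i => ⌊δ / (m * ‖v i‖)⌋₊
  let M : CosetProgression G m :=
    { subgroup := H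
      base := -∑ i : Fin m, N i • x i
      gen := fun i => x i
      len := fun i => 2 * N i + 1
      len_pos := fun i => Nat.succ_pos _ }
  let w : M.subgroup × ((i : Fin m) → Fin (M.len i)) → V :=
    fun p => ∑ i : Fin m, ((p.2 i : ℤ) - N i) • v i
  have hmem : ∀ p, (M.param p, w p) ∈ E := by
    intro p
    have e : (M.param p, w p) = ((p.1 : G), (0 : V)) +
        ∑ i : Fin m, ((p.2 i : ℤ) - N i) • ((x i, v i) : G × V) := by
      refine Prod.ext ?_ ?_
      · simp only [CosetProgression.param, M, Prod.fst_add, Prod.fst_sum, Prod.smul_fst]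
        simp only [sub_smul, natCast_zsmul, Finset.sum_sub_distrib]
        abel
      · simp [w, Prod.snd_sum]
    rw [e]
    exact add_mem ((hH _).1 p.1.2) (Submodule.sum_mem _ fun i _ =>
      Submodule.smul_mem _ _ (hx i i.2))
  have hwn : ∀ p, ‖w p‖ ≤ δ := by
    intro p
    refine (norm_sum_le _ _).trans ?_
    have hterm : ∀ i : Fin m, ‖((p.2 i : ℤ) - N i) • v i‖ ≤ δ / m := by
      intro i
      have hm0 : (0 : ℝ) < m := by exact_mod_cast i.pos
      have hv0 := hflag.norm_pos i.2
      rw [← Int.cast_smul_eq_zsmul ℝ, norm_smul, Real.norm_eq_abs]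
      have h1 : |(((p.2 i : ℤ) - N i : ℤ) : ℝ)| ≤ N i := by
        have h2 : (p.2 i : ℕ) < 2 * N i + 1 := (p.2 i).2
        have h3 : |((p.2 i : ℤ) - N i)| ≤ N i := by rw [abs_le]; omega
        exact_mod_cast h3
      have h4 : (N i : ℝ) ≤ δ / (m * ‖v i‖) := Nat.floor_le (by positivity)
      calc _ ≤ δ / (m * ‖v i‖) * ‖v i‖ := by gcongr; exact h1.trans h4
        _ = δ / m := by field_simp
    refine (Finset.sum_le_sum fun i _ => hterm i).trans ?_
    rw [Finset.sum_const, Finset.card_univ, Fintype.card_fin, nsmul_eq_mul]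
    rcases Nat.eq_zero_or_pos m with h | h
    · simp [h, hδ0.le]
    · have : (m : ℝ) ≠ 0 := by exact_mod_cast h.ne'
      exact (mul_div_cancel₀ _ this).le
  have hproper : M.Proper := by
    intro p q hpq
    have h1 := eq_of_mem_phaseLift (hEL _ (hmem p)) (hEL _ (hmem q)) ((hwn p).trans_lt hδ)
      ((hwn q).trans_lt hδ) hpq
    have h2 : w p = w q := congrArg Prod.snd h1
    let c : ℕ → ℤ := fun k => if hk : k < m then (p.2 ⟨k, hk⟩ : ℤ) - q.2 ⟨k, hk⟩ else 0
    have h3 : ∑ k ∈ Finset.range m, c k • v k = 0 := by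
      rw [Finset.sum_range]
      rw [← sub_eq_zero, ← Finset.sum_sub_distrib] at h2
      rw [← h2]
      refine Finset.sum_congr rfl fun i _ => ?_
      simp only [c, i.2, dif_pos, Fin.eta]
      rw [← sub_smul]
      congr 1
      ring
    have h4 : p.2 = q.2 := by
      funext i
      have := hflag.coeff_eq_zero c le_rfl h3 i i.2
      simp only [c, i.2, dif_pos, Fin.eta] at this
      exact Fin.ext (by omega)
    have h5 : p.1 = q.1 := by
      have h6 : M.param p = M.param q := hpq
      rw [CosetProgression.param, CosetProgression.param, h4] at h6
      exact Subtype.ext (add_right_cancel h6)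
    exact Prod.ext h5 h4
  have hcardM : M.carrier.ncard = Nat.card H * ∏ i : Fin m, (2 * N i + 1) := by
    rw [CosetProgression.carrier, ← Set.image_univ, Set.ncard_image_of_injective _ hproper,
      Set.ncard_univ, Nat.card_prod, Nat.card_pi]
    simp [M]
  have hd0 : 0 < d := by omega
  refine ⟨m, hmd, M, hproper, ?_, ?_⟩
  -- Elements of `Z'` with equal phase differ by an element of H, and the distinct phases are
  -- counted by the flag.
  · have hfib : Z'.card ≤ Nat.card H * (Z'.image Prod.snd).card := by
      refine Finset.card_le_mul_card_image _ _ fun v _ => ?_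
      rcases (Z'.filter fun p => p.2 = v).eq_empty_or_nonempty with he | ⟨q, hq⟩
      · rw [he]; simp
      have hE : ∀ p ∈ Z'.filter (fun p => p.2 = v), p.1 - q.1 ∈ H := by
        intro p hp
        rw [Finset.mem_filter] at hp hq
        rw [hH]
        have : (p.1 - q.1, (0 : V)) = p - q := by
          refine Prod.ext rfl ?_
          rw [Prod.snd_sub, hp.2, hq.2, sub_self]
        rw [this]
        exact sub_mem (Submodule.subset_span hp.1) (Submodule.subset_span hq.1)
      rw [← Nat.card_eq_finsetCard]
      refine Nat.card_le_card_of_injective (fun p => (⟨p.1.1 - q.1, hE p.1 p.2⟩ : H)) ?_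
      intro p p' h
      have h1 : p.1.1 - q.1 = p'.1.1 - q.1 := congrArg Subtype.val h
      refine Subtype.ext (Prod.ext (by simpa using h1) ?_)
      rw [(Finset.mem_filter.1 p.2).2, (Finset.mem_filter.1 p'.2).2]
    have hcount := hflag.card_le_prod_max hΛfg (τ := τ / 4) (Z'.image Prod.snd) (by
      intro c hc
      obtain ⟨p, hp, rfl⟩ := Finset.mem_image.1 hc
      exact ⟨(hΛ _).2 ⟨p.1, Submodule.subset_span hp⟩, (hZ' p hp).2.2⟩)
    have hdr : (1 : ℝ) ≤ d := by exact_mod_cast hd0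
    have hfac : ∀ i ∈ Finset.range m, max 1 (4 * (τ / 4) / ‖v i‖)
        ≤ (4 * d / δ) * ((2 * N i + 1 : ℕ) : ℝ) := by
      intro i hi
      have hi := Finset.mem_range.1 hi
      have hv0 := hflag.norm_pos hi
      have hm0 : (0 : ℝ) < m := by exact_mod_cast (by omega : 0 < m)
      have hmdr : (m : ℝ) ≤ d := by exact_mod_cast hmd.le
      have hB : 1 ≤ 4 * d / δ := by rw [one_le_div hδ0]; linarith
      have hN1 : (1 : ℝ) ≤ ((2 * N i + 1 : ℕ) : ℝ) := by exact_mod_cast Nat.succ_pos _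
      have hN2 : δ / (m * ‖v i‖) ≤ ((2 * N i + 1 : ℕ) : ℝ) := by
        have := (Nat.lt_floor_add_one (δ / (m * ‖v i‖))).le
        refine this.trans ?_
        show ((N i : ℕ) : ℝ) + 1 ≤ _
        push_cast
        have : (0 : ℝ) ≤ N i := by positivity
        linarith
      refine max_le (one_le_mul_of_one_le_of_one_le hB hN1) ?_
      have hτ4 : τ ≤ 4 := by linarith
      calc 4 * (τ / 4) / ‖v i‖ ≤ 4 * d / m / ‖v i‖ := by
            rw [mul_div_cancel₀ _ (by norm_num)]
            gcongr
            rw [le_div_iff₀ hm0]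
            nlinarith
        _ = (4 * d / δ) * (δ / (m * ‖v i‖)) := by field_simp
        _ ≤ _ := by gcongr
    have hprod := Finset.prod_le_prod (fun _ _ => by positivity) hfac
    rw [Finset.prod_mul_distrib, Finset.prod_const, Finset.card_range,
      Finset.prod_range fun i => ((2 * N i + 1 : ℕ) : ℝ)] at hprod
    rw [← hcardZ', hcardM]
    have hfib' : (Z'.card : ℝ) ≤ Nat.card H * (Z'.image Prod.snd).card := by exact_mod_cast hfib
    refine hfib'.trans ?_
    rw [Nat.cast_mul, Nat.cast_prod]
    calc _ ≤ (Nat.card H : ℝ) * ((4 * d / δ) ^ m * ∏ i : Fin m, ((2 * N i + 1 : ℕ) : ℝ)) := by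
          gcongr
          exact hcount.trans hprod
      _ = _ := by ring
  · rintro y ⟨p, rfl⟩ γ hγ
    refine (norm_one_sub_le_of_mem_phaseLift (hEL _ (hmem p)) hγ).trans ?_
    have := hwn p
    gcongr

end PhaseLift

/-! ### Progressions from sets of polynomial growth. -/

section PolynomialGrowth

variable {G : Type u} [AddCommGroup G] [DecidableEq G] [Fintype G]

set_option maxHeartbeats 1000000 in
/-- A symmetric set of polynomial growth controls a proper coset progression that annihilates its
large spectrum. -/
theorem exists_cosetProgression_of_polynomial_growth {X : Finset G} (h0 : (0 : G) ∈ X)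
    (hneg : -X = X) {D ℓ : ℕ} (hD : 0 < D) (hDℓ : D ≤ 2 ^ ℓ) (hℓ : 10 ≤ ℓ)
    (hpoly : ∀ n, 2 ≤ n → (n • X).card ≤ (2 * n + 1) ^ D * 4 ^ D * X.card)
    {δ : ℝ} (hδ0 : 0 < δ) (hδ : δ < 1 / 2) :
    ∃ m < 100000 * (D * ℓ ^ 2), ∃ M : CosetProgression G m, M.Proper ∧
      (X.card : ℝ) ≤ 2 ^ (20000 * (D * ℓ ^ 2)) *
        (4 * (100000 * (D * ℓ ^ 2) : ℕ) / δ) ^ m * M.carrier.ncard ∧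
      ∀ y ∈ M.carrier, ∀ γ : AddChar G ℂ, 1 / 2 ≤ ‖charMean X γ‖ →
        ‖1 - γ y‖ ≤ 2 * Real.pi * δ := by
  classical
  set F := D * ℓ ^ 2 with hF
  set e := 100000 * F with he
  set Y := 2 ^ (3 * ℓ) with hY
  have hP : 1024 ≤ 2 ^ ℓ := by
    calc 1024 = 2 ^ 10 := by norm_num
      _ ≤ 2 ^ ℓ := Nat.pow_le_pow_right (by norm_num) hℓ
  have hYP : Y = 2 ^ ℓ * 2 ^ ℓ * 2 ^ ℓ := by rw [hY]; ring
  have hY30 : 2 ^ 30 ≤ Y := Nat.pow_le_pow_right (by norm_num) (by omega)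
  have hℓP : ℓ ≤ 2 ^ ℓ := Nat.lt_two_pow_self.le
  have hFY : F ≤ Y := by
    rw [hF, hYP, sq, ← mul_assoc]
    exact Nat.mul_le_mul (Nat.mul_le_mul hDℓ hℓP) hℓP
  have hDℓY : D * ℓ ≤ Y := by
    refine le_trans ?_ hFY
    rw [hF]
    exact Nat.mul_le_mul_left _ (by nlinarith)
  have hF1 : 0 < F := by positivity
  have hDF : D ≤ F := Nat.le_mul_of_pos_right _ (by positivity)
  have hDℓF : D * ℓ ≤ F := Nat.mul_le_mul_left _ (by nlinarith)
  have hDDℓ : D ≤ D * ℓ := Nat.le_mul_of_pos_right _ (by omega)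
  have he1 : 0 < e := by positivity
  -- Up to scale Y^5 the set X grows by at most 2^(15Dℓ + 2D), so with this r the factor
  -- exp(23r/400) exceeds that growth.
  set r := 1000 * (D * ℓ) with hr
  -- I = 800e · 5e, so (1 + 1/(800e))^I ≥ 2^(5e), which beats q^r = 2^(20000F) together with the
  -- growth of X up to scale Y^4.
  set I := 4000 * e ^ 2 with hI
  have heY : e ≤ 100000 * Y := Nat.mul_le_mul_left _ hFY
  have he2 : e ^ 2 ≤ 10000000000 * Y ^ 2 := by
    calc e ^ 2 ≤ (100000 * Y) ^ 2 := Nat.pow_le_pow_left heY 2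
      _ = _ := by ring
  have hYY : 2 ^ 60 ≤ Y ^ 2 := by
    calc 2 ^ 60 = (2 ^ 30) ^ 2 := by norm_num
      _ ≤ _ := Nat.pow_le_pow_left hY30 2
  -- All scales in use are bounded by small powers of Y = 2^(3ℓ), so polynomial growth of degree D
  -- costs only O(Dℓ) in the exponent of 2.
  have hgr : ∀ n c, 2 ≤ n → 2 * n + 1 ≤ Y ^ c →
      (n • X).card ≤ 2 ^ (3 * c * (D * ℓ) + 2 * D) * X.card := by
    intro n c hn hc
    refine (hpoly n hn).trans (Nat.mul_le_mul_right _ ?_)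
    calc (2 * n + 1) ^ D * 4 ^ D ≤ (Y ^ c) ^ D * 4 ^ D :=
          Nat.mul_le_mul_right _ (Nat.pow_le_pow_left hc D)
      _ = 2 ^ (3 * c * (D * ℓ) + 2 * D) := by
          rw [hY, pow_add, pow_mul 2 2 D, ← pow_mul, ← pow_mul]
          norm_num
          ring
  have b1 : 2 * (2 * (3 * e + 1)) + 1 ≤ Y ^ 2 := by nlinarith
  have b2 : 2 * (2 + 2 * I) + 1 ≤ Y ^ 4 := by
    have : Y ^ 4 = Y ^ 2 * Y ^ 2 := by ring
    rw [this, hI]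
    nlinarith
  have b3 : 2 * (r * (2 + 2 * I) + 1) + 1 ≤ Y ^ 5 := by
    have h1 : r ≤ 1000 * Y := Nat.mul_le_mul_left _ hDℓY
    have h2 : 2 + 2 * I ≤ 80000000000001 * Y ^ 2 := by
      rw [hI]
      omega
    have h3 : r * (2 + 2 * I) ≤ 1000 * Y * (80000000000001 * Y ^ 2) := Nat.mul_le_mul h1 h2
    have h4 : Y ^ 5 = Y ^ 2 * Y ^ 3 := by ring
    have h5 : 1000 * Y * (80000000000001 * Y ^ 2) = 80000000000001000 * Y ^ 3 := by ring
    have h6 : 1 ≤ Y ^ 3 := Nat.one_le_pow _ _ (by omega)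
    have h7 : 2 ^ 60 * Y ^ 3 ≤ Y ^ 2 * Y ^ 3 := Nat.mul_le_mul_right _ hYY
    rw [h4]
    omega
  set q := 2 ^ (20 * ℓ) with hq
  have hq0 : 0 < q := by positivity
  have hqr0 : (0 : ℝ) < q := by exact_mod_cast hq0
  have hqr : (q : ℝ) ^ r = 2 ^ (20000 * F) := by
    rw [hq, hr, hF]
    push_cast
    rw [← pow_mul]
    congr 1
    ring
  have her : (1 : ℝ) ≤ e := by exact_mod_cast he1
  -- This η yields closeness 200η = 1/(4e) on Z, small enough for phases to stay unambiguous up to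
  -- (3e + 1)Z. The cell count q = 2^(20ℓ) exceeds Y^5 = 2^(15ℓ) by enough for κ = 4/q to satisfy
  -- the smallness condition.
  obtain ⟨Z, hZ2, hZ0, hZneg, hXZ, hZΔ⟩ := exists_subset_annihilating_spectrum h0 hneg
    (r := r) (q := q) (I := I) hq0 (κ := 4 / q) (η := 1 / (800 * e)) (by positivity)
    (by gcongr; exact Real.pi_le_four)
    (by
      have h1 : r * (2 + 2 * I) ≤ Y ^ 5 := by omega
      have h2 : 400 * Y ^ 5 ≤ q := by
        have : q = Y ^ 5 * 2 ^ (5 * ℓ) := by rw [hq, hY, ← pow_mul, ← pow_add]; congr 1; ring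
        rw [this, mul_comm 400]
        refine Nat.mul_le_mul_left _ ?_
        calc 400 ≤ 2 ^ ℓ := by omega
          _ ≤ 2 ^ (5 * ℓ) := Nat.pow_le_pow_right (by norm_num) (by omega)
      have h3 : 400 * (r * (2 + 2 * I)) ≤ q := by omega
      have h4 : 400 * ((r : ℝ) * (2 + 2 * I : ℕ)) ≤ q := by exact_mod_cast h3
      rw [← mul_assoc, mul_div_assoc', div_le_iff₀ hqr0]
      linarith)
    (by
      have h1 : (((2 + 2 * I) • X).card : ℝ) ≤ 2 ^ (3 * 4 * (D * ℓ) + 2 * D) * X.card := by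
        exact_mod_cast hgr _ 4 (by omega) b2
      have hXc : (0 : ℝ) < X.card := by exact_mod_cast Finset.card_pos.2 ⟨0, h0⟩
      have h2 : (2 : ℝ) ≤ (1 + 1 / (800 * e)) ^ (800 * e) := by
        have := one_add_mul_le_pow (a := (1 / (800 * e) : ℝ))
          (by have : (0 : ℝ) ≤ 1 / (800 * e) := by positivity
              linarith) (800 * e)
        refine le_trans (le_of_eq ?_) this
        push_cast
        field_simp
        norm_num
      have h3 : (2 : ℝ) ^ (5 * e) ≤ (1 + 1 / (800 * e)) ^ I := by
        have : I = 800 * e * (5 * e) := by rw [hI]; ring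
        rw [this, pow_mul _ (800 * e) (5 * e)]
        exact pow_le_pow_left₀ (by norm_num) h2 _
      rw [hqr]
      calc (((2 + 2 * I) • X).card : ℝ) * 2 ^ (20000 * F)
          ≤ 2 ^ (3 * 4 * (D * ℓ) + 2 * D) * X.card * 2 ^ (20000 * F) := by gcongr
        _ = 2 ^ (3 * 4 * (D * ℓ) + 2 * D + 20000 * F) * X.card := by rw [pow_add]; ring
        _ < 2 ^ (5 * e) * X.card := by
            gcongr
            · norm_num
            · omega
        _ ≤ _ := by gcongr)
    (by
      have h1 : (((r * (2 + 2 * I) + 1) • X).card : ℝ)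
          ≤ 2 ^ (3 * 5 * (D * ℓ) + 2 * D) * X.card := by
        have hr1 : 1 ≤ r := by omega
        have h2 : 1 * 2 ≤ r * (2 + 2 * I) := Nat.mul_le_mul hr1 (by omega)
        have : 2 ≤ r * (2 + 2 * I) + 1 := by omega
        exact_mod_cast hgr _ 5 this b3
      have hXc : (0 : ℝ) < X.card := by exact_mod_cast Finset.card_pos.2 ⟨0, h0⟩
      refine h1.trans_lt ?_
      gcongr
      have h2 : (2 : ℝ) ≤ Real.exp 1 := by
        have := Real.add_one_le_exp (1 : ℝ); linarith
      calc (2 : ℝ) ^ (3 * 5 * (D * ℓ) + 2 * D) ≤ Real.exp 1 ^ (3 * 5 * (D * ℓ) + 2 * D) := by gcongr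
        _ = Real.exp ((3 * 5 * (D * ℓ) + 2 * D : ℕ) : ℝ) := by
            rw [← Real.exp_nat_mul, mul_one]
        _ < _ := by
            refine Real.exp_lt_exp.2 ?_
            have h3 : (D : ℝ) ≤ (D * ℓ : ℕ) := by exact_mod_cast hDDℓ
            have h4 : (0 : ℝ) < D := by exact_mod_cast hD
            rw [hr]
            push_cast at h3 ⊢
            linarith)
  have hXcard : (X.card : ℝ) ≤ 2 ^ (20000 * F) * Z.card := by
    rw [← hqr]; exact_mod_cast hXZ
  have hXcardN : X.card ≤ 2 ^ (20000 * F) * Z.card := by exact_mod_cast hXcard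
  have hZcard : 0 < Z.card := Finset.card_pos.2 ⟨0, hZ0⟩
  have hZd : ((3 * e + 1) • Z).card < 2 ^ e * Z.card := by
    have h1 : (3 * e + 1) • Z ⊆ (2 * (3 * e + 1)) • X := by
      rw [mul_comm 2, mul_nsmul']
      exact Finset.nsmul_subset_nsmul_left hZ2
    calc ((3 * e + 1) • Z).card ≤ ((2 * (3 * e + 1)) • X).card := Finset.card_le_card h1
      _ ≤ 2 ^ (3 * 2 * (D * ℓ) + 2 * D) * X.card := hgr _ 2 (by omega) b1
      _ ≤ 2 ^ (3 * 2 * (D * ℓ) + 2 * D) * (2 ^ (20000 * F) * Z.card) :=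
          Nat.mul_le_mul_left _ hXcardN
      _ = 2 ^ (3 * 2 * (D * ℓ) + 2 * D + 20000 * F) * Z.card := by
          rw [pow_add _ _ (20000 * F)]; ring
      _ < 2 ^ e * Z.card := by
          refine Nat.mul_lt_mul_of_pos_right ?_ hZcard
          exact Nat.pow_lt_pow_right (by norm_num) (by omega)
  obtain ⟨m, hm, M, hprop, hcard, hM⟩ := exists_cosetProgression_of_annihilating
    (Finset.univ.filter fun γ : AddChar G ℂ => 1 / 2 ≤ ‖charMean X γ‖) hZ0 hZneg
    (τ := 200 * (1 / (800 * e))) (by positivity)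
    (fun γ hγ z hz => hZΔ γ (Finset.mem_filter.1 hγ).2 z hz) hZd
    (by
      have : (3 * (e : ℝ) + 1) * (200 * (1 / (800 * e))) = (3 * e + 1) / (4 * e) := by
        field_simp; norm_num
      rw [this, div_lt_iff₀ (by positivity)]
      linarith) hδ0 hδ
  refine ⟨m, hm, M, hprop, ?_, fun y hy γ hγ => hM y hy γ (Finset.mem_filter.2
    ⟨Finset.mem_univ _, hγ⟩)⟩
  calc (X.card : ℝ) ≤ 2 ^ (20000 * F) * Z.card := hXcard
    _ ≤ 2 ^ (20000 * F) * ((4 * e / δ) ^ m * M.carrier.ncard) := by gcongr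
    _ = _ := by ring

end PolynomialGrowth

/-! ### Progressions of near-periods of the overlap. -/

section OverlapProgression

variable {G : Type u} [AddCommGroup G] [DecidableEq G]

theorem mem_of_overlap_pos {A S : Finset G} {x : G} (h : 0 < overlap A S x) :
    x ∈ A - A + (S - S) := by
  by_contra hx
  refine h.ne' ?_
  rw [overlap]
  have : ∑ a ∈ A, ∑ s ∈ S, indicatorFn (A + S) (a + s + x) = 0 := by
    refine Finset.sum_eq_zero fun a ha => Finset.sum_eq_zero fun s hs => ?_
    rw [indicatorFn_apply, if_neg]
    intro hmem
    obtain ⟨a', ha', s', hs', he⟩ := Finset.mem_add.1 hmem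
    refine hx ?_
    have : x = (a' - a) + (s' - s) := by
      rw [show (a' - a) + (s' - s) = (a' + s') - (a + s) by abel, he]; abel
    rw [this]
    exact Finset.add_mem_add (Finset.sub_mem_sub ha' ha) (Finset.sub_mem_sub hs' hs)
  rw [this, zero_div]

/-- With j = ⌊n/k⌋ + 1, nX lies in the j-fold sum of A - A + (S - S), of size at most K^(4j+3)|A|.
Because k ≥ 400 log K, the part growing with n costs only n/100 in the exponent. -/
theorem card_nsmul_le_exp {A S X : Finset G} (hA : A.Nonempty) (hS : S.Nonempty) {K : ℝ}
    (hK : 1 ≤ K) (hKA : ((A + S).card : ℝ) ≤ K * A.card) (hKS : ((A + S).card : ℝ) ≤ K * S.card)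
    (h0 : (0 : G) ∈ X) {k m : ℕ} (hk0 : 0 < k) (hk : 400 * Real.log K ≤ k)
    (hkX : k • X ⊆ A - A + (S - S)) (hAX : (A.card : ℝ) ≤ 2 * K ^ m * X.card) (n : ℕ) :
    ((n • X).card : ℝ) ≤ Real.exp (n / 100 + ((m + 7) * Real.log K + 1)) * X.card := by
  have hKp : 0 < K := by linarith
  have hkr : (0 : ℝ) < k := by exact_mod_cast hk0
  have hlog : 0 ≤ Real.log K := Real.log_nonneg hK
  set j := n / k + 1 with hj
  have hnj : n ≤ k * j := by
    rw [hj]; exact (Nat.lt_mul_div_succ n hk0).le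
  have h1 : n • X ⊆ j • (A - A + (S - S)) := by
    refine (Finset.nsmul_subset_nsmul_right h0 hnj).trans ?_
    rw [mul_nsmul]
    exact Finset.nsmul_subset_nsmul_left hkX
  have h2 : ((n • X).card : ℝ) ≤ (j • (A - A + (S - S))).card := by
    exact_mod_cast Finset.card_le_card h1
  have h3 := card_iterated_differences_le hA hS hKA hKS j
  have hpow : ∀ i : ℕ, K ^ i = Real.exp (i * Real.log K) := fun i => by
    rw [Real.exp_nat_mul, Real.exp_log hKp]
  have hjr : (j : ℝ) ≤ n / k + 1 := by
    rw [hj]; push_cast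
    linarith [Nat.cast_div_le (α := ℝ) (m := n) (n := k)]
  have h2e : (2 : ℝ) ≤ Real.exp 1 := by
    have := Real.add_one_le_exp (1 : ℝ); linarith
  calc ((n • X).card : ℝ) ≤ K ^ (4 * j + 3) * A.card := h2.trans h3
    _ ≤ K ^ (4 * j + 3) * (Real.exp 1 * K ^ m * X.card) := by
        gcongr
        refine hAX.trans ?_
        gcongr
    _ = Real.exp (((4 * j + 3 : ℕ) : ℝ) * Real.log K + (1 + m * Real.log K)) * X.card := by
        rw [hpow, hpow, Real.exp_add, Real.exp_add]; ring
    _ ≤ _ := by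
        refine mul_le_mul_of_nonneg_right (Real.exp_le_exp.2 ?_) (by positivity)
        push_cast
        have h4 : (n : ℝ) / k * Real.log K ≤ n / 400 := by
          rw [div_mul_eq_mul_div, div_le_div_iff₀ hkr (by norm_num)]
          have : (n : ℝ) * (400 * Real.log K) ≤ n * k := by gcongr
          linarith
        have h5 : (j : ℝ) * Real.log K ≤ (n / k + 1) * Real.log K := by gcongr
        linarith

/-- A rate of 1/100 leaves |(3D + 1)X| below 2^D|X| once D ≥ 2E + 1. The covering lemma then turns
exponential growth of small rate into polynomial growth. -/
theorem card_nsmul_le_pow_of_exp {X : Finset G} (h0 : (0 : G) ∈ X) (hneg : -X = X) {E : ℝ}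
    (hE : 0 ≤ E) (hX : ∀ n : ℕ, ((n • X).card : ℝ) ≤ Real.exp (n / 100 + E) * X.card) {D : ℕ}
    (hD : 2 * E + 1 ≤ D) (n : ℕ) (hn : 2 ≤ n) :
    (n • X).card ≤ (2 * n + 1) ^ D * 4 ^ D * X.card := by
  have hXc : (0 : ℝ) < X.card := by exact_mod_cast Finset.card_pos.2 ⟨0, h0⟩
  have hD1 : (1 : ℝ) ≤ D := by linarith
  have hd : ((3 * D + 1) • X).card < 2 ^ D * X.card := by
    have h1 := hX (3 * D + 1)
    have h2 : Real.exp (((3 * D + 1 : ℕ) : ℝ) / 100 + E) < 2 ^ D := by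
      have h3 : (2 : ℝ) ^ D = Real.exp (D * Real.log 2) := by
        rw [Real.exp_nat_mul, Real.exp_log (by norm_num)]
      rw [h3]
      refine Real.exp_lt_exp.2 ?_
      have := Real.log_two_gt_d9
      push_cast
      nlinarith
    have h4 : (((3 * D + 1) • X).card : ℝ) < 2 ^ D * X.card := h1.trans_lt (by gcongr)
    exact_mod_cast h4
  obtain ⟨T, -, hTD, hT⟩ := exists_small_spanning_set h0 hd
  have h1 := card_nsmul_le_of_covering hneg hT hn
  have h2 : (2 • X).card ≤ 4 ^ D * X.card := by
    have h3 := hX 2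
    have h4 : Real.exp (((2 : ℕ) : ℝ) / 100 + E) ≤ 4 ^ D := by
      calc Real.exp (((2 : ℕ) : ℝ) / 100 + E) ≤ Real.exp (D * 1) := by
            refine Real.exp_le_exp.2 ?_
            push_cast; linarith
        _ = Real.exp 1 ^ D := Real.exp_nat_mul 1 D
        _ ≤ 4 ^ D := by
            gcongr
            linarith [Real.exp_one_lt_three]
    have h5 : ((2 • X).card : ℝ) ≤ 4 ^ D * X.card := h3.trans (by gcongr)
    exact_mod_cast h5
  calc (n • X).card ≤ (2 * n + 1) ^ T.card * (2 • X).card := h1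
    _ ≤ (2 * n + 1) ^ D * (4 ^ D * X.card) :=
        Nat.mul_le_mul (Nat.pow_le_pow_right (by omega) hTD.le) h2
    _ = _ := by ring

variable [Fintype G]

/-- A proper coset progression all of whose elements, together with their negatives, almost
stabilise `A + S` in the averaged sense measured by `overlap`. -/
theorem exists_cosetProgression_overlap {A S : Finset G} (hA : A.Nonempty) (hS : S.Nonempty) {K ε : ℝ}
    (hK : 1 ≤ K) (hKA : ((A + S).card : ℝ) ≤ K * A.card) (hKS : ((A + S).card : ℝ) ≤ K * S.card)
    (hε0 : 0 < ε) (hε : ε ≤ 1) {k m D ℓ : ℕ} (hk0 : 0 < k) (hk : 400 * Real.log K ≤ k)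
    (hk2 : 8 * √K ≤ ε * 2 ^ k) (hm0 : 0 < m)
    (hm : 4 * K ^ 7 * Real.exp (-(m * (ε / (32 * k)) ^ 2 / 4)) ≤ ε / (32 * k))
    (hD : 2 * ((m + 7) * Real.log K + 1) + 1 ≤ D) (hDℓ : D ≤ 2 ^ ℓ) (hℓ : 10 ≤ ℓ) :
    ∃ d < 100000 * (D * ℓ ^ 2), ∃ M : CosetProgression G d, M.Proper ∧
      ((A + S).card : ℝ) ≤ 4 ^ D * (2 ^ (20000 * (D * ℓ ^ 2)) *
        (4 * (100000 * (D * ℓ ^ 2) : ℕ) / (ε / (8 * Real.pi * √K))) ^ d * M.carrier.ncard) ∧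
      ∀ y ∈ M.carrier, 1 - ε ≤ overlap A S y ∧ 1 - ε ≤ overlap A S (-y) := by
  classical
  have hKp : 0 < K := by linarith
  have hlog : 0 ≤ Real.log K := Real.log_nonneg hK
  have hkr : (1 : ℝ) ≤ k := by exact_mod_cast hk0
  have hAc : (0 : ℝ) < A.card := by exact_mod_cast hA.card_pos
  have hsK : 1 ≤ √K := Real.one_le_sqrt.2 hK
  -- Differences of almost periods have error 2η and exceptional density 2η; k steps of both add up
  -- to 4kη = ε/8.
  set η := ε / (32 * k) with hη
  have hη0 : 0 < η := by positivity
  have hη1 : η ≤ 1 := by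
    rw [hη, div_le_one (by positivity)]; linarith
  have hASS : ((A + S - S).card : ℝ) ≤ K ^ 7 * A.card := by
    have h1 := card_iterated_differences_le hA hS hKA hKS 1
    rw [one_nsmul] at h1
    refine le_trans ?_ h1
    obtain ⟨a, ha⟩ := hA
    have : (A + S - S).card ≤ (A - A + (S - S)).card := by
      refine Finset.card_le_card_of_injOn (fun x => x - a) ?_ (fun _ _ _ _ h => by simpa using h)
      intro x hx
      obtain ⟨y, hy, s, hs, rfl⟩ := Finset.mem_sub.1 hx
      obtain ⟨b, hb, s', hs', rfl⟩ := Finset.mem_add.1 hy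
      have e : b + s' - s - a = (b - a) + (s' - s) := by abel
      simp only [e]
      exact Finset.add_mem_add (Finset.sub_mem_sub hb ha) (Finset.sub_mem_sub hs' hs)
    exact_mod_cast this
  obtain ⟨T, hTA, hTc, hTp⟩ := exists_almost_periods hA hS hKS hη0 hη1 hη0 hm0 (by
    calc 4 * ((A + S - S).card : ℝ) * Real.exp (-(m * η ^ 2 / 4))
        ≤ 4 * (K ^ 7 * A.card) * Real.exp (-(m * η ^ 2 / 4)) := by gcongr
      _ = 4 * K ^ 7 * Real.exp (-(m * η ^ 2 / 4)) * A.card := by ring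
      _ ≤ η * A.card := by gcongr)
  have hTne : T.Nonempty := by
    rw [← Finset.card_pos]
    rcases Nat.eq_zero_or_pos T.card with h | h
    · rw [h] at hTc; simp at hTc; exact absurd hTc hA.ne_empty
    · exact h
  set X := T - T with hXdef
  have h0 : (0 : G) ∈ X := by
    obtain ⟨t, ht⟩ := hTne
    rw [← sub_self t]; exact Finset.sub_mem_sub ht ht
  have hneg : -X = X := by rw [hXdef, neg_sub]
  have hTX : T.card ≤ X.card := Finset.card_le_card_sub_right hTne
  have hAX : (A.card : ℝ) ≤ 2 * K ^ m * X.card := by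
    refine hTc.trans ?_
    gcongr
  have hov : ∀ x ∈ k • X, ∀ y, |overlap A S (y + x) - overlap A S y| ≤ ε / 8 := by
    intro x hx y
    have h1 := abs_overlap_add_sub_le hA hS (X := X) (η := 2 * η) (ξ := 2 * η) (by positivity)
      (by
        intro t ht
        obtain ⟨a, ha, b, hb, rfl⟩ := Finset.mem_sub.1 ht
        exact hTp a ha b hb) k hx y
    refine h1.trans (le_of_eq ?_)
    rw [hη]; field_simp; norm_num
  have hkX : k • X ⊆ A - A + (S - S) := by
    intro x hx
    have h1 := abs_le.1 (hov x hx 0)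
    rw [zero_add, overlap_zero hA hS] at h1
    exact mem_of_overlap_pos (by linarith [h1.1])
  have hpoly := card_nsmul_le_pow_of_exp h0 hneg
    (E := (m + 7) * Real.log K + 1) (by positivity)
    (card_nsmul_le_exp hA hS hK hKA hKS h0 hk0 hk hkX hAX) hD
  have hD0 : 0 < D := by
    have : (0 : ℝ) < D := lt_of_lt_of_le (by positivity) hD
    exact_mod_cast this
  have hpi := Real.pi_gt_three
  have hδ : ε / (8 * Real.pi * √K) < 1 / 2 := by
    rw [div_lt_div_iff₀ (by positivity) (by norm_num)]
    nlinarith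
  obtain ⟨d, hd, M, hprop, hcard, hM⟩ := exists_cosetProgression_of_polynomial_growth h0 hneg hD0
    hDℓ hℓ hpoly (δ := ε / (8 * Real.pi * √K)) (by positivity) hδ
  have hδ' : 2 * Real.pi * (ε / (8 * Real.pi * √K)) = ε / (4 * √K) := by field_simp; norm_num
  rw [hδ'] at hM
  -- The error budget is 2 · ε/8 from smoothing and ε/4 each from the large spectrum and from the
  -- damped characters: 3ε/4 in total.
  have hkey : ∀ y, (∀ γ : AddChar G ℂ, 1 / 2 ≤ ‖charMean X γ‖ → ‖1 - γ y‖ ≤ ε / (4 * √K)) →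
      1 - ε ≤ overlap A S y := by
    intro y hy
    refine le_trans ?_ (overlap_ge_of_bohr hA hS hKA ⟨0, h0⟩ (by positivity) hov hy)
    have h1 : ε / (4 * √K) * √K = ε / 4 := by field_simp
    have h2 : 2 * (1 / 2 : ℝ) ^ k * √K ≤ ε / 4 := by
      rw [one_div, inv_pow, mul_assoc, inv_mul_eq_div, mul_div_assoc', div_le_iff₀ (by positivity)]
      linarith
    rw [add_mul, h1]
    linarith
  refine ⟨d, hd, M, hprop, ?_, fun y hy => ⟨hkey y (hM y hy), hkey (-y) fun γ hγ => ?_⟩⟩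
  · have h1 : ((A + S).card : ℝ) ≤ 4 ^ D * X.card := by
      have h2 : K * (2 * K ^ m) ≤ 4 ^ D := by
        have hpow : ∀ i : ℕ, K ^ i = Real.exp (i * Real.log K) := fun i => by
          rw [Real.exp_nat_mul, Real.exp_log hKp]
        have h2e : (2 : ℝ) ≤ Real.exp 1 := by
          have := Real.add_one_le_exp (1 : ℝ); linarith
        calc K * (2 * K ^ m) = 2 * K ^ (m + 1) := by ring
          _ ≤ Real.exp 1 * K ^ (m + 1) := by gcongr
          _ = Real.exp (1 + ((m + 1 : ℕ) : ℝ) * Real.log K) := by rw [hpow, Real.exp_add]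
          _ ≤ Real.exp (D * 1) := by
              refine Real.exp_le_exp.2 ?_
              push_cast
              nlinarith
          _ = Real.exp 1 ^ D := Real.exp_nat_mul 1 D
          _ ≤ 4 ^ D := by
              gcongr
              linarith [Real.exp_one_lt_three]
      calc ((A + S).card : ℝ) ≤ K * (2 * K ^ m * X.card) := hKA.trans (by gcongr)
        _ = K * (2 * K ^ m) * X.card := by ring
        _ ≤ _ := by gcongr
    refine h1.trans ?_
    gcongr
  · rw [norm_one_sub_addChar_neg]
    exact hM y hy γ hγ

end OverlapProgression

/-! ### Choice of parameters. -/

section Parameters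

variable {K ε : ℝ}

theorem two_le_exp_one : (2 : ℝ) ≤ Real.exp 1 := by
  have := Real.add_one_le_exp (1 : ℝ); linarith

theorem two_pow_le_exp (n : ℕ) : (2 : ℝ) ^ n ≤ Real.exp n := by
  calc (2 : ℝ) ^ n ≤ Real.exp 1 ^ n := by gcongr; exact two_le_exp_one
    _ = Real.exp n := by rw [← Real.exp_nat_mul, mul_one]

theorem one_third_le_log (hK : 3 / 2 ≤ K) : 1 / 3 ≤ Real.log K := by
  have h1 := Real.one_sub_inv_le_log_of_pos (by norm_num : (0 : ℝ) < 3 / 2)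
  have h2 := Real.log_le_log (by norm_num : (0 : ℝ) < 3 / 2) hK
  norm_num at h1
  linarith

/-- The inequality 1 - 1/x ≤ log x is sharp enough near x = 1, hence its use at x = (5/3)²/e. The
margin over 1/2 is what keeps 2 log K / ε above 1 when K ≥ 5/3 and ε ≤ 1. -/
theorem log_five_thirds : 51 / 100 ≤ Real.log (5 / 3) := by
  have h1 := Real.one_sub_inv_le_log_of_pos
    (by positivity : (0 : ℝ) < (5 / 3) ^ 2 / Real.exp 1)
  rw [Real.log_div (by norm_num) (Real.exp_pos 1).ne', Real.log_exp, Real.log_pow, inv_div] at h1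
  have h2 := Real.exp_one_lt_d9
  push_cast at h1
  have h3 : Real.exp 1 / (5 / 3) ^ 2 ≤ 98 / 100 := by
    rw [div_le_iff₀ (by norm_num)]
    norm_num
    linarith
  linarith

theorem log_inv_mul_eq (hK : 0 < K) (hε0 : 0 < ε) :
    Real.log (ε⁻¹ * K) = Real.log ε⁻¹ + Real.log K :=
  Real.log_mul (inv_pos.2 hε0).ne' hK.ne'

theorem half_le_log_inv_mul (hK : 3 / 2 ≤ K) (hε0 : 0 < ε) (hε : ε ≤ 1)
    (hreg : ε ≤ 1 / 2 ∨ 5 / 3 ≤ K) : 1 / 2 ≤ Real.log (ε⁻¹ * K) := by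
  have hinv : 1 ≤ ε⁻¹ := (one_le_inv₀ hε0).2 hε
  have h1 : 5 / 3 ≤ ε⁻¹ * K := by
    rcases hreg with h | h
    · have : 2 ≤ ε⁻¹ := by
        rw [le_inv_comm₀ (by norm_num) hε0]; linarith
      nlinarith
    · nlinarith
  have h2 := Real.log_le_log (by norm_num) h1
  linarith [log_five_thirds]

theorem ratio_ge (hK : 3 / 2 ≤ K) (hε0 : 0 < ε) (hε : ε ≤ 1) (hreg : ε ≤ 1 / 2 ∨ 5 / 3 ≤ K) :
    102 / 100 ≤ 2 * Real.log K / ε := by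
  rw [le_div_iff₀ hε0]
  rcases hreg with h | h
  · linarith [one_third_le_log hK]
  · have := Real.log_le_log (by norm_num) h
    linarith [log_five_thirds]

theorem log_ratio_ge (hK : 3 / 2 ≤ K) (hε0 : 0 < ε) (hε : ε ≤ 1) (hreg : ε ≤ 1 / 2 ∨ 5 / 3 ≤ K) :
    1 / 60 ≤ Real.log (2 * Real.log K / ε) := by
  have h1 := ratio_ge hK hε0 hε hreg
  have h2 := Real.one_sub_inv_le_log_of_pos (by norm_num : (0 : ℝ) < 102 / 100)
  have h3 := Real.log_le_log (by norm_num) h1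
  norm_num at h2 h3
  linarith

/-- With u = 2 log K / ε, both ε⁻¹ and log K · ε⁻¹ are O(u), so log(ε⁻¹K) · ε⁻¹ is O(u²). Quantities
logarithmic in these parameters can therefore be charged to log u, the logarithm of the inverse base
in the final size bound. -/
theorem log_log_inv_mul_le (hK : 3 / 2 ≤ K) (hε0 : 0 < ε) (hε : ε ≤ 1)
    (hreg : ε ≤ 1 / 2 ∨ 5 / 3 ≤ K) :
    Real.log (Real.log (ε⁻¹ * K)) + Real.log ε⁻¹ ≤ 2 + 2 * Real.log (2 * Real.log K / ε) := by
  have hK0 : 0 < K := by linarith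
  have hL := half_le_log_inv_mul hK hε0 hε hreg
  have hu := ratio_ge hK hε0 hε hreg
  have hlog := one_third_le_log hK
  have hinv : 0 < ε⁻¹ := inv_pos.2 hε0
  set u := 2 * Real.log K / ε with hu_def
  have hu0 : 0 < u := by linarith
  have h1 : ε⁻¹ ≤ 3 / 2 * u := by
    rw [hu_def, inv_eq_one_div, mul_div_assoc', div_le_div_iff_of_pos_right hε0]
    linarith
  have h2 : Real.log (ε⁻¹ * K) * ε⁻¹ ≤ Real.exp 2 * u ^ 2 := by
    rw [log_inv_mul_eq hK0 hε0]
    have h3 := Real.log_le_sub_one_of_pos hinv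
    have h4 : Real.log K * ε⁻¹ = u / 2 := by rw [hu_def]; field_simp
    have h5 : Real.log ε⁻¹ * ε⁻¹ ≤ ε⁻¹ * ε⁻¹ := by
      gcongr; linarith
    have h6 : ε⁻¹ * ε⁻¹ ≤ 3 / 2 * u * (3 / 2 * u) := by gcongr
    have h7 := Real.add_one_le_exp (2 : ℝ)
    have h8 : u ≤ u ^ 2 := by nlinarith
    have h9 : 3 * u ^ 2 ≤ Real.exp 2 * u ^ 2 := by gcongr; linarith
    rw [add_mul, h4]
    nlinarith
  have h3 := Real.log_le_log (by positivity) h2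
  rw [Real.log_mul (by linarith) hinv.ne', Real.log_mul (Real.exp_pos _).ne' (by positivity),
    Real.log_exp, Real.log_pow] at h3
  push_cast at h3
  exact h3

theorem exists_period_parameters (hK : 3 / 2 ≤ K) (hε0 : 0 < ε) (hε : ε ≤ 1)
    (hL : 1 / 2 ≤ Real.log (ε⁻¹ * K)) :
    ∃ k m : ℕ, 0 < k ∧ 400 * Real.log K ≤ k ∧ 8 * √K ≤ ε * 2 ^ k ∧ 0 < m ∧
      4 * K ^ 7 * Real.exp (-(m * (ε / (32 * k)) ^ 2 / 4)) ≤ ε / (32 * k) ∧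
      (m : ℝ) ≤ 300000000000 * (Real.log (ε⁻¹ * K) ^ 3 / ε ^ 2) := by
  have hK0 : 0 < K := by linarith
  have hinv : 1 ≤ ε⁻¹ := (one_le_inv₀ hε0).2 hε
  have hlinv : 0 ≤ Real.log ε⁻¹ := Real.log_nonneg hinv
  have hKL : Real.log K ≤ Real.log (ε⁻¹ * K) := by
    rw [log_inv_mul_eq hK0 hε0]; linarith
  have hexpL : Real.exp (Real.log (ε⁻¹ * K)) = ε⁻¹ * K := Real.exp_log (by positivity)
  set L := Real.log (ε⁻¹ * K) with hLdef
  set k := ⌈400 * L⌉₊ with hkdef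
  have hk1 : 400 * L ≤ k := Nat.le_ceil _
  have hk2 : (k : ℝ) ≤ 402 * L := by
    have := (Nat.ceil_lt_add_one (by positivity : 0 ≤ 400 * L)).le
    rw [← hkdef] at this
    linarith
  have hk0 : (0 : ℝ) < k := by linarith
  -- 1761280 = 430 · 4 · 32², making the Hoeffding exponent at least 430L. This absorbs 128k ε⁻¹K⁷ ≤
  -- exp(7 + 409L), since L ≥ 1/2.
  set m := ⌈1761280 * k ^ 2 * L / ε ^ 2⌉₊ with hmdef
  have hL0 : 0 < L := by linarith
  have hm1 : 1761280 * k ^ 2 * L / ε ^ 2 ≤ m := Nat.le_ceil _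
  refine ⟨k, m, by exact_mod_cast hk0, by linarith, ?_, ?_, ?_, ?_⟩
  · have h1 : √K ≤ K := Real.sqrt_le_iff.2 ⟨by linarith, by nlinarith⟩
    have h2 : (2 : ℝ) ^ k = Real.exp (k * Real.log 2) := by
      rw [Real.exp_nat_mul, Real.exp_log (by norm_num)]
    have h3 : Real.exp (3 + L) ≤ 2 ^ k := by
      rw [h2]
      refine Real.exp_le_exp.2 ?_
      have := Real.log_two_gt_d9
      nlinarith
    have h4 : 8 * (ε⁻¹ * K) ≤ Real.exp (3 + L) := by
      rw [Real.exp_add, hexpL]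
      have := two_pow_le_exp 3
      norm_num at this
      gcongr
    calc 8 * √K ≤ 8 * K := by gcongr
      _ = ε * (8 * (ε⁻¹ * K)) := by field_simp
      _ ≤ ε * 2 ^ k := by gcongr; exact h4.trans h3
  · exact Nat.ceil_pos.2 (by positivity)
  · have h1 : (430 : ℝ) * L ≤ m * (ε / (32 * k)) ^ 2 / 4 := by
      have : 1761280 * (k : ℝ) ^ 2 * L / ε ^ 2 * (ε / (32 * k)) ^ 2 / 4 = 430 * L := by
        field_simp; norm_num
      rw [← this]
      gcongr
    have h2 : (128 : ℝ) * k * (ε⁻¹ * K ^ 7) ≤ Real.exp (430 * L) := by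
      have a1 : (128 : ℝ) ≤ Real.exp 7 := by
        have := two_pow_le_exp 7
        norm_num at this
        exact this
      have a2 : (k : ℝ) ≤ Real.exp (402 * L) := by
        have := Real.add_one_le_exp (402 * L)
        linarith
      have a3 : ε⁻¹ * K ^ 7 ≤ Real.exp (7 * L) := by
        have e : Real.exp (7 * L) = (ε⁻¹ * K) ^ 7 := by
          rw [← hexpL, ← Real.exp_nat_mul]; norm_num
        rw [e, mul_pow]
        gcongr
        exact le_self_pow₀ hinv (by norm_num)
      calc (128 : ℝ) * k * (ε⁻¹ * K ^ 7)
          ≤ Real.exp 7 * Real.exp (402 * L) * Real.exp (7 * L) := by gcongr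
        _ = Real.exp (7 + 402 * L + 7 * L) := by rw [Real.exp_add, Real.exp_add]
        _ ≤ _ := Real.exp_le_exp.2 (by linarith)
    have h3 : Real.exp (-(m * (ε / (32 * k)) ^ 2 / 4)) ≤ (Real.exp (430 * L))⁻¹ := by
      rw [← Real.exp_neg]
      exact Real.exp_le_exp.2 (by linarith)
    have h4 : (Real.exp (430 * L))⁻¹ ≤ ((128 : ℝ) * k * (ε⁻¹ * K ^ 7))⁻¹ := by
      gcongr
    calc 4 * K ^ 7 * Real.exp (-(m * (ε / (32 * k)) ^ 2 / 4))
        ≤ 4 * K ^ 7 * ((128 : ℝ) * k * (ε⁻¹ * K ^ 7))⁻¹ := by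
          gcongr
          exact h3.trans h4
      _ = ε / (32 * k) := by field_simp; norm_num
  · have h1 := (Nat.ceil_lt_add_one (by positivity : 0 ≤ 1761280 * (k : ℝ) ^ 2 * L / ε ^ 2)).le
    rw [← hmdef] at h1
    have h2 : 1761280 * (k : ℝ) ^ 2 * L / ε ^ 2 ≤ 1761280 * (402 * L) ^ 2 * L / ε ^ 2 := by gcongr
    have h3 : 1761280 * (402 * L) ^ 2 * L / ε ^ 2 = 284629893120 * (L ^ 3 / ε ^ 2) := by ring
    have h4 : 1 ≤ 8 * (L ^ 3 / ε ^ 2) := by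
      have : (1 / 2 : ℝ) ^ 3 / 1 ^ 2 ≤ L ^ 3 / ε ^ 2 := by gcongr
      norm_num at this
      linarith
    linarith

/-- ℓ is of the order of log D. Its bound by log(ε⁻¹K) serves the dimension, and its bound by log(2
log K / ε) serves the size. -/
theorem exists_growth_parameters (hK : 3 / 2 ≤ K) (hε0 : 0 < ε) (hε : ε ≤ 1)
    (hreg : ε ≤ 1 / 2 ∨ 5 / 3 ≤ K) {m : ℕ}
    (hm : (m : ℝ) ≤ 300000000000 * (Real.log (ε⁻¹ * K) ^ 3 / ε ^ 2)) :
    ∃ D ℓ : ℕ, 2 * ((m + 7) * Real.log K + 1) + 1 ≤ D ∧ D ≤ 2 ^ ℓ ∧ 10 ≤ ℓ ∧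
      (D : ℝ) ≤ 1000000000000 * (Real.log (ε⁻¹ * K) ^ 4 / ε ^ 2) ∧
      (ℓ : ℝ) ≤ 150 * Real.log (ε⁻¹ * K) ∧ (ℓ : ℝ) ≤ 5000 * Real.log (2 * Real.log K / ε) := by
  have hK0 : 0 < K := by linarith
  have hinv : 1 ≤ ε⁻¹ := (one_le_inv₀ hε0).2 hε
  have hlinv : 0 ≤ Real.log ε⁻¹ := Real.log_nonneg hinv
  have hlogK := one_third_le_log hK
  have hKL : Real.log K ≤ Real.log (ε⁻¹ * K) := by
    rw [log_inv_mul_eq hK0 hε0]; linarith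
  have hinvL : Real.log ε⁻¹ ≤ Real.log (ε⁻¹ * K) := by
    rw [log_inv_mul_eq hK0 hε0]; linarith
  have hL := half_le_log_inv_mul hK hε0 hε hreg
  have hρ := log_log_inv_mul_le hK hε0 hε hreg
  have hlam := log_ratio_ge hK hε0 hε hreg
  set L := Real.log (ε⁻¹ * K) with hLdef
  have hL0 : 0 < L := by linarith
  set B := 1000000000000 * (L ^ 4 / ε ^ 2) with hB
  have hx : 1 / 16 ≤ L ^ 4 / ε ^ 2 := by
    have : (1 / 2 : ℝ) ^ 4 / 1 ^ 2 ≤ L ^ 4 / ε ^ 2 := by gcongr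
    norm_num at this
    linarith
  have hB1 : 1 ≤ B := by rw [hB]; linarith
  set D := ⌈2 * ((m + 7) * L + 1) + 1⌉₊ with hDdef
  have hD1 : 2 * ((m + 7) * L + 1) + 1 ≤ D := Nat.le_ceil _
  have hDB : (D : ℝ) ≤ B := by
    have h1 := (Nat.ceil_lt_add_one (by positivity : (0 : ℝ) ≤ 2 * ((m + 7) * L + 1) + 1)).le
    rw [← hDdef] at h1
    have h2 : (m : ℝ) * L ≤ 300000000000 * (L ^ 3 / ε ^ 2) * L := by gcongr
    have h3 : 300000000000 * (L ^ 3 / ε ^ 2) * L = 300000000000 * (L ^ 4 / ε ^ 2) := by ring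
    have h4 : L ≤ 8 * (L ^ 4 / ε ^ 2) := by
      have a1 : (1 / 2 : ℝ) ^ 3 / 1 ^ 2 ≤ L ^ 3 / ε ^ 2 := by gcongr
      have a2 : L ^ 4 / ε ^ 2 = L * (L ^ 3 / ε ^ 2) := by ring
      rw [a2]
      norm_num at a1
      nlinarith
    rw [hB]
    linarith
  set ℓ := 10 + ⌈2 * Real.log B⌉₊ with hℓdef
  have hlB : 0 ≤ Real.log B := Real.log_nonneg hB1
  have hℓ1 : 2 * Real.log B ≤ ℓ := by
    have := Nat.le_ceil (2 * Real.log B)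
    rw [hℓdef]; push_cast; linarith
  have hℓ2 : (ℓ : ℝ) ≤ 67 + 8 * (Real.log L + Real.log ε⁻¹) := by
    have h1 := (Nat.ceil_lt_add_one (by positivity : 0 ≤ 2 * Real.log B)).le
    have h2 : Real.log B = Real.log 1000000000000 + (4 * Real.log L + 2 * Real.log ε⁻¹) := by
      rw [hB, Real.log_mul (by norm_num) (by positivity), Real.log_div (by positivity)
        (by positivity), Real.log_pow, Real.log_pow, Real.log_inv]
      push_cast
      ring
    have h3 : Real.log 1000000000000 ≤ 28 := by
      have : Real.log 1000000000000 ≤ Real.log (2 ^ 40) := Real.log_le_log (by norm_num) (by norm_num)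
      rw [Real.log_pow] at this
      have h4 := Real.log_two_lt_d9
      push_cast at this
      linarith
    rw [hℓdef]; push_cast
    linarith
  refine ⟨D, ℓ, ?_, ?_, by omega, hDB, ?_, ?_⟩
  · refine le_trans ?_ hD1
    gcongr
  · have h1 : (D : ℝ) ≤ 2 ^ ℓ := by
      refine hDB.trans ?_
      have h2 : (2 : ℝ) ^ ℓ = Real.exp (ℓ * Real.log 2) := by
        rw [Real.exp_nat_mul, Real.exp_log (by norm_num)]
      rw [h2, ← Real.log_le_iff_le_exp (by linarith)]
      have := Real.log_two_gt_d9
      nlinarith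
    exact_mod_cast h1
  · have := Real.log_le_sub_one_of_pos hL0
    linarith
  · linarith

theorem progression_constant_le (hK : 1 ≤ K) (hε0 : 0 < ε) (hε : ε ≤ 1) {D ℓ d : ℕ}
    (hD0 : 0 < D) (hDℓ : D ≤ 2 ^ ℓ) (hℓ : 10 ≤ ℓ) (hd : d < 100000 * (D * ℓ ^ 2)) :
    (4 : ℝ) ^ D * (2 ^ (20000 * (D * ℓ ^ 2)) *
        (4 * (100000 * (D * ℓ ^ 2) : ℕ) / (ε / (8 * Real.pi * √K))) ^ d)
      ≤ Real.exp (1000000 * (D * ℓ ^ 2) * (ℓ + Real.log (ε⁻¹ * K))) := by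
  have hK0 : 0 < K := by linarith
  have hinv : 1 ≤ ε⁻¹ := (one_le_inv₀ hε0).2 hε
  have hexpL : Real.exp (Real.log (ε⁻¹ * K)) = ε⁻¹ * K := Real.exp_log (by positivity)
  have hL0 : 0 ≤ Real.log (ε⁻¹ * K) := Real.log_nonneg (by nlinarith)
  set L := Real.log (ε⁻¹ * K) with hL
  set F := D * ℓ ^ 2 with hF
  have hFr : (F : ℝ) = D * ℓ ^ 2 := by rw [hF]; push_cast; ring
  rw [← hFr]
  have hDF : D ≤ F := Nat.le_mul_of_pos_right _ (by positivity)
  have hDFr : (D : ℝ) ≤ F := by exact_mod_cast hDF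
  have hℓr : (10 : ℝ) ≤ ℓ := by exact_mod_cast hℓ
  have hFexp : (F : ℝ) ≤ Real.exp (3 * ℓ) := by
    have h1 : F ≤ 2 ^ (3 * ℓ) := by
      have hℓP : ℓ ≤ 2 ^ ℓ := Nat.lt_two_pow_self.le
      calc F ≤ 2 ^ ℓ * (2 ^ ℓ) ^ 2 := Nat.mul_le_mul hDℓ (Nat.pow_le_pow_left hℓP 2)
        _ = 2 ^ (3 * ℓ) := by rw [← pow_mul, ← pow_add]; congr 1; ring
    have h2 := two_pow_le_exp (3 * ℓ)
    push_cast at h2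
    refine le_trans ?_ h2
    exact_mod_cast h1
  have hbase : 4 * ((100000 * F : ℕ) : ℝ) / (ε / (8 * Real.pi * √K)) ≤ Real.exp (6 * ℓ + L) := by
    have h1 : √K ≤ K := Real.sqrt_le_iff.2 ⟨by linarith, by nlinarith⟩
    have h2 : (3200000 : ℝ) * Real.pi ≤ Real.exp (3 * ℓ) := by
      have a1 := two_pow_le_exp 24
      have a2 := Real.pi_le_four
      have a3 : Real.exp ((24 : ℕ) : ℝ) ≤ Real.exp (3 * ℓ) := Real.exp_le_exp.2 (by push_cast; linarith)
      norm_num at a1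
      push_cast at a3
      linarith
    calc 4 * ((100000 * F : ℕ) : ℝ) / (ε / (8 * Real.pi * √K))
        = 3200000 * Real.pi * F * (ε⁻¹ * √K) := by push_cast; field_simp; ring
      _ ≤ Real.exp (3 * ℓ) * Real.exp (3 * ℓ) * (ε⁻¹ * K) := by gcongr
      _ = Real.exp (6 * ℓ + L) := by
          rw [← hexpL, ← Real.exp_add, ← Real.exp_add]; congr 1; ring
  have h4 : (4 : ℝ) ^ D ≤ Real.exp (2 * F) := by
    have h1 : (4 : ℝ) ^ D = 2 ^ (2 * D) := by rw [pow_mul]; norm_num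
    rw [h1]
    refine (two_pow_le_exp _).trans (Real.exp_le_exp.2 ?_)
    push_cast; linarith
  have h5 : (2 : ℝ) ^ (20000 * F) ≤ Real.exp (20000 * F) := by
    have := two_pow_le_exp (20000 * F)
    push_cast at this
    exact this
  have h6 : (4 * ((100000 * F : ℕ) : ℝ) / (ε / (8 * Real.pi * √K))) ^ d
      ≤ Real.exp (100000 * F * (6 * ℓ + L)) := by
    calc (4 * ((100000 * F : ℕ) : ℝ) / (ε / (8 * Real.pi * √K))) ^ d
        ≤ Real.exp (6 * ℓ + L) ^ d := by gcongr
      _ = Real.exp (d * (6 * ℓ + L)) := by rw [← Real.exp_nat_mul]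
      _ ≤ _ := by
          refine Real.exp_le_exp.2 ?_
          have : (d : ℝ) ≤ 100000 * F := by exact_mod_cast hd.le
          gcongr
  calc (4 : ℝ) ^ D * (2 ^ (20000 * F) *
        (4 * ((100000 * F : ℕ) : ℝ) / (ε / (8 * Real.pi * √K))) ^ d)
      ≤ Real.exp (2 * F) * (Real.exp (20000 * F) * Real.exp (100000 * F * (6 * ℓ + L))) := by
        gcongr
    _ = Real.exp (2 * F + (20000 * F + 100000 * F * (6 * ℓ + L))) := by
        rw [Real.exp_add, Real.exp_add]
    _ ≤ _ := by
        refine Real.exp_le_exp.2 ?_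
        have hF0 : (0 : ℝ) ≤ F := by positivity
        have h7 : (F : ℝ) * 10 ≤ F * ℓ := by gcongr
        have h8 : 0 ≤ F * L := by positivity
        nlinarith

end Parameters

/-! ### The two regimes and the theorem. -/

section Main

variable {G : Type u} [AddCommGroup G] [Fintype G] [DecidableEq G]

theorem norm_convMeasure_ge_of_card_add_le [MeasurableSpace G] [DiscreteMeasurableSpace G]
    {A S MF : Finset G} (hA : A.Nonempty) (hS : S.Nonempty) {c : ℝ} (hc : 0 < c)
    (h : ((A + S + MF).card : ℝ) ≤ c * (A + S).card) (μ : MeasureTheory.Measure G)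
    [MeasureTheory.IsProbabilityMeasure μ] (hμ : μ (MF : Set G)ᶜ = 0) :
    c⁻¹ ≤ ‖convMeasure (indicatorFn (A + S)) μ‖ ∧
      c⁻¹ * ((A.card : ℝ) / ((A + S).card : ℝ)) ≤ ‖convMeasure (indicatorFn A) μ‖ := by
  have hW : (0 : ℝ) < (A + S).card := by exact_mod_cast (hA.add hS).card_pos
  constructor
  · have h1 := card_le_card_mul_norm_convMeasure (A + S) MF μ hμ
    have h2 : ((A + S + MF).card : ℝ) * ‖convMeasure (indicatorFn (A + S)) μ‖
        ≤ c * (A + S).card * ‖convMeasure (indicatorFn (A + S)) μ‖ := by gcongr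
    rw [inv_le_iff_one_le_mul₀' hc]
    refine le_of_mul_le_mul_right (a := ((A + S).card : ℝ)) ?_ hW
    linarith
  · have h1 := card_le_card_mul_norm_convMeasure A MF μ hμ
    have h3 : ((A + MF).card : ℝ) ≤ c * (A + S).card := by
      refine le_trans ?_ h
      have : (A + MF).card ≤ (A + S + MF).card := by
        rw [add_right_comm]
        exact Finset.card_le_card_add_right hS
      exact_mod_cast this
    have h2 : ((A + MF).card : ℝ) * ‖convMeasure (indicatorFn A) μ‖
        ≤ c * (A + S).card * ‖convMeasure (indicatorFn A) μ‖ := by gcongr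
    rw [← div_eq_inv_mul, div_div, div_le_iff₀ (by positivity)]
    linarith

theorem div_max_rpow_le_one {K ε D : ℝ} (hε0 : 0 < ε) (hD : 0 ≤ D) :
    (ε / max ε (2 * Real.log K)) ^ D ≤ 1 := by
  have hmax : 0 < max ε (2 * Real.log K) := lt_max_of_lt_left hε0
  refine Real.rpow_le_one (by positivity) ?_ hD
  rw [div_le_one hmax]
  exact le_max_left _ _

/-- Write L = log(ε⁻¹K). The dimension is O(Dℓ²) = O(ε⁻²L⁶), as D = O(ε⁻²L⁴) and ℓ = O(L). The size
loss is exp(O(Dℓ²(ℓ + L))); bounding one ℓ by log(2 log K / ε) and the other by L turns it into a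
power of 2 log K / ε with exponent O(ε⁻²L⁶). -/
theorem exists_cosetProgression_of_doubling_ge [MeasurableSpace G] [DiscreteMeasurableSpace G]
    {A S : Finset G} {K ε : ℝ} (hA : A.Nonempty) (hS : S.Nonempty) (hK : 1 ≤ K)
    (hKA : ((A + S).card : ℝ) ≤ K * A.card) (hKS : ((A + S).card : ℝ) ≤ K * S.card)
    (hε0 : 0 < ε) (hε : ε ≤ 1)
    (hK32 : 3 / 2 ≤ K) (hreg : ε ≤ 1 / 2 ∨ 5 / 3 ≤ K) :
    ∃ (d : ℕ) (M : CosetProgression G d),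
      M.Proper ∧
      (d : ℝ) ≤ 10 ^ 30 * ((ε ^ 2)⁻¹ * Real.log (ε⁻¹ * K) ^ 6) ∧
      (ε / max ε (2 * Real.log K)) ^ (10 ^ 30 * ((ε ^ 2)⁻¹ * Real.log (ε⁻¹ * K) ^ 6))
          * ((A + S).card : ℝ) ≤ (M.carrier.ncard : ℝ) ∧
      ∀ μ : MeasureTheory.Measure G,
        MeasureTheory.IsProbabilityMeasure μ → μ M.carrierᶜ = 0 →
          1 - ε ≤ ‖convMeasure (indicatorFn (A + S)) μ‖ ∧
          (1 - ε) * ((A.card : ℝ) / ((A + S).card : ℝ)) ≤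
            ‖convMeasure (indicatorFn A) μ‖ := by
  have hL := half_le_log_inv_mul hK32 hε0 hε hreg
  have hlam := log_ratio_ge hK32 hε0 hε hreg
  have hratio := ratio_ge hK32 hε0 hε hreg
  obtain ⟨k, m, hk0, hk, hk2, hm0, hm, hmL⟩ := exists_period_parameters hK32 hε0 hε hL
  obtain ⟨D, ℓ, hD, hDℓ, hℓ, hDL, hℓL, hℓlam⟩ :=
    exists_growth_parameters hK32 hε0 hε hreg hmL
  obtain ⟨d, hd, M, hprop, hcard, hM⟩ := exists_cosetProgression_overlap hA hS hK hKA hKS hε0 hε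
    hk0 hk hk2 hm0 hm hD hDℓ hℓ
  have hD0 : 0 < D := by
    rcases Nat.eq_zero_or_pos D with h | h
    · rw [h] at hd; simp at hd
    · exact h
  have hconst := progression_constant_le hK hε0 hε hD0 hDℓ hℓ hd
  set L := Real.log (ε⁻¹ * K) with hLdef
  set lam := Real.log (2 * Real.log K / ε) with hlamdef
  set x := L ^ 4 / ε ^ 2 with hx
  have hx0 : 0 ≤ x := by positivity
  have hL0 : 0 < L := by linarith
  have hlam0 : 0 < lam := by linarith
  have hxL : (ε ^ 2)⁻¹ * L ^ 6 = x * L ^ 2 := by rw [hx]; field_simp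
  rw [hxL]
  have hF : (D : ℝ) * ℓ ^ 2 ≤ 1000000000000 * x * (150 * L) ^ 2 := by gcongr
  have hF' : (D : ℝ) * ℓ ^ 2 * (ℓ + L)
      ≤ 1000000000000 * x * ((150 * L) * (5000 * lam)) * (151 * L) := by
    have h1 : (D : ℝ) * ℓ ^ 2 ≤ 1000000000000 * x * ((150 * L) * (5000 * lam)) := by
      rw [sq]; gcongr
    have h2 : ℓ + L ≤ 151 * L := by linarith
    gcongr
  have hxL2 : 0 ≤ x * L ^ 2 := by positivity
  refine ⟨d, M, hprop, ?_, ?_, ?_⟩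
  · have h1 : (d : ℝ) ≤ 100000 * (D * ℓ ^ 2) := by exact_mod_cast hd.le
    have e : 1000000000000 * x * (150 * L) ^ 2 = 22500000000000000 * (x * L ^ 2) := by ring
    rw [e] at hF
    linarith
  · have hmax : max ε (2 * Real.log K) = 2 * Real.log K := by
      refine max_eq_right ?_
      rw [le_div_iff₀ hε0] at hratio
      linarith
    have hpos : 0 < 2 * Real.log K / ε := by linarith
    rw [hmax, ← inv_div, Real.rpow_def_of_pos (inv_pos.2 hpos), Real.log_inv, ← hlamdef]
    have h2 : ((A + S).card : ℝ)
        ≤ Real.exp (1000000 * (D * ℓ ^ 2) * (ℓ + L)) * M.carrier.ncard := by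
      refine hcard.trans ?_
      rw [← mul_assoc]
      gcongr
    have h3 : Real.exp (1000000 * (D * ℓ ^ 2) * (ℓ + L))
        ≤ Real.exp (lam * (10 ^ 30 * (x * L ^ 2))) := by
      refine Real.exp_le_exp.2 ?_
      have h4 : 0 ≤ lam * (x * L ^ 2) := by positivity
      have e : 1000000000000 * x * ((150 * L) * (5000 * lam)) * (151 * L)
          = 113250000000000000000 * (lam * (x * L ^ 2)) := by ring
      rw [e] at hF'
      linarith
    calc Real.exp (-lam * (10 ^ 30 * (x * L ^ 2))) * ((A + S).card : ℝ)
        ≤ Real.exp (-lam * (10 ^ 30 * (x * L ^ 2))) *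
          (Real.exp (lam * (10 ^ 30 * (x * L ^ 2))) * M.carrier.ncard) := by
          gcongr
          exact h2.trans (by gcongr)
      _ = M.carrier.ncard := by
          rw [← mul_assoc, ← Real.exp_add, neg_mul, neg_add_cancel, Real.exp_zero, one_mul]
  · intro μ hμ hsupp
    have hfin : M.carrier.Finite := Set.toFinite _
    refine one_sub_le_norm_convMeasure_of_overlap (MF := hfin.toFinset) hA hS
      (fun y hy => hM y (hfin.mem_toFinset.1 hy)) μ ?_
    rw [hfin.coe_toFinset]; exact hsupp

/-- Here K < 5/3, and the allowed dimension may be below 1, so M must be explicit. If `A + S` is a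
coset of a subgroup, that subgroup works with no loss. Otherwise K ≥ 3/2, which makes a
one-dimensional M admissible and forces ε > 1/2, so the bound |A + S + M| ≤ 2|A + S| suffices. -/
theorem exists_cosetProgression_of_doubling_lt [MeasurableSpace G] [DiscreteMeasurableSpace G]
    {A S : Finset G} {K ε : ℝ} (hA : A.Nonempty) (hS : S.Nonempty) (hK : 1 ≤ K)
    (hKA : ((A + S).card : ℝ) ≤ K * A.card) (hKS : ((A + S).card : ℝ) ≤ K * S.card)
    (hε0 : 0 < ε) (hε : ε ≤ 1)
    (hreg : ¬ (3 / 2 ≤ K ∧ (ε ≤ 1 / 2 ∨ 5 / 3 ≤ K))) :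
    ∃ (d : ℕ) (M : CosetProgression G d),
      M.Proper ∧
      (d : ℝ) ≤ 10 ^ 30 * ((ε ^ 2)⁻¹ * Real.log (ε⁻¹ * K) ^ 6) ∧
      (ε / max ε (2 * Real.log K)) ^ (10 ^ 30 * ((ε ^ 2)⁻¹ * Real.log (ε⁻¹ * K) ^ 6))
          * ((A + S).card : ℝ) ≤ (M.carrier.ncard : ℝ) ∧
      ∀ μ : MeasureTheory.Measure G,
        MeasureTheory.IsProbabilityMeasure μ → μ M.carrierᶜ = 0 →
          1 - ε ≤ ‖convMeasure (indicatorFn (A + S)) μ‖ ∧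
          (1 - ε) * ((A.card : ℝ) / ((A + S).card : ℝ)) ≤
            ‖convMeasure (indicatorFn A) μ‖ := by
  have hAc : (0 : ℝ) < A.card := by exact_mod_cast hA.card_pos
  have hSc : (0 : ℝ) < S.card := by exact_mod_cast hS.card_pos
  have hexp0 : 0 ≤ 10 ^ 30 * ((ε ^ 2)⁻¹ * Real.log (ε⁻¹ * K) ^ 6) := by positivity
  have hsmall : K < 5 / 3 := by
    by_contra! h
    exact hreg ⟨by linarith, Or.inr h⟩
  have h1 : 3 * (A + S).card < 5 * A.card := by
    have : 3 * ((A + S).card : ℝ) < 5 * A.card := by nlinarith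
    exact_mod_cast this
  have h2 : 3 * (A + S).card < 5 * S.card := by
    have : 3 * ((A + S).card : ℝ) < 5 * S.card := by nlinarith
    exact_mod_cast this
  obtain ⟨d, M, MF, hprop, hMF, hcard, hcase⟩ :=
    exists_cosetProgression_of_small_sumset hA hS h1 h2
  have hK32' : ¬ (2 * (A + S).card < 3 * A.card ∧ 2 * (A + S).card < 3 * S.card) → 3 / 2 ≤ K := by
    intro hnot
    by_contra! hlt
    refine hnot ⟨?_, ?_⟩
    · have : 2 * ((A + S).card : ℝ) < 3 * A.card := by nlinarith
      exact_mod_cast this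
    · have : 2 * ((A + S).card : ℝ) < 3 * S.card := by nlinarith
      exact_mod_cast this
  refine ⟨d, M, hprop, ?_, ?_, ?_⟩
  · rcases hcase with ⟨rfl, -⟩ | ⟨hd1, hnot, -⟩
    · simpa using hexp0
    · have hK32 := hK32' hnot
      have hinv : 1 ≤ ε⁻¹ := (one_le_inv₀ hε0).2 hε
      have hlog : 1 / 3 ≤ Real.log (ε⁻¹ * K) := one_third_le_log (by nlinarith)
      have hsq : 1 ≤ (ε ^ 2)⁻¹ := (one_le_inv₀ (by positivity)).2 (pow_le_one₀ hε0.le hε)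
      have hp : (1 / 3 : ℝ) ^ 6 ≤ Real.log (ε⁻¹ * K) ^ 6 := by gcongr
      have hd1' : (d : ℝ) ≤ 1 := by exact_mod_cast hd1
      have : 1 * (1 / 3 : ℝ) ^ 6 ≤ (ε ^ 2)⁻¹ * Real.log (ε⁻¹ * K) ^ 6 := by gcongr
      norm_num at this ⊢
      linarith
  · have h3 : (M.carrier.ncard : ℝ) = MF.card := by rw [← hMF, Set.ncard_coe_finset]
    rw [h3]
    calc _ ≤ 1 * ((A + S).card : ℝ) := by
          gcongr
          exact div_max_rpow_le_one hε0 hexp0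
      _ ≤ MF.card := by rw [one_mul]; exact_mod_cast hcard
  · intro μ hμ hsupp
    rw [← hMF] at hsupp
    have hquot : (0 : ℝ) ≤ (A.card : ℝ) / (A + S).card := by positivity
    have key : ∀ c : ℝ, 0 < c → 1 - ε ≤ c⁻¹ → ((A + S + MF).card : ℝ) ≤ c * (A + S).card →
        1 - ε ≤ ‖convMeasure (indicatorFn (A + S)) μ‖ ∧
        (1 - ε) * ((A.card : ℝ) / ((A + S).card : ℝ)) ≤ ‖convMeasure (indicatorFn A) μ‖ := by
      intro c hc hcε hcc
      obtain ⟨a, b⟩ := norm_convMeasure_ge_of_card_add_le hA hS hc hcc μ hsupp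
      refine ⟨hcε.trans a, le_trans ?_ b⟩
      gcongr
    rcases hcase with ⟨-, hle⟩ | ⟨-, hnot, hle⟩
    · exact key 1 one_pos (by rw [inv_one]; linarith) (by rw [one_mul]; exact_mod_cast hle)
    · have hK32 := hK32' hnot
      have hε2 : 1 / 2 < ε := by
        by_contra! h
        exact hreg ⟨hK32, Or.inl h⟩
      exact key 2 two_pos (by norm_num; linarith) (by exact_mod_cast hle)

end Main

/-- For a finite type `G` the norm on `G → ℝ` is the supremum norm. The size bound is that of
`(ε / (2 log K)) ^ O(⋯)`, where the base is read as `1` when `2 log K ≤ ε`. -/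
theorem mainTheorem2 :
    ∃ C : ℝ, 0 < C ∧
      ∀ (G : Type u) [AddCommGroup G] [Fintype G] [DecidableEq G]
        [MeasurableSpace G] [DiscreteMeasurableSpace G]
        (A S : Finset G) (K ε : ℝ),
        A.Nonempty → S.Nonempty →
        ((A + S).card : ℝ) ≤ K * min (A.card : ℝ) (S.card : ℝ) →
        0 < ε → ε ≤ 1 →
        ∃ (d : ℕ) (M : CosetProgression G d),
          M.Proper ∧
          (d : ℝ) ≤ C * ((ε ^ 2)⁻¹ * Real.log (ε⁻¹ * K) ^ 6) ∧
          (ε / max ε (2 * Real.log K)) ^ (C * ((ε ^ 2)⁻¹ * Real.log (ε⁻¹ * K) ^ 6))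
              * ((A + S).card : ℝ) ≤ (M.carrier.ncard : ℝ) ∧
          ∀ μ : MeasureTheory.Measure G,
            MeasureTheory.IsProbabilityMeasure μ → μ M.carrierᶜ = 0 →
              1 - ε ≤ ‖convMeasure (indicatorFn (A + S)) μ‖ ∧
              (1 - ε) * ((A.card : ℝ) / ((A + S).card : ℝ)) ≤
                ‖convMeasure (indicatorFn A) μ‖ := by
  refine ⟨10 ^ 30, by positivity, ?_⟩
  intro G _ _ _ _ _ A S K ε hA hS hKmin hε0 hε
  have hAc : (0 : ℝ) < A.card := by exact_mod_cast hA.card_pos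
  have hSc : (0 : ℝ) < S.card := by exact_mod_cast hS.card_pos
  have hAW : (A.card : ℝ) ≤ (A + S).card := by exact_mod_cast Finset.card_le_card_add_right hS
  have hmin : 0 < min (A.card : ℝ) S.card := lt_min hAc hSc
  have hK : 1 ≤ K := by
    refine le_of_mul_le_mul_right (a := min (A.card : ℝ) S.card) ?_ hmin
    rw [one_mul]
    exact (min_le_left _ _).trans (hAW.trans hKmin)
  have hKA : ((A + S).card : ℝ) ≤ K * A.card := hKmin.trans (by gcongr; exact min_le_left _ _)
  have hKS : ((A + S).card : ℝ) ≤ K * S.card := hKmin.trans (by gcongr; exact min_le_right _ _)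
  by_cases hreg : 3 / 2 ≤ K ∧ (ε ≤ 1 / 2 ∨ 5 / 3 ≤ K)
  · exact exists_cosetProgression_of_doubling_ge hA hS hK hKA hKS hε0 hε hreg.1 hreg.2
  · exact exists_cosetProgression_of_doubling_lt hA hS hK hKA hKS hε0 hε hreg
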